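/- **Conventions.** Repeated indices are summed. A formal power series in $q=(q_1,\dots,q_d)$ over $\mathbb R$ is written $S(q)=S_0+\varphi^iq_i+S^{ij}q_iq_j+\cdots$ with symmetric coefficients $S^{i_1\dots i_m}$ (so $S^i=\varphi^i$), and $\varphi=(\varphi^1,\dots,\varphi^d)\in\mathbb R^d$. A *functional power series* in an element $G$ of a real vector space is a formal sum $F[G]=\sum_{n\ge0}F_n[G]$ with $F_n$ a homogeneous polynomial map of degree $n$. Identities between functional power series hold order by order, i.e. as formal power series in $\lambda$ after replacing $G$ by $\lambda G$; a smooth function is evaluated at a tuple of formal power series by its Taylor series at the constant term. **Trees.** A *bipartite tree* $t$ has black vertices numbered $1,\dots,|t|_\bullet$ and white vertices numbered $1,\dots,|t|_\circ$, with edges only between vertices of different colours, such that the resulting graph is a tree (connected, without cycles, with at least one vertex). Isomorphisms are pairs of bijections of the black and of the white vertices that preserve edges, and $sym(t)$ is the automorphism group. $T^\circ$ is the set of bipartite trees without black vertices of degree one, and $[T^\circ]$ its set of isomorphism classes. For smooth $G$ let $$\langle S,G\rangle_t=\Big(\prod_{v\ \mathrm{black}}m_v!\,S^{e^v_1\dots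 e^v_{m_v}}\Big)\Big(\prod_{w\ \mathrm{white}}\partial_{e^w_1}\cdots\partial_{e^w_{m_w}}G(\varphi)\Big),$$ where $e^v_1,\dots,e^v_{m_v}$ are the edges at the vertex $v$, used as summation indices ranging over $1,\dots,d$. **1. General equation.** Let $V\subseteq\mathbb R^d$ be open (for instance $V=\mathbb R^d$) and let $S$ be a formal power series with $\varphi\in V$. There are unique functional power series $\bar q_i$, $\bar y^i$, $R(S,\cdot)$ in $G\in C^\infty(V)$ with $$\bar q_i=\partial_iG(\bar y),\qquad \bar y^i=\frac{\partial S}{\partial q_i}(\bar q),\qquad R(S,G)=S(\bar q)+G(\bar y)-\bar y^i\bar q_i,$$ and, as functional power series in $G$ (a tree $t$ contributing to order $|t|_\circ$, finitely many trees to each order), $$R(S,G)=\sum_{t\in T^\circ}\frac{1}{|t|_\circ!\,|t|_\bullet!}\langle S,G\rangle_t=\sum_{t\in[T^\circ]}\frac1{|sym(t)|}\langle S,G\rangle_t.$$ Moreover, isomorphic bipartite trees have equal terms $\langle S,G\rangle_t$, and the number of bipartite trees isomorphic to $t$ is $|t|_\circ!\,|t|_\bullet!/|sym(t)|$. **2.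 Pullbacks.** Let $U\subseteq\mathbb R^m$, $V\subseteq\mathbb R^d$ be open and let $S(x,q)=S_0(x)+\varphi^i(x)q_i+S^{ij}(x)q_iq_j+\cdots$ have coefficients smooth in $x\in U$, with $\varphi(U)\subseteq V$ (a generating function of a thick morphism $\Phi$ in local coordinates). For $x\in U$ there are unique functional power series $\bar q_i$, $\bar y^i$, $\Phi^*[g](x)$ in $g\in C^\infty(V)$ with $\bar q_i=\partial_ig(\bar y)$, $\bar y^i=\frac{\partial S}{\partial q_i}(x,\bar q)$, $\Phi^*[g](x)=g(\bar y)+S(x,\bar q)-\bar y^i\bar q_i$, and $$\Phi^*[g](x)=\sum_{t\in T^\circ}\frac{\langle S(x,\cdot),g\rangle_t}{|t|_\circ!\,|t|_\bullet!}=\sum_{t\in[T^\circ]}\frac{\langle S(x,\cdot),g\rangle_t}{|sym(t)|}.$$ **3. Compositions.** Let $F(x,q)$ be as $S(x,q)$ in 2, and let $G(y,r)=G_0(y)+\gamma^i(y)r_i+G^{ij}(y)r_ir_j+\cdots$ range over the formal power series in $r=(r_1,\dots,r_e)$ with coefficients smooth in $y\in V$. For $x\in U$ there are unique functional power series $\bar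 q_i$, $\bar y^i$, $H(x,r)$ in $G$, with values in $\mathbb R[[r]]$, such that $\bar q_i=\frac{\partial G}{\partial y^i}(\bar y,r)$, $\bar y^i=\frac{\partial F}{\partial q_i}(x,\bar q)$, $H(x,r)=G(\bar y,r)+F(x,\bar q)-\bar y^i\bar q_i$. Let $T^\circ_{\infty/2}$ be the set of trees $t\in T^\circ$ with a weight $\ell_w\in\mathbb Z_{\ge0}$ on each white vertex $w$ (isomorphisms preserve weights), $I_t=(a_{w,k})_{w,\,1\le k\le\ell_w}$, and let $\langle F,G\rangle_t^{I_t}(x)$ be defined as above with $F(x,\cdot)$ for $S$ and with the factor $\partial_{e^w_1}\cdots\partial_{e^w_{m_w}}G^{a_{w,1}\dots a_{w,\ell_w}}(\varphi(x))$ at $w$. Then, with all indices in $I_t$ summed over and $r_{I_t}=\prod_{w,k}r_{a_{w,k}}$, $$H(x,r)=\sum_{t\in T^\circ_{\infty/2}}\frac{r_{I_t}}{|t|_\circ!\,|t|_\bullet!}\langle F,G\rangle^{I_t}_t(x)=\sum_{t\in[T^\circ_{\infty/2}]}\frac{r_{I_t}}{|sym(t)|}\langle F,G\rangle^{I_t}_t(x),$$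 as formal power series in $r$ and functional power series in $G$ (a tree $t$ contributing to order $|t|_\circ$ in $G$; finitely many trees contribute to each order in $G$ and each monomial in $r$). **4. Coordinate transformations.** Let $S(x,q)$ be as in 2, let $x=x(x')$ be a diffeomorphism from an open $U'\subseteq\mathbb R^m$ onto $U$, and let $y'=y'(y)$ be a diffeomorphism from $V$ onto an open subset of $\mathbb R^d$. For $x'\in U'$ there are unique formal power series $\bar q_i$, $\bar y^i$, $S'(x',q')$ in $q'=(q'_1,\dots,q'_d)$ with $\bar q_i=\frac{\partial y'^{a}}{\partial y^i}(\bar y)\,q'_a$, $\bar y^i=\frac{\partial S}{\partial q_i}(x(x'),\bar q)$, $S'(x',q')=S(x(x'),\bar q)+y'^a(\bar y)q'_a-\bar y^i\bar q_i$. With $\alpha_t=(a_w)_{w\ \mathrm{white}}$, and $\langle S,y'\rangle_t^{\alpha_t}(x')$ defined as above with $S(x(x'),\cdot)$ for $S$ and with the factor $\partial_{e^w_1}\cdots\partial_{e^w_{m_w}}y'^{a_w}(\varphi(x(x')))$ at the white vertex $w$, $$S'(x',q')=\sum_{t\in T^\circ}\frac{q'_{\alpha_t}}{|t|_\circ!\,|t|_\bullet!}\langle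 S,y'\rangle_t^{\alpha_t}(x')=\sum_{t\in[T^\circ]}\frac{q'_{\alpha_t}}{|sym(t)|}\langle S,y'\rangle_t^{\alpha_t}(x'),$$ with all indices in $\alpha_t$ summed over and $q'_{\alpha_t}=\prod_wq'_{a_w}$. -/

import Mathlib

open scoped ContDiff

noncomputable section

namespace Thick

/-! ### Formal power series and smooth functions -/

/-- Points of `ℝ^d`. -/
abbrev Pt (d : ℕ) : Type := Fin d → ℝ

/-- The symmetric coefficient tensor of a formal power series
`S(q) = S₀ + φ^i q_i + S^{ij} q_i q_j + ⋯`: `symCoeff S {i₁, …, i_m}` is `S^{i₁ … i_m}`.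
Symmetric tensors are encoded as functions of the multiset of their indices.  The tensor is
the coefficient of the monomial `q_{i₁} ⋯ q_{i_m}` divided by the number of distinct
rearrangements of `(i₁, …, i_m)`; see `coeff_eq_sum_symCoeff`. -/
def symCoeff {d : ℕ} (S : MvPowerSeries (Fin d) ℝ) (s : Multiset (Fin d)) : ℝ :=
  MvPowerSeries.coeff (Multiset.toFinsupp s) S *
    ((∏ i, ((s.count i).factorial : ℝ)) / (s.card.factorial : ℝ))

/-- `S(q) = ∑_m S^{i₁ … i_m} q_{i₁} ⋯ q_{i_m}`: the coefficient of `q^n` on the right is the sum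
of `S^{i₁ … i_m}` over all tuples with `q_{i₁} ⋯ q_{i_m} = q^n`. -/
theorem coeff_eq_sum_symCoeff {d : ℕ} (S : MvPowerSeries (Fin d) ℝ) (n : Fin d →₀ ℕ) :
    MvPowerSeries.coeff n S =
      ∑ i : Fin n.degree → Fin d with ∑ k, Finsupp.single (i k) 1 = n,
        symCoeff S (Finset.univ.val.map i) := by
  classical
  have key : (((Finset.univ.filter fun i : Fin n.degree → Fin d =>
      ∑ k, Finsupp.single (i k) 1 = n).card : ℕ) : ℝ) =
      (Nat.multinomial Finset.univ n : ℝ) := by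
    have h := congrArg (MvPolynomial.coeff n)
      ((Fintype.sum_pow (fun a : Fin d => (MvPolynomial.X a : MvPolynomial (Fin d) ℝ))
        n.degree).symm.trans
        (Finset.sum_pow_eq_sum_piAntidiag Finset.univ _ n.degree))
    have h1 : ∀ i : Fin n.degree → Fin d, (∏ k, (MvPolynomial.X (i k) : MvPolynomial (Fin d) ℝ))
        = MvPolynomial.monomial (∑ k, Finsupp.single (i k) 1) 1 := by
      intro i
      rw [MvPolynomial.monomial_sum_one]
      rfl
    have h2 : ∀ k : Fin d → ℕ, (∏ i, (MvPolynomial.X i : MvPolynomial (Fin d) ℝ) ^ k i)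
        = MvPolynomial.monomial (Finsupp.equivFunOnFinite.symm k) 1 := by
      intro k
      rw [MvPolynomial.monomial_eq, Finsupp.prod_fintype _ _ (by simp)]
      simp
    simp only [h1, h2, MvPolynomial.coeff_sum, MvPolynomial.coeff_monomial] at h
    rw [Finset.sum_boole] at h
    rw [h, Finset.sum_eq_single (n : Fin d → ℕ)]
    · rw [← map_natCast (MvPolynomial.C : ℝ →+* MvPolynomial (Fin d) ℝ), MvPolynomial.coeff_C_mul]
      simp
    · intro b _ hb
      rw [← map_natCast (MvPolynomial.C : ℝ →+* MvPolynomial (Fin d) ℝ), MvPolynomial.coeff_C_mul,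
        MvPolynomial.coeff_monomial, if_neg, mul_zero]
      intro h'
      exact hb (by rw [← h']; rfl)
    · intro h'
      exact absurd (by simp [Finsupp.degree_eq_sum]) h'
  have hs : ∀ i ∈ (Finset.univ.filter fun i : Fin n.degree → Fin d =>
      ∑ k, Finsupp.single (i k) 1 = n), symCoeff S (Finset.univ.val.map i) =
      MvPowerSeries.coeff n S * ((∏ i, ((n i).factorial : ℝ)) / (n.degree.factorial : ℝ)) := by
    intro i hi
    have hi' := (Finset.mem_filter.1 hi).2
    have hm : Multiset.toFinsupp (Finset.univ.val.map i) = n := by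
      refine Eq.trans ?_ hi'
      have : Finset.univ.val.map i = ∑ k, ({i k} : Multiset (Fin d)) := by
        have h3 := Multiset.sum_map_singleton (Finset.univ.val.map i)
        rw [Multiset.map_map] at h3
        exact h3.symm
      rw [this, map_sum]
      simp
    have hc : ∀ a, (Finset.univ.val.map i).count a = n a := by
      intro a
      have h4 := DFunLike.congr_fun hm a
      rwa [Multiset.toFinsupp_apply] at h4
    unfold symCoeff
    rw [hm]
    simp only [hc]
    simp
  rw [Finset.sum_congr rfl hs, Finset.sum_const, nsmul_eq_mul, key]
  have hspec := Nat.multinomial_spec (Finset.univ : Finset (Fin d)) n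
  rw [← Finsupp.degree_eq_sum] at hspec
  have hspec' : (∏ i, ((n i).factorial : ℝ)) * (Nat.multinomial Finset.univ n : ℝ) =
      (n.degree.factorial : ℝ) := by exact_mod_cast hspec
  have h0 : (n.degree.factorial : ℝ) ≠ 0 := by positivity
  field_simp
  rw [← hspec']
  ring

/-- The point `φ = (φ^1, …, φ^d)` of linear coefficients of `S(q) = S₀ + φ^i q_i + ⋯`. -/
def linearPart {d : ℕ} (S : MvPowerSeries (Fin d) ℝ) : Pt d :=
  fun i => MvPowerSeries.coeff (Finsupp.single i 1) S

/-- The iterated partial derivative `∂_{i₁} ⋯ ∂_{i_m} f (a)`, where `l = [i₁, …, i_m]`. -/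
def listPartial {d : ℕ} (l : List (Fin d)) (f : Pt d → ℝ) (a : Pt d) : ℝ :=
  iteratedFDeriv ℝ l.length f a (fun k => Pi.single (l.get k) 1)

/-- The mixed partial derivative `∂_{i₁} ⋯ ∂_{i_m} f (a)`, where `s = {i₁, …, i_m}`.  (The
indices are listed in increasing order; for smooth `f` the order is immaterial.) -/
def mixedPartial {d : ℕ} (s : Multiset (Fin d)) (f : Pt d → ℝ) (a : Pt d) : ℝ :=
  listPartial s.sort f a

/-- The formal Taylor series `∑_α ∂^α f(a) / α! · h^α` of `f` at `a`. -/
def taylorAt {d : ℕ} (f : Pt d → ℝ) (a : Pt d) : MvPowerSeries (Fin d) ℝ :=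
  fun α => mixedPartial (Finsupp.toMultiset α) f a / ∏ i, ((α i).factorial : ℝ)

/-- The value `f(y)` of a smooth function at a tuple of formal power series `y`: the Taylor
series of `f` at the constant term `y₀` of `y`, with `y - y₀` substituted into it. -/
def evalSmooth {σ : Type} {d : ℕ} (f : Pt d → ℝ) (y : Fin d → MvPowerSeries σ ℝ) :
    MvPowerSeries σ ℝ :=
  MvPowerSeries.subst
    (fun i => y i - MvPowerSeries.C (MvPowerSeries.constantCoeff (y i)))
    (taylorAt f (fun i => MvPowerSeries.constantCoeff (y i)))

/-- The value `G(y)` of a function `G` with values in formal power series,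
`G(z) = ∑_n G_n(z) X^n`, at a tuple of formal power series `y`: this is `∑_n G_n(y) X^n`. -/
def evalFamily {σ : Type} [DecidableEq σ] {d : ℕ} (G : Pt d → MvPowerSeries σ ℝ)
    (y : Fin d → MvPowerSeries σ ℝ) : MvPowerSeries σ ℝ :=
  fun m => ∑ p ∈ Finset.HasAntidiagonal.antidiagonal m,
    MvPowerSeries.coeff p.2 (evalSmooth (fun z => MvPowerSeries.coeff p.1 (G z)) y)

/-- The coefficientwise partial derivative `∂G/∂y^i` of a function with values in formal power
series. -/
def familyPartial {σ : Type} {d : ℕ} (i : Fin d) (G : Pt d → MvPowerSeries σ ℝ) :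
    Pt d → MvPowerSeries σ ℝ :=
  fun z n => fderiv ℝ (fun z' => MvPowerSeries.coeff n (G z')) z (Pi.single i 1)

/-- The space `C^∞(V)` of smooth real functions on an open set `V ⊆ ℝ^d` (values outside `V`
play no role). -/
def SmoothFn {d : ℕ} (V : Set (Pt d)) : Submodule ℝ (Pt d → ℝ) where
  carrier := {f | ContDiffOn ℝ ∞ f V}
  add_mem' hf hg := ContDiffOn.add hf hg
  zero_mem' := contDiffOn_const
  smul_mem' c _ hf := ContDiffOn.const_smul c hf

/-- The space of formal power series `G(y, r) = G₀(y) + γ^i(y) r_i + G^{ij}(y) r_i r_j + ⋯` in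
`r = (r_1, …, r_e)` whose coefficients are smooth functions of `y ∈ V`. -/
def SmoothFamily {d : ℕ} (V : Set (Pt d)) (e : ℕ) :
    Submodule ℝ (Pt d → MvPowerSeries (Fin e) ℝ) where
  carrier := {G | ∀ n, ContDiffOn ℝ ∞ (fun y => MvPowerSeries.coeff n (G y)) V}
  add_mem' hf hg n := by
    simpa using ContDiffOn.add (hf n) (hg n)
  zero_mem' n := by
    simpa using (contDiffOn_const : ContDiffOn ℝ ∞ (fun _ : Pt d => (0 : ℝ)) V)
  smul_mem' c _ hf n := by
    simpa using ContDiffOn.const_smul c (hf n)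

/-! ### Functional power series -/

/-- A formal functional power series `F[G] = F₀ + F₁[G] + F₂[G] + ⋯` in `G ∈ E`, with values
in `A`: its component of order `n` is a homogeneous polynomial map of degree `n`, i.e. the
restriction to the diagonal of an `n`-linear map. -/
@[ext]
structure FunctionalPowerSeries (E A : Type) [AddCommGroup E] [Module ℝ E]
    [AddCommGroup A] [Module ℝ A] where
  /-- The component of order `n`. -/
  comp : ℕ → E → A
  homogeneous : ∀ n, ∃ M : MultilinearMap ℝ (fun _ : Fin n => E) A,
    ∀ G, comp n G = M (fun _ => G)

/-- The formal power series `F[λG] = ∑_n λ^n F_n[G]` in the one variable `λ`, which records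
the order in `G`. -/
def FunctionalPowerSeries.series {E : Type} [AddCommGroup E] [Module ℝ E]
    (F : FunctionalPowerSeries E ℝ) (G : E) : MvPowerSeries Unit ℝ :=
  fun n => F.comp (n ()) G

/-- The same for a functional power series whose values are formal power series in variables
`r_j`: `∑_n λ^n F_n[G](r)`, where the variable `none` is `λ` and `some j` is `r_j`. -/
def FunctionalPowerSeries.paramSeries {E : Type} [AddCommGroup E] [Module ℝ E] {e : ℕ}
    (F : FunctionalPowerSeries E (MvPowerSeries (Fin e) ℝ)) (G : E) :
    MvPowerSeries (Option (Fin e)) ℝ :=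
  fun n => MvPowerSeries.coeff n.some (F.comp (n none) G)

/-- `λ G(y)`. -/
def scaled {d : ℕ} (G : Pt d → ℝ) : Pt d → MvPowerSeries Unit ℝ :=
  fun y => MvPowerSeries.X () * MvPowerSeries.C (G y)

/-- `λ G(y, r)`: the coefficient of `λ^k r^m` is that of `r^m` in `G(y, r)` if `k = 1`, and `0`
otherwise. -/
def scaledParam {d e : ℕ} (G : Pt d → MvPowerSeries (Fin e) ℝ) :
    Pt d → MvPowerSeries (Option (Fin e)) ℝ :=
  fun y n => if n none = 1 then MvPowerSeries.coeff n.some (G y) else 0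

/-! ### The equations -/

/-- The system `q_i = ∂G/∂y^i (y)`, `y^i = ∂S/∂q_i (q)` for tuples of formal power series. -/
structure SolvesSystem {σ : Type} [DecidableEq σ] {d : ℕ} (S : MvPowerSeries (Fin d) ℝ)
    (G : Pt d → MvPowerSeries σ ℝ) (q y : Fin d → MvPowerSeries σ ℝ) : Prop where
  q_eq : ∀ i, q i = evalFamily (familyPartial i G) y
  y_eq : ∀ i, y i = MvPowerSeries.subst q (MvPowerSeries.pderiv ℝ i S)

/-- `S(q) + G(y) - y^i q_i`. -/
def resultOf {σ : Type} [DecidableEq σ] {d : ℕ} (S : MvPowerSeries (Fin d) ℝ)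
    (G : Pt d → MvPowerSeries σ ℝ) (q y : Fin d → MvPowerSeries σ ℝ) : MvPowerSeries σ ℝ :=
  MvPowerSeries.subst q S + evalFamily G y - ∑ i, y i * q i

/-- `q`, `y` are functional power series in `G ∈ C^∞(V)` which solve
`q_i = ∂_i G(y)`, `y^i = ∂^i S(q)`, and `R[G] = S(q) + G(y) - y^i q_i`, as functional power
series in `G`, i.e. order by order in `λ` after replacing `G` by `λG`. -/
def SolvesGeneral {d : ℕ} (V : Set (Pt d)) (S : MvPowerSeries (Fin d) ℝ)
    (q y : Fin d → FunctionalPowerSeries (SmoothFn V) ℝ)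
    (R : FunctionalPowerSeries (SmoothFn V) ℝ) : Prop :=
  ∀ G : SmoothFn V,
    SolvesSystem S (scaled G.1) (fun i => (q i).series G) (fun i => (y i).series G) ∧
    R.series G = resultOf S (scaled G.1) (fun i => (q i).series G) (fun i => (y i).series G)

/-- The same for `G = G(y, r)` a formal power series in parameters `r`. -/
def SolvesGeneralParam {d : ℕ} (V : Set (Pt d)) (e : ℕ) (S : MvPowerSeries (Fin d) ℝ)
    (q y : Fin d → FunctionalPowerSeries (SmoothFamily V e) (MvPowerSeries (Fin e) ℝ))
    (R : FunctionalPowerSeries (SmoothFamily V e) (MvPowerSeries (Fin e) ℝ)) : Prop :=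
  ∀ G : SmoothFamily V e,
    SolvesSystem S (scaledParam G.1) (fun i => (q i).paramSeries G)
      (fun i => (y i).paramSeries G) ∧
    R.paramSeries G = resultOf S (scaledParam G.1) (fun i => (q i).paramSeries G)
      (fun i => (y i).paramSeries G)

/-- The generating function `S(x, q) = S₀(x) + φ^i(x) q_i + S^{ij}(x) q_i q_j + ⋯`, in local
coordinates `x ∈ U` and `y ∈ V`, of a thick morphism: the coefficients are smooth functions of
`x ∈ U`, and `φ` maps `U` to `V`. -/
structure GeneratingFunction {m d : ℕ} (U : Set (Pt m)) (V : Set (Pt d)) where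
  toFun : Pt m → MvPowerSeries (Fin d) ℝ
  smooth : ∀ n, ContDiffOn ℝ ∞ (fun x => MvPowerSeries.coeff n (toFun x)) U
  mapsTo : ∀ x ∈ U, linearPart (toFun x) ∈ V

/-- `P x` is the value `g ↦ Φ^*[g](x)` at `x ∈ U` of the pullback by the thick morphism with
generating function `S`: `Φ^*[g](x) = g(y) + S(x, q) - y^i q_i` with `q_i = ∂_i g(y)`,
`y^i = ∂^i S(x, q)`, where `q`, `y` and the result are functional power series in `g`. -/
def IsPullback {m d : ℕ} {U : Set (Pt m)} {V : Set (Pt d)} (S : GeneratingFunction U V)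
    (q y : U → Fin d → FunctionalPowerSeries (SmoothFn V) ℝ)
    (P : U → FunctionalPowerSeries (SmoothFn V) ℝ) : Prop :=
  ∀ x : U, SolvesGeneral V (S.toFun x) (q x) (y x) (P x)

/-- `H x` is the generating function `H(x, r)` of the composition of the thick morphisms with
generating functions `F(x, q)` and `G(y, r)`: `H(x, r) = G(y, r) + F(x, q) - y^i q_i` with
`q_i = ∂_i G(y, r)`, `y^i = ∂^i F(x, q)`, where `q`, `y` and the result are formal power series
in `r` and functional power series in `G`. -/
def IsComposition {m d : ℕ} {U : Set (Pt m)} {V : Set (Pt d)} (e : ℕ)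
    (F : GeneratingFunction U V)
    (q y : U → Fin d → FunctionalPowerSeries (SmoothFamily V e) (MvPowerSeries (Fin e) ℝ))
    (H : U → FunctionalPowerSeries (SmoothFamily V e) (MvPowerSeries (Fin e) ℝ)) : Prop :=
  ∀ x : U, SolvesGeneralParam V e (F.toFun x) (q x) (y x) (H x)

/-- An invertible smooth change of coordinates between open sets `e.source` and `e.target`. -/
def IsCoordChange {m : ℕ} (e : OpenPartialHomeomorph (Pt m) (Pt m)) : Prop :=
  ContDiffOn ℝ ∞ e e.source ∧ ContDiffOn ℝ ∞ e.symm e.target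

/-- The function `y^{α'}(y) q'_{α'}`, linear in the new momenta `q'`. -/
def coordFamily {d : ℕ} (Y : Pt d → Pt d) : Pt d → MvPowerSeries (Fin d) ℝ :=
  fun y => ∑ a, MvPowerSeries.C (Y y a) * MvPowerSeries.X a

/-- `S' x'` is the generating function `S'(x', q')` obtained from `S(x, q)` by the change of
coordinates `x = X(x')`, `y' = Y(y)`:
`S'(x', q') = S(X(x'), q) + Y^{α'}(y) q'_{α'} - y^i q_i` with
`q_i = ∂_i (Y^{α'} q'_{α'})(y)`, `y^i = ∂^i S(X(x'), q)`, where `q`, `y` are formal power series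
in `q'`. -/
def IsCoordTransform {m d : ℕ} {U : Set (Pt m)} {V : Set (Pt d)} (S : GeneratingFunction U V)
    (X : OpenPartialHomeomorph (Pt m) (Pt m)) (Y : OpenPartialHomeomorph (Pt d) (Pt d))
    (q y : X.source → Fin d → MvPowerSeries (Fin d) ℝ)
    (S' : X.source → MvPowerSeries (Fin d) ℝ) : Prop :=
  ∀ x' : X.source,
    SolvesSystem (S.toFun (X x')) (coordFamily Y) (q x') (y x') ∧
    S' x' = resultOf (S.toFun (X x')) (coordFamily Y) (q x') (y x')

/-! ### Bipartite trees -/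

/-- The graph on the black vertices `Fin nB` and the white vertices `Fin nW` with the given
edges. -/
def bipartiteGraph {nB nW : ℕ} (edges : Finset (Fin nB × Fin nW)) :
    SimpleGraph (Fin nB ⊕ Fin nW) :=
  SimpleGraph.fromRel fun u v => ∃ b w, u = Sum.inl b ∧ v = Sum.inr w ∧ (b, w) ∈ edges

/-- A bipartite tree with numbered black vertices and numbered white vertices.  (A tree has no
multiple edges, so its edges form a set.) -/
structure BipartiteTree where
  nB : ℕ
  nW : ℕ
  edges : Finset (Fin nB × Fin nW)
  isTree : (bipartiteGraph edges).IsTree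

namespace BipartiteTree

/-- The edges at the black vertex `b`. -/
def edgesAtBlack (t : BipartiteTree) (b : Fin t.nB) : Finset t.edges :=
  Finset.univ.filter fun e => e.1.1 = b

/-- The edges at the white vertex `w`. -/
def edgesAtWhite (t : BipartiteTree) (w : Fin t.nW) : Finset t.edges :=
  Finset.univ.filter fun e => e.1.2 = w

/-- All leaves, i.e. vertices of degree one, are white. -/
def WhiteLeaved (t : BipartiteTree) : Prop :=
  ∀ b, (t.edgesAtBlack b).card ≠ 1

/-- An isomorphism of bipartite trees. -/
structure Iso (t t' : BipartiteTree) where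
  black : Fin t.nB ≃ Fin t'.nB
  white : Fin t.nW ≃ Fin t'.nW
  map_edges : ∀ b w, (b, w) ∈ t.edges ↔ (black b, white w) ∈ t'.edges

/-- The order of the group `sym(t)` of automorphisms of `t`. -/
def symCard (t : BipartiteTree) : ℕ := Nat.card (Iso t t)

/-- The contraction of the factors `m_v! S^{e_1 … e_{m_v}}` at the black vertices with factors
`D w {e_1, …, e_{m_w}}` at the white vertices: the edges are used as indices, and one sums over
all their values. -/
def contraction {d : ℕ} (S : MvPowerSeries (Fin d) ℝ) (t : BipartiteTree)
    (D : Fin t.nW → Multiset (Fin d) → ℝ) : ℝ :=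
  ∑ l : t.edges → Fin d,
    (∏ b, ((t.edgesAtBlack b).card.factorial : ℝ) * symCoeff S ((t.edgesAtBlack b).val.map l)) *
      ∏ w, D w ((t.edgesAtWhite w).val.map l)

/-- The term `⟨S, G⟩_t`, with factors `∂ ⋯ ∂ G(φ)` at the white vertices. -/
def term {d : ℕ} (S : MvPowerSeries (Fin d) ℝ) (G : Pt d → ℝ) (t : BipartiteTree) : ℝ :=
  contraction S t fun _ s => mixedPartial s G (linearPart S)

/-- The term `⟨S, Y⟩_t^{a}` for `a = (a_w)_w`, with factors `∂ ⋯ ∂ Y^{a_w}(φ)` at the white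
vertices `w`. -/
def coordTerm {d : ℕ} (S : MvPowerSeries (Fin d) ℝ) (Y : Pt d → Pt d) (t : BipartiteTree)
    (a : Fin t.nW → Fin d) : ℝ :=
  contraction S t fun w s => mixedPartial s (fun y => Y y (a w)) (linearPart S)

end BipartiteTree

/-- The set `T^∘` of bipartite trees with white leaves only. -/
abbrev WhiteLeavedTree : Type := {t : BipartiteTree // t.WhiteLeaved}

/-- Isomorphism of white-leaved trees. -/
instance WhiteLeavedTree.isoSetoid : Setoid WhiteLeavedTree where
  r t t' := Nonempty (BipartiteTree.Iso t.1 t'.1)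
  iseqv :=
    { refl := fun _ => ⟨⟨Equiv.refl _, Equiv.refl _, fun _ _ => Iff.rfl⟩⟩
      symm := fun ⟨f⟩ => ⟨⟨f.black.symm, f.white.symm, fun b w => by
        simpa using (f.map_edges (f.black.symm b) (f.white.symm w)).symm⟩⟩
      trans := fun ⟨f⟩ ⟨g⟩ => ⟨⟨f.black.trans g.black, f.white.trans g.white, fun b w =>
        (f.map_edges b w).trans (g.map_edges _ _)⟩⟩ }

/-- The set `[T^∘]` of isomorphism classes. -/
abbrev WhiteLeavedClass : Type := Quotient WhiteLeavedTree.isoSetoid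

/-- A representative of an isomorphism class. -/
def WhiteLeavedClass.rep (c : WhiteLeavedClass) : BipartiteTree := (Quotient.out c).1

/-! ### White-weighted trees -/

/-- A white-weighted bipartite tree with white leaves only. -/
structure WeightedTree where
  tree : BipartiteTree
  whiteLeaved : tree.WhiteLeaved
  weight : Fin tree.nW → ℕ

namespace WeightedTree

/-- An isomorphism of white-weighted trees. -/
structure Iso (t t' : WeightedTree) extends BipartiteTree.Iso t.tree t'.tree where
  map_weight : ∀ w, t'.weight (white w) = t.weight w

/-- The order of the automorphism group of a white-weighted tree. -/
def symCard (t : WeightedTree) : ℕ := Nat.card (Iso t t)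

/-- Isomorphism of white-weighted trees. -/
instance isoSetoid : Setoid WeightedTree where
  r t t' := Nonempty (Iso t t')
  iseqv :=
    { refl := fun _ => ⟨⟨⟨Equiv.refl _, Equiv.refl _, fun _ _ => Iff.rfl⟩, fun _ => rfl⟩⟩
      symm := fun ⟨f⟩ => ⟨⟨⟨f.black.symm, f.white.symm, fun b w => by
        simpa using (f.map_edges (f.black.symm b) (f.white.symm w)).symm⟩, fun w => by
        simpa using (f.map_weight (f.white.symm w)).symm⟩⟩
      trans := fun ⟨f⟩ ⟨g⟩ => ⟨⟨⟨f.black.trans g.black, f.white.trans g.white, fun b w =>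
        (f.map_edges b w).trans (g.map_edges _ _)⟩, fun w =>
        (g.map_weight _).trans (f.map_weight w)⟩⟩ }

/-- The multi-indices `I_t = ∏_w a_{w,1} ⋯ a_{w,ℓ_w}`, `ℓ_w` the weight of `w`. -/
abbrev Index (t : WeightedTree) (e : ℕ) : Type :=
  (w : Fin t.tree.nW) → Fin (t.weight w) → Fin e

/-- The term `⟨F, G⟩_t^{I}`, with factors `∂ ⋯ ∂ G^{a_{w,1} … a_{w,ℓ_w}}(φ)` at the white
vertices `w`. -/
def term {d e : ℕ} (F : MvPowerSeries (Fin d) ℝ) (G : Pt d → MvPowerSeries (Fin e) ℝ)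
    (t : WeightedTree) (I : t.Index e) : ℝ :=
  t.tree.contraction F fun w s =>
    mixedPartial s (fun y => symCoeff (G y) (Finset.univ.val.map (I w))) (linearPart F)

/-- `λ^{|t|_∘} r_{I_t} ⟨F, G⟩_t^{I_t}`, summed over all values of the indices in `I_t`, where
`λ` (the variable `none`) records the order in `G`. -/
def contracted {d e : ℕ} (F : MvPowerSeries (Fin d) ℝ) (G : Pt d → MvPowerSeries (Fin e) ℝ)
    (t : WeightedTree) : MvPowerSeries (Option (Fin e)) ℝ :=
  MvPowerSeries.X none ^ t.tree.nW *
    ∑ I : t.Index e, MvPowerSeries.C (t.term F G I) *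
      ∏ w, ∏ k, MvPowerSeries.X (some (I w k))

end WeightedTree

/-- The set of isomorphism classes of white-weighted trees with white leaves only. -/
abbrev WeightedClass : Type := Quotient WeightedTree.isoSetoid

/-- A representative of an isomorphism class. -/
def WeightedClass.rep (c : WeightedClass) : WeightedTree := Quotient.out c

namespace BipartiteTree

/-- `λ^{|t|_∘} ⟨S, G⟩_t`, where `λ` records the order in `G`. -/
def ordered {d : ℕ} (S : MvPowerSeries (Fin d) ℝ) (G : Pt d → ℝ) (t : BipartiteTree) :
    MvPowerSeries Unit ℝ :=
  MvPowerSeries.X () ^ t.nW * MvPowerSeries.C (t.term S G)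

/-- `q'_{α_t} ⟨S, Y⟩_t^{α_t}`, summed over all values of the indices in `α_t`. -/
def coordContracted {d : ℕ} (S : MvPowerSeries (Fin d) ℝ) (Y : Pt d → Pt d)
    (t : BipartiteTree) : MvPowerSeries (Fin d) ℝ :=
  ∑ a : Fin t.nW → Fin d, MvPowerSeries.C (t.coordTerm S Y a) * ∏ w, MvPowerSeries.X (a w)

/-- The number `1 / (|t|_∘! |t|_•!)`. -/
def labelFactor (t : BipartiteTree) : ℝ :=
  1 / ((t.nW.factorial : ℝ) * (t.nB.factorial : ℝ))

end BipartiteTree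

/-- `s` is the sum of the family `f` as a formal power series: for each monomial only finitely
many members of the family contribute, and their contributions add up to the coefficient of
`s`. -/
def HasFormalSum {T σ : Type} (f : T → MvPowerSeries σ ℝ) (s : MvPowerSeries σ ℝ) : Prop :=
  ∀ n, (Function.support fun t => MvPowerSeries.coeff n (f t)).Finite ∧
    ∑ᶠ t, MvPowerSeries.coeff n (f t) = MvPowerSeries.coeff n s

end Thick

end

/-! The value of an action at its critical point is a sum over trees, because a tree has exactly one
vertex more than it has edges. All four assertions are instances of one statement about a family
`G(y)` of power series that is linear for a grading `deg` (`IsLinearFamily`): the exponent of `λ` in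
the first three cases, the total degree in `q'` for coordinate transformations.

Forget the two colours. Consider trees on a finite vertex set whose edges are directed and labelled
by indices, and give every vertex a factor `F` depending on the labels of its half-edges (`inl i`
outgoing, `inr i` incoming). Let `B_h` be the exponential generating series of the trees with one
free half-edge that can be glued to a half-edge `h`. Cutting all edges at a root shows that the
trees whose root has labels `s` sum to `∏ B_h^{s_h} / s_h!` (`Admissible.markedSeries_select`), so a
root with factor `K` contributes `∑_s K(s) B^s / s!`, the value of `K` at `B`. Counting each tree
with (vertices − edges) = 1, and cutting the marked edge in the second term, gives: all trees =
(value of `F` at `B`) `− ∑_i B_{inl i} B_{inr i}` (`Admissible.hasFormalSum_treeCoeff`).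

Now let `F` be a sum of a black factor, the tensors of `S` without linear part, with outgoing
half-edges only, and a white factor, the derivatives of `G` at `φ`, with incoming half-edges only.
For `q_i = B_{inl i}` and `h^i = B_{inr i}` the description of a branch by the branches at its root
is exactly `q_i = ∂_i G(φ + h)`, `φ^i + h^i = ∂S/∂q_i (q)`: the branch series solve the system
(`solvesSystem_solution`). The formula for all trees becomes `S(q) − φ^i q_i + G(φ + h) − h^i q_i`,
the required result at `y = φ + h` (`resultOf_solution`). The linear part of `S` is used up by the
choice of the expansion point, which is why black leaves do not occur; this also bounds the size of
the trees of a given order (`Admissible.card_le`).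

Expanding the product of the sums black + white colours the vertices and turns `1/n!` into
`1/(|t|_∘! |t|_•!)` (`treeCoeff_vertexFactor`). Renumberings act on trees with the automorphisms as
stabilisers, which gives the sums over isomorphism classes. Weights appear when the white factors
are expanded in the degree in `r`.

Uniqueness is an order by order argument (`SolvesSystem.sub_mem`). That the solution is a functional
power series holds because each coefficient is a finite sum, over a range independent of `G`, of
products of factors which are constant or linear in `G`. -/

set_option linter.unusedSectionVars false
open scoped ContDiff
noncomputable section
namespace Thick
open Finset

/-! ### Labelled directed trees: cutting and joining along an edge. -/

section Trees
variable {V J : Type} [DecidableEq V] [DecidableEq J]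

/-- `Q` is a union of connected components: no edge of `E` leaves `Q`. -/
def EdgeClosed (E : Finset (V × V × J)) (Q : Finset V) : Prop :=
  ∀ e ∈ E, e.1 ∈ Q ↔ e.2.1 ∈ Q

/-- The labelled directed edges `E` form a connected graph with vertex set `P`. -/
structure ConnectedOn (P : Finset V) (E : Finset (V × V × J)) : Prop where
  inside : ∀ e ∈ E, e.1 ∈ P ∧ e.2.1 ∈ P
  nonempty : P.Nonempty
  conn : ∀ Q ⊆ P, Q.Nonempty → EdgeClosed E Q → Q = P

/-- The labelled directed edges `E` form a tree with vertex set `P`. -/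
structure SpansTree (P : Finset V) (E : Finset (V × V × J)) : Prop extends ConnectedOn P E where
  card_eq : E.card + 1 = P.card

theorem EdgeClosed.sdiff {P Q : Finset V} {E : Finset (V × V × J)}
    (hE : ∀ e ∈ E, e.1 ∈ P ∧ e.2.1 ∈ P) (h : EdgeClosed E Q) : EdgeClosed E (P \ Q) := by
  intro e he
  have := h e he
  have := hE e he
  simp only [mem_sdiff]
  tauto

/-- Deleting an edge from a connected graph leaves it connected or splits it into two connected
parts, each containing one end of the edge. -/
theorem ConnectedOn.erase {P : Finset V} {E : Finset (V × V × J)} (h : ConnectedOn P E)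
    {e : V × V × J} (he : e ∈ E) :
    ConnectedOn P (E.erase e) ∨ ∃ C ⊆ P, e.1 ∈ C ∧ e.2.1 ∈ P \ C ∧ EdgeClosed (E.erase e) C ∧
      ConnectedOn C ((E.erase e).filter fun x => x.1 ∈ C) ∧
      ConnectedOn (P \ C) ((E.erase e).filter fun x => x.1 ∉ C) := by
  classical
  -- The component of the tail of `e` after deletion, as the intersection of all closed sets
  -- containing that tail. The two cases of the statement are whether the head of `e` still lies in
  -- it.
  set C : Finset V := P.filter fun x => ∀ Q ⊆ P, EdgeClosed (E.erase e) Q → e.1 ∈ Q → x ∈ Q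
    with hC
  have hin : ∀ x ∈ E.erase e, x.1 ∈ P ∧ x.2.1 ∈ P := fun x hx => h.inside x (mem_of_mem_erase hx)
  have hCP : C ⊆ P := filter_subset _ _
  have he1 : e.1 ∈ C := mem_filter.2 ⟨(h.inside e he).1, fun _ _ _ hQ => hQ⟩
  have hmin : ∀ Q ⊆ P, EdgeClosed (E.erase e) Q → e.1 ∈ Q → C ⊆ Q :=
    fun Q hQ hQc heQ x hx => (mem_filter.1 hx).2 Q hQ hQc heQ
  have hCc : EdgeClosed (E.erase e) C := by
    intro x hx
    have := hin x hx
    simp only [hC, mem_filter, this, true_and]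
    exact ⟨fun hh Q hQ hQc heQ => (hQc x hx).1 (hh Q hQ hQc heQ),
      fun hh Q hQ hQc heQ => (hQc x hx).2 (hh Q hQ hQc heQ)⟩
  have hfull : ∀ Q, EdgeClosed (E.erase e) Q → (e.1 ∈ Q ↔ e.2.1 ∈ Q) → EdgeClosed E Q := by
    intro Q hQ heQ x hx
    by_cases hxe : x = e
    · rw [hxe]; exact heQ
    · exact hQ x (mem_erase.2 ⟨hxe, hx⟩)
  by_cases he2 : e.2.1 ∈ C
  · left
    refine ⟨hin, h.nonempty, fun Q hQ hQn hQc => h.conn Q hQ hQn (hfull Q hQc ?_)⟩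
    by_cases h1 : e.1 ∈ Q
    · exact iff_of_true h1 (hmin Q hQ hQc h1 he2)
    · have := hmin (P \ Q) sdiff_subset (hQc.sdiff hin) (mem_sdiff.2 ⟨hCP he1, h1⟩) he2
      exact iff_of_false h1 (mem_sdiff.1 this).2
  · right
    refine ⟨C, hCP, he1, mem_sdiff.2 ⟨(h.inside e he).2, he2⟩, hCc, ⟨?_, ⟨_, he1⟩, ?_⟩,
      ⟨?_, ⟨_, mem_sdiff.2 ⟨(h.inside e he).2, he2⟩⟩, ?_⟩⟩
    · intro x hx
      obtain ⟨hx1, hx2⟩ := mem_filter.1 hx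
      exact ⟨hx2, (hCc x hx1).1 hx2⟩
    · intro Q hQ hQn hQc
      have hQc' : EdgeClosed (E.erase e) Q := by
        intro x hx
        by_cases hxC : x.1 ∈ C
        · exact hQc x (mem_filter.2 ⟨hx, hxC⟩)
        · exact iff_of_false (fun hh => hxC (hQ hh)) (fun hh => hxC ((hCc x hx).2 (hQ hh)))
      by_cases h1 : e.1 ∈ Q
      · exact hQ.antisymm (hmin Q (hQ.trans hCP) hQc' h1)
      · have := hmin (P \ Q) sdiff_subset (hQc'.sdiff hin) (mem_sdiff.2 ⟨hCP he1, h1⟩)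
        obtain ⟨x, hx⟩ := hQn
        exact absurd hx (mem_sdiff.1 (this (hQ hx))).2
    · intro x hx
      obtain ⟨hx1, hx2⟩ := mem_filter.1 hx
      have := hin x hx1
      exact ⟨mem_sdiff.2 ⟨this.1, hx2⟩, mem_sdiff.2 ⟨this.2, fun hh => hx2 ((hCc x hx1).2 hh)⟩⟩
    · intro Q hQ hQn hQc
      -- A nonempty closed set outside `C` contains the head of `e`, since otherwise it would be
      -- closed for `E` itself. Hence `P \ C` cannot split into two closed nonempty sets.
      have key : ∀ Q ⊆ P \ C, Q.Nonempty →
          EdgeClosed ((E.erase e).filter fun x => x.1 ∉ C) Q → e.2.1 ∈ Q := by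
        intro Q hQ hQn hQc
        have hQc' : EdgeClosed (E.erase e) Q := by
          intro x hx
          by_cases hxC : x.1 ∈ C
          · exact iff_of_false (fun hh => (mem_sdiff.1 (hQ hh)).2 hxC)
              (fun hh => (mem_sdiff.1 (hQ hh)).2 ((hCc x hx).1 hxC))
          · exact hQc x (mem_filter.2 ⟨hx, hxC⟩)
        have h1 : e.1 ∉ Q := fun hh => (mem_sdiff.1 (hQ hh)).2 he1
        by_contra h2
        have := h.conn Q (hQ.trans sdiff_subset) hQn (hfull Q hQc' (iff_of_false h1 h2))
        exact h1 (this ▸ hCP he1)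
      have h2 := key Q hQ hQn hQc
      by_contra hne
      have hn : ((P \ C) \ Q).Nonempty := by
        rw [sdiff_nonempty]
        exact fun hh => hne (hQ.antisymm hh)
      refine (mem_sdiff.1 (key ((P \ C) \ Q) sdiff_subset hn (hQc.sdiff ?_))).2 h2
      intro x hx
      obtain ⟨hx1, hx2⟩ := mem_filter.1 hx
      have := hin x hx1
      exact ⟨mem_sdiff.2 ⟨this.1, hx2⟩, mem_sdiff.2 ⟨this.2, fun hh => hx2 ((hCc x hx1).2 hh)⟩⟩

/-- Induction on the edges: deleting one leaves a connected graph or two connected parts that share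
the remaining edges. Without edges every singleton is closed, so there is only one vertex. -/
theorem ConnectedOn.card_le {P : Finset V} {E : Finset (V × V × J)} (h : ConnectedOn P E) :
    P.card ≤ E.card + 1 := by
  induction hn : E.card using Nat.strong_induction_on generalizing P E with
  | _ n ih =>
    rcases E.eq_empty_or_nonempty with rfl | ⟨e, he⟩
    · obtain ⟨x, hx⟩ := h.nonempty
      have := h.conn {x} (by simpa using hx) (by simp) (by simp [EdgeClosed])
      rw [← this]
      simp
    · have hlt : (E.erase e).card + 1 = E.card := card_erase_add_one he
      rcases h.erase he with h1 | ⟨C, hC, -, -, -, h1, h2⟩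
      · have := ih (E.erase e).card (by omega) h1 rfl
        omega
      · have hs := card_filter_add_card_filter_not (s := E.erase e) (fun x => x.1 ∈ C)
        have i1 := ih _ (by omega) h1 rfl
        have i2 := ih _ (by omega) h2 rfl
        have := card_sdiff_add_card_eq_card hC
        omega

/-- Cutting an edge of a tree yields two trees. -/
theorem SpansTree.exists_cut {P : Finset V} {E : Finset (V × V × J)} (h : SpansTree P E)
    {e : V × V × J} (he : e ∈ E) :
    ∃ C ⊆ P, ∃ E₁ E₂, SpansTree C E₁ ∧ SpansTree (P \ C) E₂ ∧ e.1 ∈ C ∧ e.2.1 ∈ P \ C ∧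
      insert e (E₁ ∪ E₂) = E := by
  have hlt : (E.erase e).card + 1 = E.card := card_erase_add_one he
  have hc := h.card_eq
  -- Counting edges decides: a graph that stayed connected would have too few edges, and after a
  -- split both inequalities `ConnectedOn.card_le` have to be equalities.
  rcases h.erase he with h1 | ⟨C, hC, he1, he2, -, h1, h2⟩
  · have := h1.card_le
    omega
  · have hs := card_filter_add_card_filter_not (s := E.erase e) (fun x => x.1 ∈ C)
    have i1 := h1.card_le
    have i2 := h2.card_le
    have := card_sdiff_add_card_eq_card hC
    refine ⟨C, hC, _, _, ⟨h1, by omega⟩, ⟨h2, by omega⟩, he1, he2, ?_⟩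
    rw [filter_union_filter_not_eq, insert_erase he]

theorem disjoint_of_inside {P C : Finset V} {E₁ E₂ : Finset (V × V × J)}
    (h1 : ∀ e ∈ E₁, e.1 ∈ C ∧ e.2.1 ∈ C) (h2 : ∀ e ∈ E₂, e.1 ∈ P \ C ∧ e.2.1 ∈ P \ C) :
    Disjoint E₁ E₂ := by
  rw [disjoint_left]
  intro x hx hx'
  exact (mem_sdiff.1 (h2 x hx').1).2 (h1 x hx).1

theorem notMem_union_of_cross {P C : Finset V} {E₁ E₂ : Finset (V × V × J)} {e : V × V × J}
    (h1 : ∀ e ∈ E₁, e.1 ∈ C ∧ e.2.1 ∈ C) (h2 : ∀ e ∈ E₂, e.1 ∈ P \ C ∧ e.2.1 ∈ P \ C)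
    (hu : e.1 ∈ C) (hv : e.2.1 ∈ P \ C) : e ∉ E₁ ∪ E₂ := by
  rw [mem_union, not_or]
  exact ⟨fun h => (mem_sdiff.1 hv).2 (h1 _ h).2, fun h => (mem_sdiff.1 (h2 _ h).1).2 hu⟩

/-- Joining two disjoint trees by an edge yields a tree. -/
theorem SpansTree.join {P C : Finset V} (hC : C ⊆ P) {E₁ E₂ : Finset (V × V × J)}
    (h1 : SpansTree C E₁) (h2 : SpansTree (P \ C) E₂) {e : V × V × J} (hu : e.1 ∈ C)
    (hv : e.2.1 ∈ P \ C) : SpansTree P (insert e (E₁ ∪ E₂)) := by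
  refine ⟨⟨?_, h1.nonempty.mono hC, ?_⟩, ?_⟩
  · intro x hx
    rcases mem_insert.1 hx with rfl | hx
    · exact ⟨hC hu, sdiff_subset hv⟩
    rcases mem_union.1 hx with hx | hx
    · exact ⟨hC (h1.inside x hx).1, hC (h1.inside x hx).2⟩
    · exact ⟨sdiff_subset (h2.inside x hx).1, sdiff_subset (h2.inside x hx).2⟩
  · intro Q hQ hQn hQc
    have k1 : (∃ x ∈ Q, x ∈ C) → C ⊆ Q := by
      rintro ⟨x, hx, hxC⟩
      have := h1.conn (Q ∩ C) inter_subset_right ⟨x, mem_inter.2 ⟨hx, hxC⟩⟩ (by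
        intro y hy
        have := h1.inside y hy
        have := hQc y (by simp [hy])
        simp only [mem_inter]
        tauto)
      exact this ▸ inter_subset_left
    have k2 : (∃ x ∈ Q, x ∈ P \ C) → P \ C ⊆ Q := by
      rintro ⟨x, hx, hxC⟩
      have := h2.conn (Q ∩ (P \ C)) inter_subset_right ⟨x, mem_inter.2 ⟨hx, hxC⟩⟩ (by
        intro y hy
        have := h2.inside y hy
        have := hQc y (by simp [hy])
        simp only [mem_inter]
        tauto)
      exact this ▸ inter_subset_left
    have huv := hQc e (mem_insert_self _ _)
    have hall : C ⊆ Q ∧ P \ C ⊆ Q := by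
      obtain ⟨x, hx⟩ := hQn
      by_cases hxC : x ∈ C
      · have a := k1 ⟨x, hx, hxC⟩
        exact ⟨a, k2 ⟨_, huv.1 (a hu), hv⟩⟩
      · have a := k2 ⟨x, hx, mem_sdiff.2 ⟨hQ hx, hxC⟩⟩
        exact ⟨k1 ⟨_, huv.2 (a hv), hu⟩, a⟩
    refine hQ.antisymm ?_
    rw [← union_sdiff_of_subset hC]
    exact union_subset hall.1 hall.2
  · rw [card_insert_of_notMem (notMem_union_of_cross h1.inside h2.inside hu hv),
      card_union_of_disjoint (disjoint_of_inside h1.inside h2.inside)]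
    have := h1.card_eq
    have := h2.card_eq
    have := card_sdiff_add_card_eq_card hC
    omega

/-- The two trees which arise by cutting an edge are unique. -/
theorem SpansTree.cut_unique {P C C' : Finset V}
    {E₁ E₂ E₁' E₂' : Finset (V × V × J)} (h1 : SpansTree C E₁) (h2 : SpansTree (P \ C) E₂)
    (h1' : SpansTree C' E₁') (h2' : SpansTree (P \ C') E₂') {e : V × V × J}
    (hu : e.1 ∈ C) (hv : e.2.1 ∈ P \ C) (hu' : e.1 ∈ C') (hv' : e.2.1 ∈ P \ C')
    (h : insert e (E₁ ∪ E₂) = insert e (E₁' ∪ E₂')) : C = C' ∧ E₁ = E₁' ∧ E₂ = E₂' := by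
  have hU : E₁ ∪ E₂ = E₁' ∪ E₂' := by
    have := congrArg (fun s => s.erase e) h
    simpa [erase_insert (notMem_union_of_cross h1.inside h2.inside hu hv),
      erase_insert (notMem_union_of_cross h1'.inside h2'.inside hu' hv')] using this
  -- Each edge of the first tree lies within `C'` or within its complement, so `C ∩ C'` is closed in
  -- the connected set `C`, and it contains the tail of `e`.
  have sub : ∀ {C C' : Finset V} {E₁ E₂ E₁' E₂' : Finset (V × V × J)}, SpansTree C E₁ →
      SpansTree C' E₁' → SpansTree (P \ C') E₂' → e.1 ∈ C → e.1 ∈ C' → E₁ ∪ E₂ = E₁' ∪ E₂' →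
      C ⊆ C' := by
    intro C C' E₁ E₂ E₁' E₂' h1 h1' h2' hu hu' hU
    have := h1.conn (C ∩ C') inter_subset_left ⟨_, mem_inter.2 ⟨hu, hu'⟩⟩ (by
      intro y hy
      have a := h1.inside y hy
      have hy' : y ∈ E₁' ∪ E₂' := hU ▸ mem_union_left _ hy
      simp only [mem_inter]
      rcases mem_union.1 hy' with hy' | hy'
      · have := h1'.inside y hy'
        tauto
      · have := h2'.inside y hy'
        simp only [mem_sdiff] at this
        tauto)
    exact this ▸ inter_subset_right
  have hCC : C = C' := (sub h1 h1' h2' hu hu' hU).antisymm (sub h1' h1 h2 hu' hu hU.symm)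
  subst hCC
  refine ⟨rfl, ?_, ?_⟩
  · ext x
    have a := congrArg (fun s => x ∈ s ∧ x.1 ∈ C) hU
    have b1 := h1.inside x
    have b2 := h2.inside x
    have b3 := h1'.inside x
    have b4 := h2'.inside x
    simp only [mem_union, mem_sdiff, eq_iff_iff] at *
    tauto
  · ext x
    have a := congrArg (fun s => x ∈ s ∧ x.1 ∉ C) hU
    have b1 := h1.inside x
    have b2 := h2.inside x
    have b3 := h1'.inside x
    have b4 := h2'.inside x
    simp only [mem_union, mem_sdiff, eq_iff_iff] at *
    tauto

variable [Fintype J]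

open Classical in
/-- The finite set of trees with vertex set `P`. -/
def spanningTrees (J : Type) [Fintype J] [DecidableEq J] (P : Finset V) :
    Finset (Finset (V × V × J)) :=
  (P ×ˢ P ×ˢ (univ : Finset J)).powerset.filter (SpansTree P)

theorem mem_spanningTrees {P : Finset V} {E : Finset (V × V × J)} :
    E ∈ spanningTrees J P ↔ SpansTree P E := by
  classical
  rw [spanningTrees, mem_filter, mem_powerset, and_iff_right_iff_imp]
  intro h e he
  simp [h.inside e he]

/-- A sum over trees with a distinguished edge is a sum over pairs of trees. -/
theorem sum_spanningTrees_edges {A : Type} [AddCommMonoid A] (P : Finset V)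
    (f : Finset (V × V × J) → V × V × J → A) :
    ∑ E ∈ spanningTrees J P, ∑ e ∈ E, f E e =
      ∑ C ∈ P.powerset, ∑ E₁ ∈ spanningTrees J C, ∑ E₂ ∈ spanningTrees J (P \ C),
        ∑ e ∈ C ×ˢ (P \ C) ×ˢ (univ : Finset J), f (insert e (E₁ ∪ E₂)) e := by
  rw [sum_sigma']
  simp_rw [← sum_product']
  rw [sum_sigma']
  symm
  refine sum_bij (fun x _ => ⟨insert x.2.2.2 (x.2.1 ∪ x.2.2.1), x.2.2.2⟩) ?_ ?_ ?_ ?_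
  · rintro ⟨C, E₁, E₂, e⟩ hx
    simp only [mem_sigma, mem_powerset, mem_product, mem_spanningTrees, mem_univ, and_true] at hx ⊢
    exact ⟨SpansTree.join hx.1 hx.2.1 hx.2.2.1 hx.2.2.2.1 hx.2.2.2.2, mem_insert_self _ _⟩
  · rintro ⟨C, E₁, E₂, e⟩ hx ⟨C', E₁', E₂', e'⟩ hx' h
    simp only [mem_sigma, mem_powerset, mem_product, mem_spanningTrees, mem_univ, and_true]
      at hx hx'
    simp only [Sigma.mk.injEq, heq_eq_eq] at h
    obtain ⟨h, rfl⟩ := h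
    obtain ⟨rfl, rfl, rfl⟩ := SpansTree.cut_unique hx.2.1 hx.2.2.1 hx'.2.1
      hx'.2.2.1 hx.2.2.2.1 hx.2.2.2.2 hx'.2.2.2.1 hx'.2.2.2.2 h
    rfl
  · rintro ⟨E, e⟩ hx
    simp only [mem_sigma, mem_spanningTrees] at hx
    obtain ⟨C, hC, E₁, E₂, h1, h2, hu, hv, hE⟩ := hx.1.exists_cut hx.2
    refine ⟨⟨C, E₁, E₂, e⟩, ?_, ?_⟩
    · simp only [mem_sigma, mem_powerset, mem_product, mem_spanningTrees, mem_univ, and_true]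
      exact ⟨hC, h1, h2, hu, hv⟩
    · simp only [hE]
  · intros
    rfl

end Trees

/-! ### Tree sums with a root, and the recursion obtained by cutting edges. -/

section RootedSums
variable {V J : Type} [DecidableEq V] [DecidableEq J]

/-- The labels of the half-edges at `v`: outgoing edges give labels `inl i`, incoming edges give
labels `inr i`. -/
def endLabels (E : Finset (V × V × J)) (v : V) : J ⊕ J →₀ ℕ :=
  ∑ e ∈ E, ((if e.1 = v then Finsupp.single (Sum.inl e.2.2) 1 else 0) +
    if e.2.1 = v then Finsupp.single (Sum.inr e.2.2) 1 else 0)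

theorem endLabels_eq_zero {E : Finset (V × V × J)} {v : V}
    (h : ∀ e ∈ E, e.1 ≠ v ∧ e.2.1 ≠ v) : endLabels E v = 0 :=
  sum_eq_zero fun e he => by simp [h e he]

theorem endLabels_inl (E : Finset (V × V × J)) (v : V) (i : J) :
    endLabels E v (Sum.inl i) = ∑ e ∈ E, if e.1 = v ∧ e.2.2 = i then 1 else 0 := by
  rw [endLabels, Finsupp.finsetSum_apply]
  refine sum_congr rfl fun e _ => ?_
  rw [Finsupp.add_apply]
  split_ifs <;> simp_all

theorem endLabels_inr (E : Finset (V × V × J)) (v : V) (i : J) :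
    endLabels E v (Sum.inr i) = ∑ e ∈ E, if e.2.1 = v ∧ e.2.2 = i then 1 else 0 := by
  rw [endLabels, Finsupp.finsetSum_apply]
  refine sum_congr rfl fun e _ => ?_
  rw [Finsupp.add_apply]
  split_ifs <;> simp_all

theorem endLabels_join {P C : Finset V} {E₁ E₂ : Finset (V × V × J)}
    (h1 : SpansTree C E₁) (h2 : SpansTree (P \ C) E₂) {e : V × V × J} (hu : e.1 ∈ C)
    (hv : e.2.1 ∈ P \ C) (x : V) :
    endLabels (insert e (E₁ ∪ E₂)) x = ((if e.1 = x then Finsupp.single (Sum.inl e.2.2) 1 else 0) +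
    if e.2.1 = x then Finsupp.single (Sum.inr e.2.2) 1 else 0) +
      (endLabels E₁ x + endLabels E₂ x) := by
  rw [endLabels, sum_insert (notMem_union_of_cross h1.inside h2.inside hu hv),
    sum_union (disjoint_of_inside h1.inside h2.inside)]
  rfl

theorem endLabels_join_left {P C : Finset V} {E₁ E₂ : Finset (V × V × J)}
    (h1 : SpansTree C E₁) (h2 : SpansTree (P \ C) E₂) {e : V × V × J} (hu : e.1 ∈ C)
    (hv : e.2.1 ∈ P \ C) {x : V} (hx : x ∈ C) :
    endLabels (insert e (E₁ ∪ E₂)) x =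
      endLabels E₁ x + if x = e.1 then Finsupp.single (Sum.inl e.2.2) 1 else 0 := by
  have hne : e.2.1 ≠ x := fun h => (mem_sdiff.1 hv).2 (h ▸ hx)
  have h0 : endLabels E₂ x = 0 := endLabels_eq_zero fun y hy =>
    ⟨fun h => (mem_sdiff.1 (h2.inside y hy).1).2 (h ▸ hx),
      fun h => (mem_sdiff.1 (h2.inside y hy).2).2 (h ▸ hx)⟩
  rw [endLabels_join h1 h2 hu hv, h0, if_neg hne, add_zero, add_zero, add_comm]
  simp only [eq_comm]

theorem endLabels_join_right {P C : Finset V} {E₁ E₂ : Finset (V × V × J)}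
    (h1 : SpansTree C E₁) (h2 : SpansTree (P \ C) E₂) {e : V × V × J} (hu : e.1 ∈ C)
    (hv : e.2.1 ∈ P \ C) {x : V} (hx : x ∈ P \ C) :
    endLabels (insert e (E₁ ∪ E₂)) x =
      endLabels E₂ x + if x = e.2.1 then Finsupp.single (Sum.inr e.2.2) 1 else 0 := by
  have hxC := (mem_sdiff.1 hx).2
  have hne : e.1 ≠ x := fun h => hxC (h ▸ hu)
  have h0 : endLabels E₁ x = 0 := endLabels_eq_zero fun y hy =>
    ⟨fun h => hxC (h ▸ (h1.inside y hy).1), fun h => hxC (h ▸ (h1.inside y hy).2)⟩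
  rw [endLabels_join h1 h2 hu hv, h0, if_neg hne, zero_add, zero_add, add_comm]
  simp only [eq_comm]

variable [Fintype J] {A : Type} [CommRing A]

/-- The sum over trees with vertex set `L ∪ {r}` of the product of a factor `K` at the root `r`
and factors `F` at all other vertices. -/
def rootedSum (F K : (J ⊕ J →₀ ℕ) → A) (r : V) (L : Finset V) : A :=
  ∑ E ∈ spanningTrees J (insert r L), K (endLabels E r) * ∏ v ∈ L, F (endLabels E v)

/-- The sum over trees with vertex set `P` and with one distinguished vertex, which carries the
factor `K`. -/
def markedSum (F K : (J ⊕ J →₀ ℕ) → A) (P : Finset V) : A :=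
  ∑ v ∈ P, rootedSum F K v (P.erase v)

/-- The functional `F` with one more half-edge, labelled `h`. -/
def shift (h : J ⊕ J) (F : (J ⊕ J →₀ ℕ) → A) : (J ⊕ J →₀ ℕ) → A :=
  fun s => F (s + Finsupp.single h 1)

/-- The functional which selects the labels `s`. -/
def select (s : J ⊕ J →₀ ℕ) : (J ⊕ J →₀ ℕ) → A := fun t => if t = s then 1 else 0

theorem prod_shift (F : (J ⊕ J →₀ ℕ) → A) (P : Finset V) {v : V} (hv : v ∈ P)
    (E : Finset (V × V × J)) (h : J ⊕ J) :
    ∏ x ∈ P, F (endLabels E x + if x = v then Finsupp.single h 1 else 0) =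
      shift h F (endLabels E v) * ∏ x ∈ P.erase v, F (endLabels E x) := by
  rw [← mul_prod_erase P _ hv, if_pos rfl, shift]
  congr 1
  refine prod_congr rfl fun x hx => ?_
  rw [if_neg (ne_of_mem_erase hx), add_zero]

/-- Putting the shifted factor at the distinguished vertex amounts to attaching a free half-edge
there. This is the form in which the two ends of a cut edge appear in the halves of a tree. -/
theorem markedSum_shift (F : (J ⊕ J →₀ ℕ) → A) (h : J ⊕ J) (P : Finset V) :
    markedSum F (shift h F) P = ∑ E ∈ spanningTrees J P, ∑ v ∈ P,
      ∏ x ∈ P, F (endLabels E x + if x = v then Finsupp.single h 1 else 0) := by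
  rw [markedSum, sum_comm]
  refine sum_congr rfl fun v hv => ?_
  rw [rootedSum, insert_erase hv]
  exact sum_congr rfl fun E _ => (prod_shift F P hv E h).symm

theorem markedSum_self (F : (J ⊕ J →₀ ℕ) → A) (P : Finset V) :
    markedSum F F P =
      P.card * ∑ E ∈ spanningTrees J P, ∏ x ∈ P, F (endLabels E x) := by
  have : ∀ v ∈ P, rootedSum F F v (P.erase v) =
      ∑ E ∈ spanningTrees J P, ∏ x ∈ P, F (endLabels E x) := by
    intro v hv
    rw [rootedSum, insert_erase hv]
    exact sum_congr rfl fun E _ => mul_prod_erase P (fun x => F (endLabels E x)) hv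
  rw [markedSum, sum_congr rfl this, sum_const, nsmul_eq_mul]

/-- The number of edges counts the choices of an edge to cut. As edges are directed, the tail side
and the head side are distinguished and no factor 1/2 occurs. -/
theorem sum_card_spanningTrees (F : (J ⊕ J →₀ ℕ) → A) (P : Finset V) :
    ∑ E ∈ spanningTrees J P, (E.card : A) * ∏ x ∈ P, F (endLabels E x) =
      ∑ i, ∑ C ∈ P.powerset,
        markedSum F (shift (Sum.inl i) F) C * markedSum F (shift (Sum.inr i) F) (P \ C) := by
  have h : ∀ E : Finset (V × V × J), (E.card : A) * ∏ x ∈ P, F (endLabels E x) =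
      ∑ e ∈ E, ∏ x ∈ P, F (endLabels E x) := by
    intro E
    rw [sum_const, nsmul_eq_mul]
  simp_rw [h]
  rw [sum_spanningTrees_edges P fun E _ => ∏ x ∈ P, F (endLabels E x), sum_comm (s := univ)]
  refine sum_congr rfl fun C hC => ?_
  rw [mem_powerset] at hC
  simp_rw [markedSum_shift, sum_mul_sum]
  rw [sum_comm (s := univ)]
  refine sum_congr rfl fun E₁ h1 => ?_
  rw [sum_comm (s := univ)]
  refine sum_congr rfl fun E₂ h2 => ?_
  rw [mem_spanningTrees] at h1 h2
  rw [sum_product, sum_comm (s := univ)]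
  refine sum_congr rfl fun u hu => ?_
  rw [sum_product, sum_comm (s := univ)]
  refine sum_congr rfl fun v hv => sum_congr rfl fun i _ => ?_
  rw [← union_sdiff_of_subset hC, prod_union disjoint_sdiff, union_sdiff_of_subset hC]
  congr 1
  · exact prod_congr rfl fun x hx => by
      rw [endLabels_join_left h1 h2 (e := (u, v, i)) hu hv hx]
  · exact prod_congr rfl fun x hx => by
      rw [endLabels_join_right h1 h2 (e := (u, v, i)) hu hv hx]

/-- Splitting off a branch at the root along an outgoing edge. -/
theorem rootedSum_select_inl (F : (J ⊕ J →₀ ℕ) → A) {r : V} {L : Finset V} (hr : r ∉ L)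
    (s : J ⊕ J →₀ ℕ) (i : J) :
    ((s (Sum.inl i) + 1 : ℕ) : A) *
        rootedSum F (select (s + Finsupp.single (Sum.inl i) 1)) r L =
      ∑ C ∈ L.powerset, rootedSum F (select s) r C *
        markedSum F (shift (Sum.inr i) F) (L \ C) := by
  -- The factor is the number of outgoing edges with label `i` at a root with these labels, so it
  -- amounts to distinguishing one of them, which is then cut.
  have hL : ((s (Sum.inl i) + 1 : ℕ) : A) *
        rootedSum F (select (s + Finsupp.single (Sum.inl i) 1)) r L =
      ∑ E ∈ spanningTrees J (insert r L), ∑ e ∈ E, if e.1 = r ∧ e.2.2 = i then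
        select (s + Finsupp.single (Sum.inl i) 1) (endLabels E r) *
          ∏ v ∈ L, F (endLabels E v) else 0 := by
    rw [rootedSum, mul_sum]
    refine sum_congr rfl fun E _ => ?_
    by_cases h : endLabels E r = s + Finsupp.single (Sum.inl i) 1
    · have := endLabels_inl E r i
      rw [h, Finsupp.add_apply, Finsupp.single_eq_same] at this
      rw [this, Nat.cast_sum, sum_mul]
      refine sum_congr rfl fun e _ => ?_
      split_ifs <;> simp
    · simp [select, h]
  rw [hL, sum_spanningTrees_edges (insert r L) fun E e => if e.1 = r ∧ e.2.2 = i then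
        select (s + Finsupp.single (Sum.inl i) 1) (endLabels E r) *
          ∏ v ∈ L, F (endLabels E v) else 0, sum_powerset_insert hr]
  -- The tail of the cut edge is the root, so a component of the tail that avoids the root
  -- contributes nothing.
  have hz : ∑ C ∈ L.powerset, ∑ E₁ ∈ spanningTrees J C,
      ∑ E₂ ∈ spanningTrees J (insert r L \ C), ∑ e ∈ C ×ˢ (insert r L \ C) ×ˢ (univ : Finset J),
      (if e.1 = r ∧ e.2.2 = i then
        select (s + Finsupp.single (Sum.inl i) 1) (endLabels (insert e (E₁ ∪ E₂)) r) *
          ∏ v ∈ L, F (endLabels (insert e (E₁ ∪ E₂)) v) else 0) = 0 := by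
    refine sum_eq_zero fun C hC => sum_eq_zero fun E₁ _ => sum_eq_zero fun E₂ _ =>
      sum_eq_zero fun e he => if_neg ?_
    rintro ⟨h, -⟩
    exact hr (mem_powerset.1 hC (h ▸ (mem_product.1 he).1))
  rw [hz, zero_add]
  refine sum_congr rfl fun C hC => ?_
  rw [mem_powerset] at hC
  have hrC : r ∉ C := fun h => hr (hC h)
  have hsd : insert r L \ insert r C = L \ C := by
    ext x
    simp only [mem_sdiff, mem_insert]
    have : x ∈ L → x ≠ r := fun h1 h2 => hr (h2 ▸ h1)
    tauto
  rw [markedSum_shift, rootedSum, sum_mul_sum]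
  refine sum_congr rfl fun E₁ h1 => ?_
  rw [hsd]
  refine sum_congr rfl fun E₂ h2 => ?_
  rw [mem_spanningTrees] at h1 h2
  rw [sum_product, sum_eq_single r _ (fun h => absurd (mem_insert_self _ _) h), mul_sum,
    sum_product]
  · refine sum_congr rfl fun v hv => ?_
    have h2' : SpansTree (insert r L \ insert r C) E₂ := hsd ▸ h2
    have hv' : v ∈ insert r L \ insert r C := hsd ▸ hv
    have hrr : r ∈ insert r C := mem_insert_self _ _
    rw [sum_eq_single i _ (fun h => absurd (mem_univ _) h)]
    · rw [if_pos ⟨rfl, rfl⟩, endLabels_join_left h1 h2' (e := (r, v, i)) hrr hv' hrr, if_pos rfl,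
        mul_assoc]
      congr 1
      · simp [select]
      rw [← union_sdiff_of_subset hC, prod_union disjoint_sdiff, union_sdiff_of_subset hC]
      congr 1
      · refine prod_congr rfl fun x hx => ?_
        rw [endLabels_join_left h1 h2' (e := (r, v, i)) hrr hv' (mem_insert_of_mem hx), if_neg,
          add_zero]
        rintro rfl
        exact hrC hx
      · exact prod_congr rfl fun x hx => by
          rw [endLabels_join_right h1 h2' (e := (r, v, i)) hrr hv' (hsd ▸ hx)]
    · intro j _ hj
      exact if_neg fun h => hj h.2
  · intro u _ hu
    exact sum_eq_zero fun e _ => if_neg fun h => hu h.1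

/-- Splitting off a branch at the root along an incoming edge. -/
theorem rootedSum_select_inr (F : (J ⊕ J →₀ ℕ) → A) {r : V} {L : Finset V} (hr : r ∉ L)
    (s : J ⊕ J →₀ ℕ) (i : J) :
    ((s (Sum.inr i) + 1 : ℕ) : A) *
        rootedSum F (select (s + Finsupp.single (Sum.inr i) 1)) r L =
      ∑ C ∈ L.powerset, rootedSum F (select s) r C *
        markedSum F (shift (Sum.inl i) F) (L \ C) := by
  have hL : ((s (Sum.inr i) + 1 : ℕ) : A) *
        rootedSum F (select (s + Finsupp.single (Sum.inr i) 1)) r L =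
      ∑ E ∈ spanningTrees J (insert r L), ∑ e ∈ E, if e.2.1 = r ∧ e.2.2 = i then
        select (s + Finsupp.single (Sum.inr i) 1) (endLabels E r) *
          ∏ v ∈ L, F (endLabels E v) else 0 := by
    rw [rootedSum, mul_sum]
    refine sum_congr rfl fun E _ => ?_
    by_cases h : endLabels E r = s + Finsupp.single (Sum.inr i) 1
    · have := endLabels_inr E r i
      rw [h, Finsupp.add_apply, Finsupp.single_eq_same] at this
      rw [this, Nat.cast_sum, sum_mul]
      refine sum_congr rfl fun e _ => ?_
      split_ifs <;> simp
    · simp [select, h]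
  rw [hL, sum_spanningTrees_edges (insert r L) fun E e => if e.2.1 = r ∧ e.2.2 = i then
        select (s + Finsupp.single (Sum.inr i) 1) (endLabels E r) *
          ∏ v ∈ L, F (endLabels E v) else 0, sum_powerset_insert hr]
  have hz : ∑ C ∈ L.powerset, ∑ E₁ ∈ spanningTrees J (insert r C),
      ∑ E₂ ∈ spanningTrees J (insert r L \ insert r C),
      ∑ e ∈ (insert r C) ×ˢ (insert r L \ insert r C) ×ˢ (univ : Finset J),
      (if e.2.1 = r ∧ e.2.2 = i then
        select (s + Finsupp.single (Sum.inr i) 1) (endLabels (insert e (E₁ ∪ E₂)) r) *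
          ∏ v ∈ L, F (endLabels (insert e (E₁ ∪ E₂)) v) else 0) = 0 := by
    refine sum_eq_zero fun C hC => sum_eq_zero fun E₁ _ => sum_eq_zero fun E₂ _ =>
      sum_eq_zero fun e he => if_neg ?_
    rintro ⟨h, -⟩
    have := (mem_sdiff.1 (mem_product.1 (mem_product.1 he).2).1).2
    exact this (h ▸ mem_insert_self _ _)
  rw [hz, add_zero]
  -- Now the root is the head of the cut edge. The component of the tail is the branch, and its
  -- complement in `L` stays with the root, so the roles of `C` and `L \ C` are exchanged.
  refine sum_nbij' (fun C => L \ C) (fun C => L \ C) (fun C _ => by simp) (fun C _ => by simp)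
    (fun C hC => by simpa using mem_powerset.1 hC) (fun C hC => by simpa using mem_powerset.1 hC)
    fun C hC => ?_
  rw [mem_powerset] at hC
  have hrC : r ∉ C := fun h => hr (hC h)
  have hsd : insert r L \ C = insert r (L \ C) := insert_sdiff_of_notMem _ hrC
  rw [markedSum_shift, rootedSum, mul_comm, sum_mul_sum, Finset.sdiff_sdiff_eq_self hC]
  refine sum_congr rfl fun E₁ h1 => ?_
  rw [hsd]
  refine sum_congr rfl fun E₂ h2 => ?_
  rw [mem_spanningTrees] at h1 h2
  have h2' : SpansTree (insert r L \ C) E₂ := hsd ▸ h2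
  have hr' : r ∈ insert r L \ C := hsd ▸ mem_insert_self _ _
  rw [sum_product, sum_mul]
  refine sum_congr rfl fun u hu => ?_
  rw [sum_product, sum_eq_single r _ (fun h => absurd (mem_insert_self _ _) h),
    sum_eq_single i _ (fun h => absurd (mem_univ _) h)]
  · rw [if_pos ⟨rfl, rfl⟩, endLabels_join_right h1 h2' (e := (u, r, i)) hu hr' hr', if_pos rfl,
      mul_left_comm]
    congr 1
    · simp [select]
    rw [← union_sdiff_of_subset hC, prod_union disjoint_sdiff, union_sdiff_of_subset hC]
    congr 1
    · exact prod_congr rfl fun x hx => by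
        rw [endLabels_join_left h1 h2' (e := (u, r, i)) hu hr' hx]
    · refine prod_congr rfl fun x hx => ?_
      rw [endLabels_join_right h1 h2' (e := (u, r, i)) hu hr' (hsd ▸ mem_insert_of_mem hx),
        if_neg, add_zero]
      rintro rfl
      exact hr (mem_sdiff.1 hx).1
  · intro j _ hj
    exact if_neg fun h => hj h.2
  · intro v _ hv
    exact sum_eq_zero fun j _ => if_neg fun h => hv h.1

end RootedSums

/-! ### Independence of the names of the vertices. -/

section Transport
variable {V V' J : Type} [DecidableEq V] [DecidableEq V'] [DecidableEq J]

/-- The map on labelled edges induced by an embedding of the vertices. -/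
def edgeEmbedding (J : Type) (φ : V ↪ V') : V × V × J ↪ V' × V' × J :=
  φ.prodMap (φ.prodMap (Function.Embedding.refl J))

theorem edgeEmbedding_apply (φ : V ↪ V') (e : V × V × J) :
    edgeEmbedding J φ e = (φ e.1, φ e.2.1, e.2.2) := rfl

theorem endLabels_map (φ : V ↪ V') (E : Finset (V × V × J)) (v : V) :
    endLabels (E.map (edgeEmbedding J φ)) (φ v) = endLabels E v := by
  simp [endLabels, edgeEmbedding_apply]

theorem spansTree_map (φ : V ↪ V') {P : Finset V} {E : Finset (V × V × J)} :
    SpansTree (P.map φ) (E.map (edgeEmbedding J φ)) ↔ SpansTree P E := by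
  have hcl : ∀ Q : Finset V, EdgeClosed (E.map (edgeEmbedding J φ)) (Q.map φ) ↔ EdgeClosed E Q := by
    intro Q
    constructor
    · intro h e he
      simpa [edgeEmbedding_apply] using h _ (mem_map_of_mem (edgeEmbedding J φ) he)
    · intro h e he
      obtain ⟨e', he', rfl⟩ := mem_map.1 he
      simpa [edgeEmbedding_apply] using h e' he'
  constructor
  · intro h
    refine ⟨⟨?_, by simpa using h.nonempty, ?_⟩, by simpa using h.card_eq⟩
    · intro e he
      simpa [edgeEmbedding_apply] using h.inside _ (mem_map_of_mem (edgeEmbedding J φ) he)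
    · intro Q hQ hQn hQc
      exact map_injective φ (h.conn (Q.map φ) (map_subset_map.2 hQ) (hQn.map) ((hcl Q).2 hQc))
  · intro h
    refine ⟨⟨?_, h.nonempty.map, ?_⟩, by simpa using h.card_eq⟩
    · intro e he
      obtain ⟨e', he', rfl⟩ := mem_map.1 he
      simpa [edgeEmbedding_apply] using h.inside e' he'
    · intro Q hQ hQn hQc
      obtain ⟨Q', hQ', rfl⟩ := subset_map_iff.1 hQ
      rw [h.conn Q' hQ' (by simpa using hQn) ((hcl Q').1 hQc)]

variable [Fintype J]

theorem sum_spanningTrees_map {M : Type} [AddCommMonoid M] (φ : V ↪ V') (P : Finset V)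
    (g : Finset (V' × V' × J) → M) :
    ∑ E ∈ spanningTrees J (P.map φ), g E =
      ∑ E ∈ spanningTrees J P, g (E.map (edgeEmbedding J φ)) := by
  symm
  refine sum_bij (fun E _ => E.map (edgeEmbedding J φ)) ?_ ?_ ?_ fun _ _ => rfl
  · intro E hE
    rw [mem_spanningTrees] at hE ⊢
    exact (spansTree_map φ).2 hE
  · intro E _ E' _ h
    exact map_injective _ h
  · intro E hE
    rw [mem_spanningTrees] at hE
    have hsub : E ⊆ (P ×ˢ P ×ˢ (univ : Finset J)).map (edgeEmbedding J φ) := by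
      rintro ⟨u, v, i⟩ he
      obtain ⟨h1, h2⟩ := hE.inside _ he
      obtain ⟨u', hu', rfl⟩ := mem_map.1 h1
      obtain ⟨v', hv', rfl⟩ := mem_map.1 h2
      exact mem_map.2 ⟨(u', v', i), by simp [hu', hv'], rfl⟩
    obtain ⟨E', -, rfl⟩ := subset_map_iff.1 hsub
    exact ⟨E', mem_spanningTrees.2 ((spansTree_map φ).1 hE), rfl⟩

variable {A : Type} [CommRing A]

theorem rootedSum_map (F K : (J ⊕ J →₀ ℕ) → A) (φ : V ↪ V') (r : V) (L : Finset V) :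
    rootedSum F K (φ r) (L.map φ) = rootedSum F K r L := by
  rw [rootedSum, ← map_insert, sum_spanningTrees_map]
  simp_rw [prod_map, endLabels_map]
  rfl

/-- The sum over trees with a root, which carries the factor `K`, and `n` further vertices. -/
def rootedCount (F K : (J ⊕ J →₀ ℕ) → A) (n : ℕ) : A :=
  rootedSum F K (none : Option (Fin n)) (univ.map Function.Embedding.some)

/-- Only the number of non-root vertices matters, which makes exponential generating series
available. -/
theorem rootedSum_eq_rootedCount (F K : (J ⊕ J →₀ ℕ) → A) {r : V} {L : Finset V} (hr : r ∉ L) :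
    rootedSum F K r L = rootedCount F K L.card := by
  let f : Fin L.card ↪ V := L.equivFin.symm.toEmbedding.trans (Function.Embedding.subtype _)
  have hf : (univ : Finset (Fin L.card)).map f = L := by
    rw [← map_map, map_univ_equiv]
    ext x
    simp
  let φ : Option (Fin L.card) ↪ V := Function.Embedding.optionElim f r (by
    rintro ⟨k, hk⟩
    exact hr (hk ▸ (L.equivFin.symm k).2))
  have := rootedSum_map F K φ none (univ.map Function.Embedding.some)
  rw [map_map] at this
  rw [rootedCount, ← this]
  congr 1
  exact hf.symm

theorem markedSum_eq (F K : (J ⊕ J →₀ ℕ) → A) (P : Finset V) :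
    markedSum F K P = P.card * rootedCount F K (P.card - 1) := by
  rw [markedSum, sum_congr rfl fun v hv => by
    rw [rootedSum_eq_rootedCount F K (notMem_erase v P), card_erase_of_mem hv],
    sum_const, nsmul_eq_mul]

end Transport

/-! ### Exponential coefficients and the vertex-minus-edge count. -/

section ExponentialCoefficients
variable {J : Type} [DecidableEq J] [Fintype J] {A : Type} [CommRing A] [Algebra ℝ A]

/-- The exponential coefficients of the numbers `rootedCount`. -/
def rootedCoeff (F K : (J ⊕ J →₀ ℕ) → A) (n : ℕ) : A :=
  ((n.factorial : ℝ)⁻¹) • rootedCount F K n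

/-- The exponential coefficients of the sums over trees with a distinguished vertex, which
carries the factor `K`. -/
def markedCoeff (F K : (J ⊕ J →₀ ℕ) → A) : ℕ → A
  | 0 => 0
  | n + 1 => rootedCoeff F K n

/-- The exponential coefficients of the sums over trees. -/
def treeCoeff (F : (J ⊕ J →₀ ℕ) → A) (n : ℕ) : A :=
  ((n.factorial : ℝ)⁻¹) • ∑ E ∈ spanningTrees J (univ : Finset (Fin n)), ∏ x, F (endLabels E x)

theorem markedCoeff_eq {V : Type} [DecidableEq V] (F K : (J ⊕ J →₀ ℕ) → A) (P : Finset V) :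
    markedSum F K P = (P.card.factorial : ℝ) • markedCoeff F K P.card := by
  rw [markedSum_eq]
  cases h : P.card with
  | zero => simp [markedCoeff]
  | succ n =>
    rw [markedCoeff, rootedCoeff, smul_smul, Nat.factorial_succ, Nat.cast_mul, mul_assoc,
      mul_inv_cancel₀ (by positivity), mul_one, Nat.cast_smul_eq_nsmul, nsmul_eq_mul]
    rfl

/-- The product rule for exponential generating functions: a set of size `n` has `n.choose k`
subsets of size `k`, and these binomial coefficients cancel the factorials. -/
theorem sum_powerset_mul {V : Type} [DecidableEq V] (L : Finset V) (a b : ℕ → A) :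
    ((L.card.factorial : ℝ)⁻¹) • ∑ C ∈ L.powerset,
      ((C.card.factorial : ℝ) • a C.card) * (((L \ C).card.factorial : ℝ) • b (L \ C).card) =
      ∑ p ∈ antidiagonal L.card, a p.1 * b p.2 := by
  have h : ∀ C ∈ L.powerset,
      ((C.card.factorial : ℝ) • a C.card) * (((L \ C).card.factorial : ℝ) • b (L \ C).card) =
      (fun k => ((k.factorial : ℝ) • a k) * (((L.card - k).factorial : ℝ) • b (L.card - k)))
        C.card := by
    intro C hC
    rw [card_sdiff_of_subset (mem_powerset.1 hC)]
  rw [sum_congr rfl h, sum_powerset_apply_card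
    (fun k => ((k.factorial : ℝ) • a k) * (((L.card - k).factorial : ℝ) • b (L.card - k))),
    Nat.sum_antidiagonal_eq_sum_range_succ fun i j => a i * b j, smul_sum]
  refine sum_congr rfl fun k hk => ?_
  have hk' : k ≤ L.card := Nat.lt_succ_iff.1 (mem_range.1 hk)
  rw [smul_mul_smul_comm, ← Nat.cast_smul_eq_nsmul ℝ, smul_smul, smul_smul]
  have : (L.card.factorial : ℝ)⁻¹ *
      (L.card.choose k * (k.factorial * (L.card - k).factorial)) = 1 := by
    rw [← Nat.choose_mul_factorial_mul_factorial hk']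
    push_cast
    rw [← mul_assoc (L.card.choose k : ℝ)]
    exact inv_mul_cancel₀ (by
      have := Nat.choose_pos hk'
      positivity)
  rw [mul_assoc, this, one_smul]

/-- A root without half-edges is a connected component by itself, so the tree has no other vertex.
-/
theorem rootedCoeff_select_zero (F : (J ⊕ J →₀ ℕ) → A) (n : ℕ) :
    rootedCoeff F (select 0) n = if n = 0 then 1 else 0 := by
  rw [rootedCoeff, rootedCount, rootedSum]
  split_ifs with h
  · subst h
    have hst : spanningTrees J (insert none ((univ : Finset (Fin 0)).map
        Function.Embedding.some)) = {∅} := by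
      ext E
      rw [mem_spanningTrees, mem_singleton]
      constructor
      · intro h
        have := h.card_eq
        simpa using this
      · rintro rfl
        refine ⟨⟨by simp, by simp, ?_⟩, by simp⟩
        intro Q hQ hn _
        have : Q ⊆ {none} := by simpa using hQ
        rw [hn.subset_singleton_iff.1 this]
        rfl
    rw [hst, sum_singleton, select, if_pos (endLabels_eq_zero (by simp))]
    simp
  · rw [sum_eq_zero, smul_zero]
    intro E hE
    rw [mem_spanningTrees] at hE
    rw [select, if_neg, zero_mul]
    intro h0
    have h1 : EdgeClosed E {none} := by
      intro e he
      have k1 : e.1 ≠ none := by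
        intro h1
        have := DFunLike.congr_fun h0 (Sum.inl e.2.2)
        rw [endLabels_inl, Finsupp.zero_apply, sum_eq_zero_iff] at this
        simpa [h1] using this e he
      have k2 : e.2.1 ≠ none := by
        intro h1
        have := DFunLike.congr_fun h0 (Sum.inr e.2.2)
        rw [endLabels_inr, Finsupp.zero_apply, sum_eq_zero_iff] at this
        simpa [h1] using this e he
      simp [k1, k2]
    have := congrArg card (hE.conn {none} (by simp) (by simp) h1)
    rw [card_insert_of_notMem (by simp)] at this
    simp at this
    omega

/-- The label at the other end of an edge. -/
def opposite : J ⊕ J → J ⊕ J := Sum.swap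

/-- Cutting one edge with label `h` at the root leaves a rooted tree and a branch. The branch keeps
the other end of the cut edge as a free half-edge, hence the opposite label. -/
theorem rootedCoeff_select_add (F : (J ⊕ J →₀ ℕ) → A) (s : J ⊕ J →₀ ℕ) (h : J ⊕ J) (n : ℕ) :
    ((s h + 1 : ℕ) : ℝ) • rootedCoeff F (select (s + Finsupp.single h 1)) n =
      ∑ p ∈ antidiagonal n,
        rootedCoeff F (select s) p.1 * markedCoeff F (shift (opposite h) F) p.2 := by
  have hn : (none : Option (Fin n)) ∉ (univ.map Function.Embedding.some) := by simp
  have key : ((s h + 1 : ℕ) : A) * rootedSum F (select (s + Finsupp.single h 1))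
        (none : Option (Fin n)) (univ.map Function.Embedding.some) =
      ∑ C ∈ (univ.map Function.Embedding.some).powerset,
        rootedSum F (select s) (none : Option (Fin n)) C *
        markedSum F (shift (opposite h) F) (univ.map Function.Embedding.some \ C) := by
    cases h with
    | inl i => exact rootedSum_select_inl F hn s i
    | inr i => exact rootedSum_select_inr F hn s i
  have key2 : ∀ C ∈ ((univ : Finset (Fin n)).map Function.Embedding.some).powerset,
      rootedSum F (select s) (none : Option (Fin n)) C *
        markedSum F (shift (opposite h) F) (univ.map Function.Embedding.some \ C) =
      ((C.card.factorial : ℝ) • rootedCoeff F (select s) C.card) *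
      (((univ.map Function.Embedding.some \ C).card.factorial : ℝ) •
        markedCoeff F (shift (opposite h) F) (univ.map Function.Embedding.some \ C).card) := by
    intro C hC
    rw [markedCoeff_eq, rootedSum_eq_rootedCount F _ fun h => hn (mem_powerset.1 hC h),
      rootedCoeff, smul_smul, mul_inv_cancel₀ (by positivity), one_smul]
  rw [sum_congr rfl key2] at key
  have := sum_powerset_mul ((univ : Finset (Fin n)).map Function.Embedding.some)
    (rootedCoeff F (select s)) (markedCoeff F (shift (opposite h) F))
  rw [← key] at this
  simp only [card_map, card_univ, Fintype.card_fin] at this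
  rw [← this, rootedCoeff, smul_comm, Nat.cast_smul_eq_nsmul ℝ (s h + 1), nsmul_eq_mul]
  rfl

/-- Trees are vertex-rooted trees minus edge-rooted trees. -/
theorem treeCoeff_eq (F : (J ⊕ J →₀ ℕ) → A) (n : ℕ) :
    treeCoeff F n = markedCoeff F F n - ∑ i, ∑ p ∈ antidiagonal n,
      markedCoeff F (shift (Sum.inl i) F) p.1 * markedCoeff F (shift (Sum.inr i) F) p.2 := by
  have h1 := markedSum_self F (univ : Finset (Fin n))
  have h2 := sum_card_spanningTrees F (univ : Finset (Fin n))
  -- A tree has one more vertex than edges, so weighting it by vertices minus edges counts it once.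
  have h3 : ∀ E ∈ spanningTrees J (univ : Finset (Fin n)),
      ((univ : Finset (Fin n)).card : A) * ∏ x, F (endLabels E x) -
        (E.card : A) * ∏ x, F (endLabels E x) = ∏ x, F (endLabels E x) := by
    intro E hE
    rw [mem_spanningTrees] at hE
    rw [← hE.card_eq]
    push_cast
    ring
  rw [treeCoeff, ← sum_congr rfl h3, sum_sub_distrib, ← mul_sum, ← h1, h2, smul_sub, markedCoeff_eq,
    smul_smul, card_univ, Fintype.card_fin, inv_mul_cancel₀ (by positivity), one_smul, smul_sum]
  congr 1
  refine sum_congr rfl fun i _ => ?_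
  have := sum_powerset_mul (univ : Finset (Fin n)) (markedCoeff F (shift (Sum.inl i) F))
    (markedCoeff F (shift (Sum.inr i) F))
  rw [card_univ, Fintype.card_fin] at this
  rw [← this]
  simp_rw [markedCoeff_eq]

end ExponentialCoefficients

/-! ### Coefficientwise finite sums of formal power series. -/

section FormalSums
variable {σ T N : Type}

/-- The coefficientwise sum of a family of formal power series. -/
def formalSum (f : T → MvPowerSeries σ ℝ) : MvPowerSeries σ ℝ :=
  fun n => ∑ᶠ t, MvPowerSeries.coeff n (f t)

theorem hasFormalSum_formalSum {f : T → MvPowerSeries σ ℝ}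
    (h : ∀ n, (Function.support fun t => MvPowerSeries.coeff n (f t)).Finite) :
    HasFormalSum f (formalSum f) :=
  fun n => ⟨h n, rfl⟩

theorem HasFormalSum.unique {f : T → MvPowerSeries σ ℝ} {s s' : MvPowerSeries σ ℝ}
    (h : HasFormalSum f s) (h' : HasFormalSum f s') : s = s' := by
  ext n
  rw [← (h n).2, ← (h' n).2]

theorem HasFormalSum.eq_formalSum {f : T → MvPowerSeries σ ℝ} {s : MvPowerSeries σ ℝ}
    (h : HasFormalSum f s) : s = formalSum f :=
  h.unique (hasFormalSum_formalSum fun n => (h n).1)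

theorem hasFormalSum_zero : HasFormalSum (fun _ : T => (0 : MvPowerSeries σ ℝ)) 0 := by
  intro n
  simp [Function.support]

theorem HasFormalSum.add {f g : T → MvPowerSeries σ ℝ} {s t : MvPowerSeries σ ℝ}
    (hf : HasFormalSum f s) (hg : HasFormalSum g t) :
    HasFormalSum (fun x => f x + g x) (s + t) := by
  intro n
  refine ⟨((hf n).1.union (hg n).1).subset ?_, ?_⟩
  · intro x hx
    by_contra h
    simp only [Set.mem_union, Function.mem_support, not_or, not_not] at h
    exact hx (by simp [h.1, h.2])
  · simp only [map_add]
    rw [finsum_add_distrib (hf n).1 (hg n).1, (hf n).2, (hg n).2]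

theorem HasFormalSum.mul_left {f : T → MvPowerSeries σ ℝ} {s : MvPowerSeries σ ℝ}
    (c : MvPowerSeries σ ℝ) (hf : HasFormalSum f s) : HasFormalSum (fun x => c * f x) (c * s) := by
  classical
  intro n
  have hfin : ∀ p : (σ →₀ ℕ) × (σ →₀ ℕ), (Function.support fun x =>
      MvPowerSeries.coeff p.1 c * MvPowerSeries.coeff p.2 (f x)).Finite := fun p =>
    ((hf p.2).1).subset fun x hx h => hx (by simp [h])
  simp only [MvPowerSeries.coeff_mul]
  constructor
  · refine ((antidiagonal n).finite_toSet.biUnion fun p _ => hfin p).subset ?_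
    intro x hx
    obtain ⟨p, hp, h⟩ := exists_ne_zero_of_sum_ne_zero hx
    exact Set.mem_biUnion hp h
  · rw [finsum_sum_comm _ _ fun p _ => hfin p]
    refine sum_congr rfl fun p _ => ?_
    rw [← (hf p.2).2, mul_finsum' _ _ (hf p.2).1]

theorem HasFormalSum.smul {f : T → MvPowerSeries σ ℝ} {s : MvPowerSeries σ ℝ}
    (c : ℝ) (hf : HasFormalSum f s) : HasFormalSum (fun x => c • f x) (c • s) := by
  simpa only [MvPowerSeries.smul_eq_C_mul] using hf.mul_left (MvPowerSeries.C c)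

theorem HasFormalSum.neg {f : T → MvPowerSeries σ ℝ} {s : MvPowerSeries σ ℝ}
    (hf : HasFormalSum f s) : HasFormalSum (fun x => -f x) (-s) := by
  simpa using hf.smul (-1)

theorem HasFormalSum.sub {f g : T → MvPowerSeries σ ℝ} {s t : MvPowerSeries σ ℝ}
    (hf : HasFormalSum f s) (hg : HasFormalSum g t) :
    HasFormalSum (fun x => f x - g x) (s - t) := by
  simpa only [sub_eq_add_neg] using hf.add hg.neg

theorem HasFormalSum.sum {ι : Type} (I : Finset ι) {f : ι → T → MvPowerSeries σ ℝ}
    {s : ι → MvPowerSeries σ ℝ} (h : ∀ i ∈ I, HasFormalSum (f i) (s i)) :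
    HasFormalSum (fun x => ∑ i ∈ I, f i x) (∑ i ∈ I, s i) := by
  classical
  induction I using Finset.induction_on with
  | empty => simpa using hasFormalSum_zero
  | insert a I ha ih =>
    simp only [sum_insert ha]
    exact (h a (mem_insert_self _ _)).add (ih fun i hi => h i (mem_insert_of_mem hi))

theorem hasFormalSum_of_support_subset (I : Finset T) {f : T → MvPowerSeries σ ℝ}
    (h : ∀ t, t ∉ I → f t = 0) : HasFormalSum f (∑ t ∈ I, f t) := by
  intro n
  have hs : (Function.support fun t => MvPowerSeries.coeff n (f t)) ⊆ I := by
    intro t ht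
    by_contra hn
    exact ht (by simp [h t hn])
  refine ⟨I.finite_toSet.subset hs, ?_⟩
  rw [finsum_eq_sum_of_support_subset _ hs, map_sum]

/-- Terms outside the range of an injective map which vanish may be omitted. -/
theorem hasFormalSum_comp_injective {e : N → T} (he : Function.Injective e)
    {f : T → MvPowerSeries σ ℝ} (hf : ∀ t, t ∉ Set.range e → f t = 0) {s : MvPowerSeries σ ℝ} :
    HasFormalSum (fun x => f (e x)) s ↔ HasFormalSum f s := by
  classical
  refine forall_congr' fun n => ?_
  have hs : (Function.support fun t => MvPowerSeries.coeff n (f t)) =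
      e '' Function.support fun x => MvPowerSeries.coeff n (f (e x)) := by
    ext t
    constructor
    · intro ht
      by_cases h : t ∈ Set.range e
      · obtain ⟨x, rfl⟩ := h
        exact ⟨x, ht, rfl⟩
      · exact absurd (by simp [hf t h]) ht
    · rintro ⟨x, hx, rfl⟩
      exact hx
  rw [hs, Set.finite_image_iff he.injOn, ← finsum_mem_range he (f := fun t =>
    MvPowerSeries.coeff n (f t))]
  have : ∀ t, (∑ᶠ (_ : t ∈ Set.range e), MvPowerSeries.coeff n (f t)) =
      MvPowerSeries.coeff n (f t) := by
    intro t
    by_cases h : t ∈ Set.range e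
    · rw [finsum_eq_if, if_pos h]
    · rw [finsum_eq_if, if_neg h, hf t h, map_zero]
  simp_rw [this]

open Classical in
/-- Summation along the fibres of a map. -/
theorem hasFormalSum_fiberwise {f : T → MvPowerSeries σ ℝ}
    (hf : ∀ n, (Function.support fun t => MvPowerSeries.coeff n (f t)).Finite) (p : T → N)
    {g : N → MvPowerSeries σ ℝ}
    (hg : ∀ x, HasFormalSum (fun t => if p t = x then f t else 0) (g x))
    {s : MvPowerSeries σ ℝ} : HasFormalSum f s ↔ HasFormalSum g s := by
  refine forall_congr' fun n => ?_
  have hgx : ∀ x, MvPowerSeries.coeff n (g x) =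
      ∑ t ∈ (hf n).toFinset with p t = x, MvPowerSeries.coeff n (f t) := by
    intro x
    rw [← (hg x n).2, finsum_eq_sum_of_support_subset (s := (hf n).toFinset), sum_filter]
    · refine sum_congr rfl fun t _ => ?_
      split_ifs with h <;> simp [h]
    · intro t ht
      simp only [Set.Finite.coe_toFinset, Function.mem_support]
      intro h
      apply ht
      simp only
      split_ifs <;> simp [h]
  have hsub : (Function.support fun x => MvPowerSeries.coeff n (g x)) ⊆
      (hf n).toFinset.image p := by
    intro x hx
    rw [Function.mem_support, hgx] at hx
    obtain ⟨t, ht, -⟩ := exists_ne_zero_of_sum_ne_zero hx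
    rw [mem_filter] at ht
    exact mem_coe.2 (mem_image.2 ⟨t, ht.1, ht.2⟩)
  refine and_congr (iff_of_true (hf n) ((finite_toSet _).subset hsub)) ?_
  rw [finsum_eq_sum _ (hf n), finsum_eq_sum_of_support_subset _ hsub]
  simp_rw [hgx]
  rw [sum_fiberwise_of_maps_to fun t ht => mem_image_of_mem p ht]

/-- The Cauchy product. -/
theorem HasFormalSum.mul_antidiagonal {f g : ℕ → MvPowerSeries σ ℝ} {s t : MvPowerSeries σ ℝ}
    (hf : HasFormalSum f s) (hg : HasFormalSum g t) :
    HasFormalSum (fun n => ∑ p ∈ antidiagonal n, f p.1 * g p.2) (s * t) := by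
  classical
  -- For a fixed monomial the sequence of coefficients is finitely supported, hence a polynomial
  -- whose value at 1 is the sum. The Cauchy product then reduces to multiplicativity of evaluation
  -- at 1.
  have hpoly : ∀ {h : ℕ → MvPowerSeries σ ℝ} {u : MvPowerSeries σ ℝ}, HasFormalSum h u → ∀ m,
      ∃ P : Polynomial ℝ, (∀ n, P.coeff n = MvPowerSeries.coeff m (h n)) ∧
        P.eval 1 = MvPowerSeries.coeff m u := by
    intro h u hu m
    have hc : ∀ n, (∑ k ∈ (hu m).1.toFinset,
        Polynomial.monomial k (MvPowerSeries.coeff m (h k))).coeff n =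
        MvPowerSeries.coeff m (h n) := by
      intro n
      simp only [Polynomial.finsetSum_coeff, Polynomial.coeff_monomial]
      rw [sum_ite_eq' (hu m).1.toFinset n]
      split_ifs with hn
      · rfl
      · simp only [Set.Finite.mem_toFinset, Function.mem_support, not_not] at hn
        exact hn.symm
    refine ⟨_, hc, ?_⟩
    refine Eq.trans ?_ ((finsum_eq_sum _ (hu m).1).symm.trans (hu m).2)
    simp [Polynomial.eval_finsetSum]
  intro m
  choose P hP hP1 using hpoly hf
  choose Q hQ hQ1 using hpoly hg
  have hcoef : ∀ n, MvPowerSeries.coeff m (∑ p ∈ antidiagonal n, f p.1 * g p.2) =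
      (∑ q ∈ antidiagonal m, P q.1 * Q q.2).coeff n := by
    intro n
    simp only [map_sum, MvPowerSeries.coeff_mul, Polynomial.finsetSum_coeff, Polynomial.coeff_mul]
    rw [sum_comm]
    simp only [hP, hQ]
  simp_rw [hcoef]
  set R : Polynomial ℝ := ∑ q ∈ antidiagonal m, P q.1 * Q q.2 with hR
  have hsub : (Function.support fun n => R.coeff n) ⊆ R.support := by
    intro n hn
    simpa using hn
  refine ⟨(finite_toSet _).subset hsub, ?_⟩
  rw [finsum_eq_sum_of_support_subset _ hsub, MvPowerSeries.coeff_mul]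
  simp_rw [← hP1, ← hQ1, ← Polynomial.eval_mul]
  rw [← Polynomial.eval_finsetSum, ← hR, Polynomial.eval_eq_sum, Polynomial.sum]
  simp

end FormalSums

/-! ### Generating series of rooted trees and of branches. -/

section RootedSeries
variable {σ J : Type} [DecidableEq J] [Fintype J]

/-- The numbers of labels of the first kind. -/
def leftPart (s : J ⊕ J →₀ ℕ) : J →₀ ℕ := (Finsupp.sumFinsuppAddEquivProdFinsupp s).1

/-- The numbers of labels of the second kind. -/
def rightPart (s : J ⊕ J →₀ ℕ) : J →₀ ℕ := (Finsupp.sumFinsuppAddEquivProdFinsupp s).2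

/-- A condition on vertex factors which ensures that only finitely many trees contribute to each
coefficient: a vertex with only one half-edge of the first kind has positive order. -/
def Admissible (deg : (σ →₀ ℕ) →+ ℕ) (F : (J ⊕ J →₀ ℕ) → MvPowerSeries σ ℝ) : Prop :=
  ∀ s p, s ≠ 0 → MvPowerSeries.coeff p (F s) ≠ 0 → 2 ≤ (leftPart s).degree + 2 * deg p

theorem degree_leftPart (s : J ⊕ J →₀ ℕ) : (leftPart s).degree = ∑ i, s (Sum.inl i) := by
  rw [Finsupp.degree_eq_sum]
  rfl

theorem degree_eq_left_add_right (s : J ⊕ J →₀ ℕ) :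
    s.degree = (leftPart s).degree + (rightPart s).degree := by
  simp only [Finsupp.degree_eq_sum, Fintype.sum_sum_type]
  rfl

/-- Each edge has one tail, so it is counted at most once. -/
theorem sum_degree_leftPart_le {V : Type} [DecidableEq V] (E : Finset (V × V × J)) (L : Finset V) :
    ∑ v ∈ L, (leftPart (endLabels E v)).degree ≤ E.card := by
  simp_rw [degree_leftPart, endLabels_inl]
  have : ∀ v, ∑ i, ∑ e ∈ E, (if e.1 = v ∧ e.2.2 = i then 1 else 0) =
      ∑ e ∈ E, if e.1 = v then 1 else 0 := by
    intro v
    rw [sum_comm]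
    refine sum_congr rfl fun e _ => ?_
    split_ifs with h <;> simp [h]
  simp_rw [this]
  rw [sum_comm, card_eq_sum_ones]
  refine sum_le_sum fun e _ => ?_
  rw [sum_ite_eq]
  split_ifs <;> simp

theorem degree_endLabels_le {V : Type} [DecidableEq V] (E : Finset (V × V × J)) (v : V) :
    (endLabels E v).degree ≤ 2 * E.card := by
  rw [endLabels, map_sum, mul_comm, ← smul_eq_mul]
  refine sum_le_card_nsmul _ _ _ fun e _ => ?_
  rw [map_add]
  split_ifs <;> simp

variable {deg : (σ →₀ ℕ) →+ ℕ} {F : (J ⊕ J →₀ ℕ) → MvPowerSeries σ ℝ}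

/-- The tree has `L.card` edges, so the outgoing half-edges at `L` number at most `L.card`. Summing
the admissibility inequality over `L` gives `2 * L.card ≤ L.card + 2 * deg m`. -/
theorem Admissible.card_le (hF : Admissible deg F) {V : Type} [DecidableEq V] {r : V}
    {L : Finset V} (hr : r ∉ L) {E : Finset (V × V × J)} (hE : SpansTree (insert r L) E)
    {m : σ →₀ ℕ} (hm : MvPowerSeries.coeff m (∏ v ∈ L, F (endLabels E v)) ≠ 0) :
    L.card ≤ 2 * deg m := by
  classical
  rw [MvPowerSeries.coeff_prod] at hm
  obtain ⟨l, hl, hne⟩ := exists_ne_zero_of_sum_ne_zero hm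
  rw [mem_finsuppAntidiag] at hl
  have hcard := hE.card_eq
  rw [card_insert_of_notMem hr] at hcard
  have h1 : ∀ v ∈ L, 2 ≤ (leftPart (endLabels E v)).degree + 2 * deg (l v) := by
    intro v hv
    refine hF _ _ ?_ (fun h => hne (prod_eq_zero hv h))
    -- A vertex without half-edges would be the whole tree, which also contains the root.
    intro h0
    have hcl : EdgeClosed E {v} := by
      intro e he
      have k1 : e.1 ≠ v := by
        intro h1
        have := DFunLike.congr_fun h0 (Sum.inl e.2.2)
        rw [endLabels_inl, Finsupp.zero_apply, sum_eq_zero_iff] at this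
        simpa [h1] using this e he
      have k2 : e.2.1 ≠ v := by
        intro h1
        have := DFunLike.congr_fun h0 (Sum.inr e.2.2)
        rw [endLabels_inr, Finsupp.zero_apply, sum_eq_zero_iff] at this
        simpa [h1] using this e he
      simp [k1, k2]
    have := hE.conn {v} (by simp [hv]) (by simp) hcl
    have hrv : r ∈ ({v} : Finset V) := this ▸ mem_insert_self _ _
    rw [mem_singleton] at hrv
    exact hr (hrv ▸ hv)
  have h2 := sum_le_sum h1
  rw [sum_const, smul_eq_mul, sum_add_distrib, ← mul_sum, ← map_sum deg, hl.1] at h2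
  have h3 := sum_degree_leftPart_le E L
  omega

/-- The second bound follows from the first: a tree with a root and `n` further vertices has `n`
edges, and the root carries at most two half-edges of each. -/
theorem Admissible.rootedCoeff_bound (hF : Admissible deg F) {s : J ⊕ J →₀ ℕ} {n : ℕ}
    {m : σ →₀ ℕ} (hm : MvPowerSeries.coeff m (rootedCoeff F (select s) n) ≠ 0) :
    n ≤ 2 * deg m ∧ s.degree ≤ 4 * deg m := by
  rw [rootedCoeff, rootedCount, rootedSum, MvPowerSeries.coeff_smul, map_sum] at hm
  obtain ⟨E, hE, hne⟩ := exists_ne_zero_of_sum_ne_zero (right_ne_zero_of_mul hm)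
  rw [mem_spanningTrees] at hE
  have hs : endLabels E none = s := by
    by_contra h
    exact hne (by simp [select, h])
  rw [select, if_pos hs, one_mul] at hne
  have h1 := hF.card_le (by simp) hE hne
  have h2 := hE.card_eq
  rw [card_insert_of_notMem (by simp)] at h2
  have h3 := degree_endLabels_le E none
  rw [hs] at h3
  simp only [card_map, card_univ, Fintype.card_fin] at h1 h2
  omega

/-- Linearity in the root factor, `K` being the combination of the functionals `select s` with
coefficients `K s`. For fixed `n` only the finitely many label sets that occur at roots contribute.
-/
theorem hasFormalSum_rootedCoeff_select (F K : (J ⊕ J →₀ ℕ) → MvPowerSeries σ ℝ) (n : ℕ) :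
    HasFormalSum (fun s => K s * rootedCoeff F (select s) n) (rootedCoeff F K n) := by
  classical
  set P : Finset (Option (Fin n)) := insert none (univ.map Function.Embedding.some) with hP
  set I := (spanningTrees J P).image fun E => endLabels E none with hI
  convert hasFormalSum_of_support_subset I (f := fun s => K s * rootedCoeff F (select s) n) ?_
  · simp only [rootedCoeff, rootedCount, rootedSum, mul_smul_comm, mul_sum]
    rw [← smul_sum, sum_comm]
    congr 1
    refine sum_congr rfl fun E hE => ?_
    rw [sum_eq_single (endLabels E none)]
    · simp [select]
    · intro s _ hs
      simp [select, hs.symm]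
    · intro h
      exact absurd (mem_image_of_mem (fun E => endLabels E none) hE) h
  · intro s hs
    rw [rootedCoeff, rootedCount, rootedSum, sum_eq_zero, smul_zero, mul_zero]
    intro E hE
    rw [select, if_neg, zero_mul]
    rintro rfl
    exact hs (mem_image_of_mem (fun E => endLabels E none) hE)

/-- The sum of all trees with one distinguished vertex, which carries the factor `K`. -/
def markedSeries (F K : (J ⊕ J →₀ ℕ) → MvPowerSeries σ ℝ) : MvPowerSeries σ ℝ :=
  formalSum (rootedCoeff F K)

theorem Admissible.pair_finite (hF : Admissible deg F) (K : (J ⊕ J →₀ ℕ) → MvPowerSeries σ ℝ)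
    (m : σ →₀ ℕ) : (Function.support fun x : (J ⊕ J →₀ ℕ) × ℕ =>
      MvPowerSeries.coeff m (K x.1 * rootedCoeff F (select x.1) x.2)).Finite := by
  classical
  refine (Set.Finite.prod (Finsupp.finite_of_degree_le (4 * deg m))
    (Set.finite_le_nat (2 * deg m))).subset ?_
  rintro ⟨s, n⟩ hx
  rw [Function.mem_support, MvPowerSeries.coeff_mul] at hx
  obtain ⟨p, hp, hne⟩ := exists_ne_zero_of_sum_ne_zero hx
  have := hF.rootedCoeff_bound (right_ne_zero_of_mul hne)
  rw [HasAntidiagonal.mem_antidiagonal] at hp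
  have hd : deg p.1 + deg p.2 = deg m := by rw [← map_add, hp]
  dsimp only at this
  exact Set.mk_mem_prod (Set.mem_ofPred.2 (by omega)) (Set.mem_ofPred.2 (by omega))

theorem Admissible.hasFormalSum_select (hF : Admissible deg F) (s : J ⊕ J →₀ ℕ) :
    HasFormalSum (rootedCoeff F (select s)) (markedSeries F (select s)) :=
  hasFormalSum_formalSum fun m => (Set.finite_le_nat (2 * deg m)).subset
    fun _ hn => (hF.rootedCoeff_bound hn).1

/-- Interchange of summation in the double family indexed by the labels `s` of the root and the
number `n` of other vertices, which `Admissible.pair_finite` permits. -/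
theorem Admissible.hasFormalSum_pair (hF : Admissible deg F)
    (K : (J ⊕ J →₀ ℕ) → MvPowerSeries σ ℝ) :
    HasFormalSum (rootedCoeff F K) (markedSeries F K) ∧
      HasFormalSum (fun s => K s * markedSeries F (select s)) (markedSeries F K) := by
  classical
  have h0 := hasFormalSum_formalSum (hF.pair_finite K)
  have h1 := (hasFormalSum_fiberwise (hF.pair_finite K) Prod.snd (g := rootedCoeff F K) (by
    intro n
    refine (hasFormalSum_comp_injective (e := fun s => (s, n))
      (fun a b h => (Prod.mk.inj h).1) ?_).1 ?_
    · rintro ⟨s, k⟩ h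
      exact if_neg fun hk => h ⟨s, by rw [← hk]⟩
    · simpa using hasFormalSum_rootedCoeff_select F K n)).1 h0
  have h2 := (hasFormalSum_fiberwise (hF.pair_finite K) Prod.fst
    (g := fun s => K s * markedSeries F (select s)) (by
    intro s
    refine (hasFormalSum_comp_injective (e := fun n => (s, n))
      (fun a b h => (Prod.mk.inj h).2) ?_).1 ?_
    · rintro ⟨s', k⟩ h
      exact if_neg fun hk => h ⟨k, by rw [← hk]⟩
    · simpa using (hF.hasFormalSum_select s).mul_left (K s))).1 h0
  rw [h1.eq_formalSum] at h2
  rw [h1.eq_formalSum] at h1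
  exact ⟨h1, h2⟩

theorem hasFormalSum_markedCoeff {K : (J ⊕ J →₀ ℕ) → MvPowerSeries σ ℝ} {u : MvPowerSeries σ ℝ}
    (h : HasFormalSum (rootedCoeff F K) u) : HasFormalSum (markedCoeff F K) u := by
  refine (hasFormalSum_comp_injective (e := Nat.succ) Nat.succ_injective ?_).1 h
  intro n hn
  cases n with
  | zero => rfl
  | succ n => exact absurd ⟨n, rfl⟩ hn

/-- The sum of all trees with one free half-edge, which carries the label opposite to `h`. -/
def branchSeries (F : (J ⊕ J →₀ ℕ) → MvPowerSeries σ ℝ) (h : J ⊕ J) : MvPowerSeries σ ℝ :=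
  markedSeries F (shift (opposite h) F)

/-- The branches at a root are independent, and those at half-edges with equal labels are unordered.
Formally, `rootedCoeff_select_add` sums to `(s_h + 1) R_{s+h} = R_s B_h`, and induction on the
degree of `s` collects the factorials. -/
theorem Admissible.markedSeries_select (hF : Admissible deg F) (s : J ⊕ J →₀ ℕ) :
    markedSeries F (select s) =
      MvPowerSeries.C (∏ h, ((s h).factorial : ℝ)⁻¹) * ∏ h, branchSeries F h ^ s h := by
  induction hn : s.degree generalizing s with
  | zero =>
    have hs : s = 0 := (Finsupp.degree_eq_zero_iff s).1 hn
    subst hs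
    have h1 : HasFormalSum (rootedCoeff F (select 0)) (1 : MvPowerSeries σ ℝ) := by
      convert hasFormalSum_of_support_subset {0} (f := rootedCoeff F (select 0)) ?_
      · simp [rootedCoeff_select_zero]
      · intro n hn
        rw [rootedCoeff_select_zero, if_neg (by simpa using hn)]
    rw [(hF.hasFormalSum_select 0).unique h1]
    simp
  | succ k ih =>
    obtain ⟨h, hh⟩ : ∃ h, s h ≠ 0 := by
      by_contra hc
      push Not at hc
      have : s = 0 := Finsupp.ext hc
      simp [this] at hn
    obtain ⟨s', rfl⟩ : ∃ s', s = s' + Finsupp.single h 1 :=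
      ⟨s - Finsupp.single h 1, (tsub_add_cancel_of_le (by simpa using Nat.one_le_iff_ne_zero.2 hh)).symm⟩
    have hs' : s'.degree = k := by
      rw [map_add, Finsupp.degree_single] at hn
      omega
    have hrec : HasFormalSum (fun n => ((s' h + 1 : ℕ) : ℝ) •
        rootedCoeff F (select (s' + Finsupp.single h 1)) n)
        (markedSeries F (select s') * branchSeries F h) := by
      simp_rw [rootedCoeff_select_add]
      exact (hF.hasFormalSum_select s').mul_antidiagonal
        (hasFormalSum_markedCoeff (hF.hasFormalSum_pair _).1)
    have heq := ((hF.hasFormalSum_select (s' + Finsupp.single h 1)).smul _).unique hrec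
    have hpos : ((s' h + 1 : ℕ) : ℝ) ≠ 0 := by positivity
    have hp : ∏ x, branchSeries F x ^ (s' + Finsupp.single h 1 : J ⊕ J →₀ ℕ) x =
        (∏ x, branchSeries F x ^ s' x) * branchSeries F h := by
      simp only [Finsupp.add_apply, pow_add, prod_mul_distrib]
      congr 1
      rw [prod_eq_single h]
      · simp
      · intro b _ hb
        rw [Finsupp.single_eq_of_ne hb, pow_zero]
      · simp
    have hfac : ∏ x, (((s' + Finsupp.single h 1 : J ⊕ J →₀ ℕ) x).factorial : ℝ)⁻¹ =
        ((s' h + 1 : ℕ) : ℝ)⁻¹ * ∏ x, ((s' x).factorial : ℝ)⁻¹ := by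
      rw [← mul_prod_erase univ _ (mem_univ h), ← mul_prod_erase univ
        (fun x => ((s' x).factorial : ℝ)⁻¹) (mem_univ h), ← mul_assoc]
      congr 1
      · rw [Finsupp.add_apply, Finsupp.single_eq_same, Nat.factorial_succ, Nat.cast_mul, mul_inv]
      · refine prod_congr rfl fun x hx => ?_
        rw [Finsupp.add_apply, Finsupp.single_eq_of_ne (ne_of_mem_erase hx), add_zero]
    rw [hp, hfac, map_mul, mul_assoc, ← mul_assoc (MvPowerSeries.C (∏ x, _)), ← ih s' hs', ← heq,
      ← MvPowerSeries.smul_eq_C_mul, smul_smul, inv_mul_cancel₀ hpos, one_smul]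

/-- Evaluation at the branch series. -/
theorem Admissible.hasFormalSum_markedSeries (hF : Admissible deg F)
    (K : (J ⊕ J →₀ ℕ) → MvPowerSeries σ ℝ) :
    HasFormalSum (fun s => K s * (MvPowerSeries.C (∏ h, ((s h).factorial : ℝ)⁻¹) *
      ∏ h, branchSeries F h ^ s h)) (markedSeries F K) := by
  simpa only [hF.markedSeries_select] using (hF.hasFormalSum_pair K).2

/-- The edge-rooted terms of `treeCoeff_eq` are Cauchy products of the two branches obtained by
cutting the edge. -/
theorem Admissible.hasFormalSum_treeCoeff (hF : Admissible deg F) :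
    HasFormalSum (treeCoeff F) (markedSeries F F -
      ∑ i, branchSeries F (Sum.inr i) * branchSeries F (Sum.inl i)) := by
  have h := fun K => hasFormalSum_markedCoeff (hF.hasFormalSum_pair K).1
  convert (h F).sub (HasFormalSum.sum univ fun i _ =>
    (h (shift (Sum.inl i) F)).mul_antidiagonal (h (shift (Sum.inr i) F))) using 1
  · ext1 n
    exact treeCoeff_eq F n
  · rfl

end RootedSeries

/-! ### Partial derivatives of smooth functions, one index at a time. -/

section Derivatives
variable {d : ℕ}

/-- The partial derivative `∂_i f`. -/
def partialDeriv (i : Fin d) (f : Pt d → ℝ) : Pt d → ℝ := fun z => fderiv ℝ f z (Pi.single i 1)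

/-- Iterated partial derivatives; the first index in the list is applied first. -/
def iterPartial : List (Fin d) → (Pt d → ℝ) → Pt d → ℝ
  | [], f => f
  | i :: l, f => iterPartial l (partialDeriv i f)

variable {V : Set (Pt d)} (hV : IsOpen V)
include hV

theorem contDiffOn_partialDeriv {f : Pt d → ℝ} (hf : ContDiffOn ℝ ∞ f V) (i : Fin d) :
    ContDiffOn ℝ ∞ (partialDeriv i f) V :=
  (hf.fderiv_of_isOpen hV (by simp)).clm_apply contDiffOn_const

theorem iterPartial_congr {f g : Pt d → ℝ} (h : ∀ z ∈ V, f z = g z) (l : List (Fin d)) :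
    ∀ z ∈ V, iterPartial l f z = iterPartial l g z := by
  induction l generalizing f g with
  | nil => exact h
  | cons i l ih =>
    refine ih fun z hz => ?_
    have : f =ᶠ[nhds z] g := Filter.eventually_of_mem (hV.mem_nhds hz) h
    rw [partialDeriv, partialDeriv, this.fderiv_eq]

theorem partialDeriv_comm {f : Pt d → ℝ} (hf : ContDiffOn ℝ ∞ f V) (i j : Fin d) :
    ∀ z ∈ V, partialDeriv i (partialDeriv j f) z = partialDeriv j (partialDeriv i f) z := by
  intro z hz
  have hfz : ContDiffAt ℝ ∞ f z := hf.contDiffAt (hV.mem_nhds hz)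
  have hd : DifferentiableAt ℝ (fderiv ℝ f) z :=
    (hfz.fderiv_right (m := 1) (WithTop.coe_le_coe.2 le_top)).differentiableAt (by simp)
  have key : ∀ v w : Pt d, fderiv ℝ (fun y => fderiv ℝ f y v) z w =
      fderiv ℝ (fderiv ℝ f) z w v := by
    intro v w
    rw [fderiv_clm_apply hd (differentiableAt_const v)]
    simp
  have hs := hfz.isSymmSndFDerivAt (by simp; exact WithTop.coe_le_coe.2 le_top)
  change fderiv ℝ (fun y => fderiv ℝ f y (Pi.single j 1)) z (Pi.single i 1) =
    fderiv ℝ (fun y => fderiv ℝ f y (Pi.single i 1)) z (Pi.single j 1)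
  rw [key, key]
  exact hs _ _

theorem iterPartial_perm {f : Pt d → ℝ} (hf : ContDiffOn ℝ ∞ f V) {l l' : List (Fin d)}
    (h : l.Perm l') : ∀ z ∈ V, iterPartial l f z = iterPartial l' f z := by
  induction h generalizing f with
  | nil => exact fun _ _ => rfl
  | cons i _ ih => exact ih (contDiffOn_partialDeriv hV hf i)
  | swap i j l =>
    exact iterPartial_congr hV (partialDeriv_comm hV hf i j) l
  | trans _ _ ih1 ih2 => exact fun z hz => (ih1 hf z hz).trans (ih2 hf z hz)

/-- The last direction of `iteratedFDeriv` belongs to the innermost derivative, while `iterPartial`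
starts from the head of the list; hence the reversal. -/
theorem iteratedFDeriv_eq_iterPartial {f : Pt d → ℝ} (hf : ContDiffOn ℝ ∞ f V) {a : Pt d}
    (ha : a ∈ V) (n : ℕ) (c : Fin n → Fin d) :
    iteratedFDeriv ℝ n f a (fun k => Pi.single (c k) 1) =
      iterPartial (List.ofFn c).reverse f a := by
  induction n generalizing f with
  | zero => simp [iterPartial]
  | succ n ih =>
    rw [List.ofFn_succ_last, List.reverse_append, List.reverse_singleton,
      List.singleton_append, iterPartial, ← ih (contDiffOn_partialDeriv hV hf _),
      iteratedFDeriv_succ_apply_right]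
    have hfa : ContDiffAt ℝ ∞ f a := hf.contDiffAt (hV.mem_nhds ha)
    have hc : ContDiffAt ℝ n (fderiv ℝ f) a :=
      hfa.fderiv_right (by exact_mod_cast le_top)
    have := (ContinuousLinearMap.apply ℝ ℝ (Pi.single (c (Fin.last n)) (1 : ℝ) :
      Pt d)).iteratedFDeriv_comp_left hc (i := n) le_rfl
    have h2 : partialDeriv (c (Fin.last n)) f =
        (ContinuousLinearMap.apply ℝ ℝ (Pi.single (c (Fin.last n)) (1 : ℝ) : Pt d)) ∘
          fderiv ℝ f := rfl
    rw [h2, this]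
    rfl

theorem mixedPartial_eq_iterPartial {f : Pt d → ℝ} (hf : ContDiffOn ℝ ∞ f V) {a : Pt d}
    (ha : a ∈ V) (l : List (Fin d)) : mixedPartial (l : Multiset (Fin d)) f a =
      iterPartial l f a := by
  rw [mixedPartial, listPartial, iteratedFDeriv_eq_iterPartial hV hf ha]
  refine iterPartial_perm hV hf ?_ a ha
  refine (List.reverse_perm _).trans ?_
  have h : List.ofFn (fun k => (l : Multiset (Fin d)).sort.get k) = (l : Multiset (Fin d)).sort :=
    List.ofFn_get _
  rw [h, ← Multiset.coe_eq_coe, Multiset.sort_eq]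

/-- Symmetry of derivatives makes the sorted order in `mixedPartial` irrelevant. This form lets a
free half-edge at a white vertex be read as one more derivative of `G`. -/
theorem mixedPartial_cons {f : Pt d → ℝ} (hf : ContDiffOn ℝ ∞ f V) {a : Pt d}
    (ha : a ∈ V) (i : Fin d) (s : Multiset (Fin d)) :
    mixedPartial (i ::ₘ s) f a = mixedPartial s (partialDeriv i f) a := by
  induction s using Quotient.inductionOn with
  | h l =>
    refine (mixedPartial_eq_iterPartial hV hf ha (i :: l)).trans ?_
    exact (mixedPartial_eq_iterPartial hV (contDiffOn_partialDeriv hV hf i) ha l).symm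

theorem mixedPartial_add {f g : Pt d → ℝ} (hf : ContDiffOn ℝ ∞ f V) (hg : ContDiffOn ℝ ∞ g V)
    {a : Pt d} (ha : a ∈ V) (s : Multiset (Fin d)) :
    mixedPartial s (f + g) a = mixedPartial s f a + mixedPartial s g a := by
  rw [mixedPartial, listPartial, iteratedFDeriv_add_apply]
  · rfl
  · exact (hf.contDiffAt (hV.mem_nhds ha)).of_le (by exact_mod_cast le_top)
  · exact (hg.contDiffAt (hV.mem_nhds ha)).of_le (by exact_mod_cast le_top)

theorem mixedPartial_smul {f : Pt d → ℝ} (hf : ContDiffOn ℝ ∞ f V) (c : ℝ)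
    {a : Pt d} (ha : a ∈ V) (s : Multiset (Fin d)) :
    mixedPartial s (c • f) a = c • mixedPartial s f a := by
  rw [mixedPartial, listPartial, iteratedFDeriv_const_smul_apply]
  · rfl
  · exact (hf.contDiffAt (hV.mem_nhds ha)).of_le (by exact_mod_cast le_top)

omit hV in
theorem mixedPartial_zero (s : Multiset (Fin d)) (a : Pt d) :
    mixedPartial s (fun _ => (0 : ℝ)) a = 0 := by
  simp only [mixedPartial, listPartial]
  rw [iteratedFDeriv_fun_zero]
  rfl

end Derivatives

/-! ### Taylor expansion and the factors at black and white vertices. -/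

section Evaluation
variable {σ : Type} {d : ℕ}

/-- The divided monomial `∏ q_i^{α_i} / α_i!`. -/
def dividedMonomial {ι : Type} [Fintype ι] (q : ι → MvPowerSeries σ ℝ) (α : ι →₀ ℕ) :
    MvPowerSeries σ ℝ :=
  MvPowerSeries.C (∏ i, ((α i).factorial : ℝ)⁻¹) * ∏ i, q i ^ α i

theorem prod_factorial_mul_inv {ι : Type} [Fintype ι] (α : ι →₀ ℕ) :
    (∏ i, ((α i).factorial : ℝ)) * ∏ i, ((α i).factorial : ℝ)⁻¹ = 1 := by
  rw [← prod_mul_distrib]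
  exact prod_eq_one fun i _ => mul_inv_cancel₀ (by positivity)

theorem hasFormalSum_subst {q : Fin d → MvPowerSeries σ ℝ}
    (hq : ∀ i, MvPowerSeries.constantCoeff (q i) = 0) (f : MvPowerSeries (Fin d) ℝ) :
    HasFormalSum (fun α => MvPowerSeries.C (MvPowerSeries.coeff α f) * ∏ i, q i ^ α i)
      (MvPowerSeries.subst q f) := by
  have hs := MvPowerSeries.hasSubst_of_constantCoeff_zero hq
  intro n
  have h1 := MvPowerSeries.coeff_subst_finite hs f n
  have h2 := MvPowerSeries.coeff_subst hs f n
  have h3 : (fun α => MvPowerSeries.coeff α f •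
      MvPowerSeries.coeff n (α.prod fun s e => q s ^ e)) = fun α => MvPowerSeries.coeff n
        (MvPowerSeries.C (MvPowerSeries.coeff α f) * ∏ i, q i ^ α i) := by
    ext α
    rw [Finsupp.prod_fintype _ _ (by simp), MvPowerSeries.coeff_C_mul, smul_eq_mul]
  rw [h3] at h1 h2
  exact ⟨h1, h2.symm⟩

/-- The derivatives of a function with values in formal power series. -/
def derivTensor (G : Pt d → MvPowerSeries σ ℝ) (a : Pt d) (α : Fin d →₀ ℕ) : MvPowerSeries σ ℝ :=
  fun n => mixedPartial (Finsupp.toMultiset α) (fun z => MvPowerSeries.coeff n (G z)) a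

theorem coeff_derivTensor (G : Pt d → MvPowerSeries σ ℝ) (a : Pt d) (α : Fin d →₀ ℕ)
    (n : σ →₀ ℕ) : MvPowerSeries.coeff n (derivTensor G a α) =
      mixedPartial (Finsupp.toMultiset α) (fun z => MvPowerSeries.coeff n (G z)) a := rfl

/-- Taylor's formula for `G(a + h)` with the coefficients of `G` reassembled into power series,
which is the value of the white factors at `h`. -/
theorem hasFormalSum_evalFamily [DecidableEq σ] (G : Pt d → MvPowerSeries σ ℝ) (a : Pt d)
    {h y : Fin d → MvPowerSeries σ ℝ} (hh : ∀ i, MvPowerSeries.constantCoeff (h i) = 0)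
    (hy : ∀ i, y i = MvPowerSeries.C (a i) + h i) :
    HasFormalSum (fun α => derivTensor G a α * dividedMonomial h α) (evalFamily G y) := by
  have hc : (fun i => MvPowerSeries.constantCoeff (y i)) = a := by
    ext i
    simp [hy, hh]
  have hsub : (fun i => y i - MvPowerSeries.C (MvPowerSeries.constantCoeff (y i))) = h := by
    ext1 i
    simp [hy, hh]
  have hT : ∀ f : Pt d → ℝ, HasFormalSum (fun α => MvPowerSeries.C
      (MvPowerSeries.coeff α (taylorAt f a)) * ∏ i, h i ^ α i) (evalSmooth f y) := by
    intro f
    rw [evalSmooth, hc, hsub]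
    exact hasFormalSum_subst hh _
  intro m
  have hterm : ∀ α, MvPowerSeries.coeff m (derivTensor G a α * dividedMonomial h α) =
      ∑ p ∈ HasAntidiagonal.antidiagonal m, MvPowerSeries.coeff p.2 (MvPowerSeries.C
        (MvPowerSeries.coeff α (taylorAt (fun z => MvPowerSeries.coeff p.1 (G z)) a)) *
          ∏ i, h i ^ α i) := by
    intro α
    rw [MvPowerSeries.coeff_mul]
    refine sum_congr rfl fun p _ => ?_
    rw [coeff_derivTensor, dividedMonomial, MvPowerSeries.coeff_C_mul, MvPowerSeries.coeff_C_mul,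
      ← mul_assoc]
    congr 1
    rw [prod_inv_distrib]
    rfl
  simp_rw [hterm]
  constructor
  · refine ((HasAntidiagonal.antidiagonal m).finite_toSet.biUnion fun p _ =>
      (hT (fun z => MvPowerSeries.coeff p.1 (G z)) p.2).1).subset ?_
    intro α hα
    obtain ⟨p, hp, hne⟩ := exists_ne_zero_of_sum_ne_zero hα
    exact Set.mem_biUnion hp hne
  · refine (finsum_sum_comm _ _ ?_).trans ?_
    · exact fun p _ => (hT (fun z => MvPowerSeries.coeff p.1 (G z)) p.2).1
    · exact sum_congr rfl fun p _ => (hT _ p.2).2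

/-- The tensors `m! S^{i₁ … i_m}`, without the linear part of `S`. -/
def blackTensor (S : MvPowerSeries (Fin d) ℝ) (α : Fin d →₀ ℕ) : ℝ :=
  if α.degree = 1 then 0 else (∏ i, ((α i).factorial : ℝ)) * MvPowerSeries.coeff α S

/-- Vertex factors for two kinds of vertices: those with factors `b` have outgoing edges only,
those with factors `g` have incoming edges only. -/
def vertexFactor (b : (Fin d →₀ ℕ) → ℝ) (g : (Fin d →₀ ℕ) → MvPowerSeries σ ℝ)
    (s : Fin d ⊕ Fin d →₀ ℕ) : MvPowerSeries σ ℝ :=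
  (if rightPart s = 0 then MvPowerSeries.C (b (leftPart s)) else 0) +
    if leftPart s = 0 then g (rightPart s) else 0

/-- The functions `G(y) = ∑_n G_n(y) X^n` whose coefficients are smooth on `V` and vanish unless
`n` has degree one. -/
structure IsLinearFamily (deg : (σ →₀ ℕ) →+ ℕ) (V : Set (Pt d)) (G : Pt d → MvPowerSeries σ ℝ) :
    Prop where
  smooth : ∀ n, ContDiffOn ℝ ∞ (fun z => MvPowerSeries.coeff n (G z)) V
  linear : ∀ n, deg n ≠ 1 → ∀ z, MvPowerSeries.coeff n (G z) = 0

variable {deg : (σ →₀ ℕ) →+ ℕ} {V : Set (Pt d)} {G : Pt d → MvPowerSeries σ ℝ}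

theorem IsLinearFamily.coeff_derivTensor_eq_zero (hG : IsLinearFamily deg V G) {n : σ →₀ ℕ}
    (hn : deg n ≠ 1) (a : Pt d) (α : Fin d →₀ ℕ) :
    MvPowerSeries.coeff n (derivTensor G a α) = 0 := by
  rw [coeff_derivTensor]
  simp_rw [hG.linear n hn]
  exact mixedPartial_zero _ _

/-- A nonzero white factor has order one. A nonzero black factor has no incoming half-edges and, as
the linear part of `S` is omitted, not just one outgoing half-edge. -/
theorem IsLinearFamily.admissible (hG : IsLinearFamily deg V G) (S : MvPowerSeries (Fin d) ℝ)
    (a : Pt d) : Admissible deg (vertexFactor (blackTensor S) (derivTensor G a)) := by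
  intro s p hs hne
  have hdeg := degree_eq_left_add_right s
  have hs' : s.degree ≠ 0 := fun h => hs ((Finsupp.degree_eq_zero_iff s).1 h)
  rw [vertexFactor, map_add] at hne
  by_cases hp : deg p = 1
  · omega
  have hz : MvPowerSeries.coeff p (if leftPart s = 0 then derivTensor G a (rightPart s) else 0)
      = 0 := by
    split_ifs
    · exact hG.coeff_derivTensor_eq_zero hp a _
    · exact map_zero _
  rw [hz, add_zero] at hne
  split_ifs at hne with h
  · rw [h, map_zero, add_zero] at hdeg
    have : (leftPart s).degree ≠ 1 := by
      intro h1
      rw [blackTensor, if_pos h1, map_zero, map_zero] at hne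
      exact hne rfl
    omega
  · exact absurd (map_zero _) hne

/-- Labels of the first kind only. -/
def ofLeft (α : Fin d →₀ ℕ) : Fin d ⊕ Fin d →₀ ℕ := Finsupp.sumFinsuppAddEquivProdFinsupp.symm (α, 0)

/-- Labels of the second kind only. -/
def ofRight (α : Fin d →₀ ℕ) : Fin d ⊕ Fin d →₀ ℕ :=
  Finsupp.sumFinsuppAddEquivProdFinsupp.symm (0, α)

@[simp] theorem leftPart_ofLeft (α : Fin d →₀ ℕ) : leftPart (ofLeft α) = α := by
  simp [leftPart, ofLeft]
@[simp] theorem rightPart_ofLeft (α : Fin d →₀ ℕ) : rightPart (ofLeft α) = 0 := by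
  simp [rightPart, ofLeft]
@[simp] theorem leftPart_ofRight (α : Fin d →₀ ℕ) : leftPart (ofRight α) = 0 := by
  simp [leftPart, ofRight]
@[simp] theorem rightPart_ofRight (α : Fin d →₀ ℕ) : rightPart (ofRight α) = α := by
  simp [rightPart, ofRight]

theorem ofLeft_leftPart {s : Fin d ⊕ Fin d →₀ ℕ} (h : rightPart s = 0) :
    ofLeft (leftPart s) = s := by
  rw [ofLeft, AddEquiv.symm_apply_eq]
  exact Prod.ext rfl h.symm

theorem ofRight_rightPart {s : Fin d ⊕ Fin d →₀ ℕ} (h : leftPart s = 0) :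
    ofRight (rightPart s) = s := by
  rw [ofRight, AddEquiv.symm_apply_eq]
  exact Prod.ext h.symm rfl

theorem ofLeft_inl (α : Fin d →₀ ℕ) (i : Fin d) : ofLeft α (Sum.inl i) = α i := rfl
theorem ofLeft_inr (α : Fin d →₀ ℕ) (i : Fin d) : ofLeft α (Sum.inr i) = 0 := rfl
theorem ofRight_inl (α : Fin d →₀ ℕ) (i : Fin d) : ofRight α (Sum.inl i) = 0 := rfl
theorem ofRight_inr (α : Fin d →₀ ℕ) (i : Fin d) : ofRight α (Sum.inr i) = α i := rfl

theorem leftPart_add_single_inl (s : Fin d ⊕ Fin d →₀ ℕ) (i : Fin d) :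
    leftPart (s + Finsupp.single (Sum.inl i) 1) = leftPart s + Finsupp.single i 1 := by
  ext j
  simp [leftPart, Finsupp.single_apply]

theorem rightPart_add_single_inl (s : Fin d ⊕ Fin d →₀ ℕ) (i : Fin d) :
    rightPart (s + Finsupp.single (Sum.inl i) 1) = rightPart s := by
  ext j
  simp [rightPart]

theorem leftPart_add_single_inr (s : Fin d ⊕ Fin d →₀ ℕ) (i : Fin d) :
    leftPart (s + Finsupp.single (Sum.inr i) 1) = leftPart s := by
  ext j
  simp [leftPart]

theorem rightPart_add_single_inr (s : Fin d ⊕ Fin d →₀ ℕ) (i : Fin d) :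
    rightPart (s + Finsupp.single (Sum.inr i) 1) = rightPart s + Finsupp.single i 1 := by
  ext j
  simp [rightPart, Finsupp.single_apply]

theorem dividedMonomial_ofLeft (z : Fin d ⊕ Fin d → MvPowerSeries σ ℝ) (α : Fin d →₀ ℕ) :
    dividedMonomial z (ofLeft α) = dividedMonomial (fun i => z (Sum.inl i)) α := by
  simp [dividedMonomial, Fintype.prod_sum_type, ofLeft_inl, ofLeft_inr]

theorem dividedMonomial_ofRight (z : Fin d ⊕ Fin d → MvPowerSeries σ ℝ) (α : Fin d →₀ ℕ) :
    dividedMonomial z (ofRight α) = dividedMonomial (fun i => z (Sum.inr i)) α := by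
  simp [dividedMonomial, Fintype.prod_sum_type, ofRight_inl, ofRight_inr]

theorem hasFormalSum_left {z : Fin d ⊕ Fin d → MvPowerSeries σ ℝ}
    {f : (Fin d →₀ ℕ) → MvPowerSeries σ ℝ} {u : MvPowerSeries σ ℝ} :
    HasFormalSum (fun s => (if rightPart s = 0 then f (leftPart s) else 0) * dividedMonomial z s) u ↔
      HasFormalSum (fun α => f α * dividedMonomial (fun i => z (Sum.inl i)) α) u := by
  rw [← hasFormalSum_comp_injective (e := ofLeft)
    (fun a b h => by simpa using congrArg leftPart h)]
  · simp [dividedMonomial_ofLeft]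
  · intro s hs
    rw [if_neg, zero_mul]
    exact fun h => hs ⟨_, ofLeft_leftPart h⟩

theorem hasFormalSum_right {z : Fin d ⊕ Fin d → MvPowerSeries σ ℝ}
    {f : (Fin d →₀ ℕ) → MvPowerSeries σ ℝ} {u : MvPowerSeries σ ℝ} :
    HasFormalSum (fun s => (if leftPart s = 0 then f (rightPart s) else 0) * dividedMonomial z s) u ↔
      HasFormalSum (fun α => f α * dividedMonomial (fun i => z (Sum.inr i)) α) u := by
  rw [← hasFormalSum_comp_injective (e := ofRight)
    (fun a b h => by simpa using congrArg rightPart h)]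
  · simp [dividedMonomial_ofRight]
  · intro s hs
    rw [if_neg, zero_mul]
    exact fun h => hs ⟨_, ofRight_rightPart h⟩

end Evaluation

/-! ### The branch series solve the system. -/

section Solution
variable {σ : Type} [DecidableEq σ] {d : ℕ} {deg : (σ →₀ ℕ) →+ ℕ} {V : Set (Pt d)}
  {G : Pt d → MvPowerSeries σ ℝ}

theorem hasFormalSum_single {T : Type} [DecidableEq T] (t : T) (u : MvPowerSeries σ ℝ) :
    HasFormalSum (fun x => if x = t then u else 0) u := by
  convert hasFormalSum_of_support_subset {t} (f := fun x => if x = t then u else 0) ?_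
  · simp
  · intro x hx
    exact if_neg (by simpa using hx)

theorem exists_eq_single_of_degree_eq_one {ι : Type} {α : ι →₀ ℕ} (h : α.degree = 1) :
    ∃ i, α = Finsupp.single i 1 := by
  obtain ⟨i, hi⟩ : ∃ i, α i ≠ 0 := by
    by_contra hc
    push Not at hc
    rw [(Finsupp.ext hc : α = 0), map_zero] at h
    exact zero_ne_one h
  obtain ⟨β, rfl⟩ : ∃ β, α = β + Finsupp.single i 1 :=
    ⟨α - Finsupp.single i 1, (tsub_add_cancel_of_le (by simpa using Nat.one_le_iff_ne_zero.2 hi)).symm⟩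
  rw [map_add, Finsupp.degree_single, add_eq_right, Finsupp.degree_eq_zero_iff] at h
  exact ⟨i, by rw [h, zero_add]⟩

theorem dividedMonomial_zero {ι : Type} [Fintype ι] (q : ι → MvPowerSeries σ ℝ) :
    dividedMonomial q 0 = 1 := by
  simp [dividedMonomial]

theorem dividedMonomial_single {ι : Type} [Fintype ι] [DecidableEq ι] (q : ι → MvPowerSeries σ ℝ)
    (i : ι) : dividedMonomial q (Finsupp.single i 1) = q i := by
  rw [dividedMonomial, prod_eq_one, map_one, one_mul, prod_eq_single i]
  · simp
  · intro j _ hj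
    rw [Finsupp.single_eq_of_ne hj, pow_zero]
  · simp
  · intro j _
    by_cases h : j = i
    · subst h
      simp
    · simp [Finsupp.single_eq_of_ne h]

theorem constantCoeff_dividedMonomial {ι : Type} [Fintype ι] {q : ι → MvPowerSeries σ ℝ}
    (hq : ∀ i, MvPowerSeries.constantCoeff (q i) = 0) {α : ι →₀ ℕ} (hα : α ≠ 0) :
    MvPowerSeries.constantCoeff (dividedMonomial q α) = 0 := by
  obtain ⟨i, hi⟩ : ∃ i, α i ≠ 0 := by
    by_contra h
    push Not at h
    exact hα (Finsupp.ext h)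
  have h0 : ∏ j, MvPowerSeries.constantCoeff (q j ^ α j) = 0 :=
    prod_eq_zero (mem_univ i) (by rw [map_pow, hq, zero_pow hi])
  rw [dividedMonomial, map_mul, map_prod MvPowerSeries.constantCoeff, h0, mul_zero]

theorem HasFormalSum.constantCoeff_eq_zero {T : Type} {f : T → MvPowerSeries σ ℝ}
    {s : MvPowerSeries σ ℝ} (h : HasFormalSum f s)
    (hf : ∀ t, MvPowerSeries.constantCoeff (f t) = 0) : MvPowerSeries.constantCoeff s = 0 := by
  rw [← MvPowerSeries.coeff_zero_eq_constantCoeff_apply, ← (h 0).2]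
  simp [hf]

theorem C_coeff_mul_prod (c : ℝ) {ι : Type} [Fintype ι] (q : ι → MvPowerSeries σ ℝ)
    (α : ι →₀ ℕ) : MvPowerSeries.C c * ∏ i, q i ^ α i =
      MvPowerSeries.C ((∏ i, ((α i).factorial : ℝ)) * c) * dividedMonomial q α := by
  rw [dividedMonomial, ← mul_assoc, ← map_mul, mul_right_comm, prod_factorial_mul_inv, one_mul]

theorem prod_factorial_add_single {ι : Type} [Fintype ι] [DecidableEq ι] (α : ι →₀ ℕ) (i : ι) :
    ∏ j, (((α + Finsupp.single i 1 : ι →₀ ℕ) j).factorial : ℝ) =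
      (α i + 1) * ∏ j, ((α j).factorial : ℝ) := by
  rw [← mul_prod_erase univ _ (mem_univ i),
    ← mul_prod_erase univ (fun j => ((α j).factorial : ℝ)) (mem_univ i), ← mul_assoc]
  congr 1
  · rw [Finsupp.add_apply, Finsupp.single_eq_same, Nat.factorial_succ]
    push_cast
    rfl
  · refine prod_congr rfl fun x hx => ?_
    rw [Finsupp.add_apply, Finsupp.single_eq_of_ne (ne_of_mem_erase hx), add_zero]

/-- The sum of all trees with one free half-edge at a white vertex: the solution `q`. -/
def solutionQ (S : MvPowerSeries (Fin d) ℝ) (G : Pt d → MvPowerSeries σ ℝ) (i : Fin d) :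
    MvPowerSeries σ ℝ :=
  branchSeries (vertexFactor (blackTensor S) (derivTensor G (linearPart S))) (Sum.inl i)

/-- The sum of all trees with one free half-edge at a black vertex: the solution `y - φ`. -/
def solutionH (S : MvPowerSeries (Fin d) ℝ) (G : Pt d → MvPowerSeries σ ℝ) (i : Fin d) :
    MvPowerSeries σ ℝ :=
  branchSeries (vertexFactor (blackTensor S) (derivTensor G (linearPart S))) (Sum.inr i)

/-- The solution `y`. -/
def solutionY (S : MvPowerSeries (Fin d) ℝ) (G : Pt d → MvPowerSeries σ ℝ) (i : Fin d) :
    MvPowerSeries σ ℝ :=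
  MvPowerSeries.C (linearPart S i) + solutionH S G i

/-- The free half-edge at the root is incoming, so the root is white with one extra derivative. The
sum over its other branches is the Taylor series of `∂_i G` at `φ`. -/
theorem IsLinearFamily.hasFormalSum_solutionQ (hG : IsLinearFamily deg V G)
    (S : MvPowerSeries (Fin d) ℝ) (i : Fin d) :
    HasFormalSum (fun α => derivTensor G (linearPart S) (α + Finsupp.single i 1) *
      dividedMonomial (solutionH S G) α) (solutionQ S G i) := by
  have h := (hG.admissible S (linearPart S)).hasFormalSum_markedSeries
    (shift (Sum.inr i) (vertexFactor (blackTensor S) (derivTensor G (linearPart S))))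
  refine (hasFormalSum_right (z := branchSeries _) (f := fun α => derivTensor G (linearPart S)
    (α + Finsupp.single i 1))).1 ?_
  convert h using 1
  swap
  · rfl
  ext1 s
  change _ = _ * dividedMonomial _ s
  congr 1
  have hne : rightPart s + Finsupp.single i 1 ≠ 0 := by
    intro h
    have := congrArg (fun f => f i) h
    simp at this
  rw [shift, vertexFactor, leftPart_add_single_inr, rightPart_add_single_inr, if_neg hne, zero_add]

/-- Here the free half-edge is outgoing, so the root is black; the right-hand side is `∂S/∂q_i` at
`solutionQ` without its constant term `φ^i`. -/
theorem IsLinearFamily.hasFormalSum_solutionH (hG : IsLinearFamily deg V G)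
    (S : MvPowerSeries (Fin d) ℝ) (i : Fin d) :
    HasFormalSum (fun α => MvPowerSeries.C (blackTensor S (α + Finsupp.single i 1)) *
      dividedMonomial (solutionQ S G) α) (solutionH S G i) := by
  have h := (hG.admissible S (linearPart S)).hasFormalSum_markedSeries
    (shift (Sum.inl i) (vertexFactor (blackTensor S) (derivTensor G (linearPart S))))
  refine (hasFormalSum_left (z := branchSeries _) (f := fun α => MvPowerSeries.C (blackTensor S
    (α + Finsupp.single i 1)))).1 ?_
  convert h using 1
  swap
  · rfl
  ext1 s
  change _ = _ * dividedMonomial _ s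
  congr 1
  have hne : leftPart s + Finsupp.single i 1 ≠ 0 := by
    intro h
    have := congrArg (fun f => f i) h
    simp at this
  rw [shift, vertexFactor, leftPart_add_single_inl, rightPart_add_single_inl, if_neg hne, add_zero]

theorem IsLinearFamily.constantCoeff_solutionQ (hG : IsLinearFamily deg V G)
    (S : MvPowerSeries (Fin d) ℝ) (i : Fin d) :
    MvPowerSeries.constantCoeff (solutionQ S G i) = 0 := by
  refine (hG.hasFormalSum_solutionQ S i).constantCoeff_eq_zero fun α => ?_
  rw [map_mul, ← MvPowerSeries.coeff_zero_eq_constantCoeff_apply,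
    hG.coeff_derivTensor_eq_zero (by simp), zero_mul]

theorem IsLinearFamily.constantCoeff_solutionH (hG : IsLinearFamily deg V G)
    (S : MvPowerSeries (Fin d) ℝ) (i : Fin d) :
    MvPowerSeries.constantCoeff (solutionH S G i) = 0 := by
  refine (hG.hasFormalSum_solutionH S i).constantCoeff_eq_zero fun α => ?_
  by_cases hα : α = 0
  · rw [hα, blackTensor, if_pos (by simp), map_zero, zero_mul, map_zero]
  · rw [map_mul, constantCoeff_dividedMonomial (hG.constantCoeff_solutionQ S) hα, mul_zero]

theorem derivTensor_familyPartial (hV : IsOpen V) (hG : IsLinearFamily deg V G) {a : Pt d}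
    (ha : a ∈ V) (i : Fin d) (α : Fin d →₀ ℕ) :
    derivTensor (familyPartial i G) a α = derivTensor G a (α + Finsupp.single i 1) := by
  ext n
  rw [coeff_derivTensor, coeff_derivTensor, map_add, Finsupp.toMultiset_single, one_smul,
    Multiset.add_comm, Multiset.singleton_add, mixedPartial_cons hV (hG.smooth n) ha]
  rfl

/-- Both equations say that a branch is a root with further branches attached. The constant `φ^i` in
`solutionY` restores the linear coefficients missing from `blackTensor`. -/
theorem solvesSystem_solution (hV : IsOpen V) (hG : IsLinearFamily deg V G)
    {S : MvPowerSeries (Fin d) ℝ} (hS : linearPart S ∈ V) :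
    SolvesSystem S G (solutionQ S G) (solutionY S G) := by
  constructor
  · intro i
    have h1 := hasFormalSum_evalFamily (familyPartial i G) (linearPart S)
      (hG.constantCoeff_solutionH S) (y := solutionY S G) fun _ => rfl
    simp_rw [derivTensor_familyPartial hV hG hS] at h1
    exact (hG.hasFormalSum_solutionQ S i).unique h1
  · intro i
    refine HasFormalSum.unique ?_ (hasFormalSum_subst (hG.constantCoeff_solutionQ S) _)
    convert (hasFormalSum_single 0 (MvPowerSeries.C (linearPart S i))).add
      (hG.hasFormalSum_solutionH S i) using 1
    swap
    · rfl
    ext1 α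
    rw [C_coeff_mul_prod, MvPowerSeries.coeff_pderiv, blackTensor]
    by_cases hα : α = 0
    · subst hα
      simp [dividedMonomial_zero, linearPart]
    · have : (α + Finsupp.single i 1).degree ≠ 1 := by
        rw [map_add, Finsupp.degree_single]
        have := (Finsupp.degree_eq_zero_iff α).not.2 hα
        omega
      rw [if_neg hα, if_neg this, zero_add, prod_factorial_add_single]
      congr 2
      ring

/-- Marking a vertex gives `S(q) - φ^i q_i + G(y)`: black roots produce the first two terms, white
roots the third. Together with `-h^i q_i` the correction becomes `-y^i q_i`. -/
theorem resultOf_solution (hG : IsLinearFamily deg V G) (S : MvPowerSeries (Fin d) ℝ) :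
    resultOf S G (solutionQ S G) (solutionY S G) =
      markedSeries (vertexFactor (blackTensor S) (derivTensor G (linearPart S)))
        (vertexFactor (blackTensor S) (derivTensor G (linearPart S))) -
      ∑ i, solutionH S G i * solutionQ S G i := by
  set φ := linearPart S with hφ
  set F := vertexFactor (blackTensor S) (derivTensor G φ) with hF
  have h1 := (hG.admissible S φ).hasFormalSum_markedSeries F
  have h2 := hasFormalSum_evalFamily G φ (hG.constantCoeff_solutionH S)
    (y := solutionY S G) fun _ => rfl
  have h3 := hasFormalSum_subst (hG.constantCoeff_solutionQ S) S
  have h4 : HasFormalSum (fun α => MvPowerSeries.C (blackTensor S α) *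
      dividedMonomial (solutionQ S G) α) (MvPowerSeries.subst (solutionQ S G) S -
        ∑ i, MvPowerSeries.C (φ i) * solutionQ S G i) := by
    convert h3.sub (HasFormalSum.sum univ fun i _ =>
      hasFormalSum_single (Finsupp.single i 1) (MvPowerSeries.C (φ i) * solutionQ S G i)) using 1
    ext1 α
    rw [C_coeff_mul_prod, blackTensor]
    split_ifs with h
    · obtain ⟨i, rfl⟩ := exists_eq_single_of_degree_eq_one h
      rw [sum_eq_single i]
      · have : ∏ j, (((Finsupp.single i 1 : Fin d →₀ ℕ) j).factorial : ℝ) = 1 := by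
          simpa using prod_factorial_add_single (0 : Fin d →₀ ℕ) i
        rw [this, dividedMonomial_single, if_pos rfl]
        simp [hφ, linearPart]
      · intro j _ hj
        rw [if_neg]
        intro h
        exact hj ((Finsupp.single_left_inj one_ne_zero).1 h).symm
      · simp
    · rw [sum_eq_zero, sub_zero]
      intro i _
      rw [if_neg]
      rintro rfl
      simp at h
  have h5 : HasFormalSum (fun s => F s * dividedMonomial (branchSeries F) s)
      ((MvPowerSeries.subst (solutionQ S G) S - ∑ i, MvPowerSeries.C (φ i) * solutionQ S G i) +
        evalFamily G (solutionY S G)) := by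
    convert ((hasFormalSum_left (z := branchSeries F) (f := fun α =>
      MvPowerSeries.C (blackTensor S α))).2 h4).add
      ((hasFormalSum_right (z := branchSeries F) (f := derivTensor G φ)).2 h2) using 1
    ext1 s
    rw [← add_mul]
    rfl
  rw [h1.unique h5, resultOf]
  simp only [solutionY, add_mul, sum_add_distrib]
  ring

/-- The generating series of trees is the value of the action at the solution. -/
theorem hasFormalSum_treeCoeff_resultOf (hG : IsLinearFamily deg V G)
    (S : MvPowerSeries (Fin d) ℝ) :
    HasFormalSum (treeCoeff (vertexFactor (blackTensor S) (derivTensor G (linearPart S))))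
      (resultOf S G (solutionQ S G) (solutionY S G)) := by
  rw [resultOf_solution hG]
  exact (hG.admissible S (linearPart S)).hasFormalSum_treeCoeff

end Solution

/-! ### Uniqueness of the solution, order by order. -/

section Uniqueness
variable {σ : Type} {d : ℕ}

/-- The ideal of power series whose coefficients of total degree less than `N` vanish. -/
def orderIdeal (σ : Type) (N : ℕ) : Ideal (MvPowerSeries σ ℝ) where
  carrier := {f | ∀ m, m.degree < N → MvPowerSeries.coeff m f = 0}
  add_mem' hf hg m hm := by rw [map_add, hf m hm, hg m hm, add_zero]
  zero_mem' m _ := map_zero _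
  smul_mem' c f hf m hm := by
    classical
    rw [smul_eq_mul, MvPowerSeries.coeff_mul]
    refine sum_eq_zero fun p hp => ?_
    rw [HasAntidiagonal.mem_antidiagonal] at hp
    rw [hf p.2, mul_zero]
    rw [← hp, map_add] at hm
    omega

/-- Congruent arguments have congruent monomials modulo the ideal, and a coefficient of a
substitution is a finite combination of coefficients of monomials. -/
theorem subst_sub_mem {q q' : Fin d → MvPowerSeries σ ℝ}
    (hq : ∀ i, MvPowerSeries.constantCoeff (q i) = 0)
    (hq' : ∀ i, MvPowerSeries.constantCoeff (q' i) = 0) {N : ℕ}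
    (h : ∀ i, q i - q' i ∈ orderIdeal σ N) (f : MvPowerSeries (Fin d) ℝ) :
    MvPowerSeries.subst q f - MvPowerSeries.subst q' f ∈ orderIdeal σ N := by
  intro m hm
  have hs := (hasFormalSum_subst hq f).sub (hasFormalSum_subst hq' f)
  rw [← (hs m).2]
  refine finsum_eq_zero_of_forall_eq_zero fun α => ?_
  dsimp only
  rw [← mul_sub, MvPowerSeries.coeff_C_mul]
  have : ∏ i, q i ^ α i - ∏ i, q' i ^ α i ∈ orderIdeal σ N := by
    rw [← Ideal.Quotient.eq, map_prod, map_prod]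
    refine prod_congr rfl fun i _ => ?_
    rw [map_pow, map_pow, Ideal.Quotient.eq.2 (h i)]
  rw [this m hm, mul_zero]

theorem subst_zero_series {q : Fin d → MvPowerSeries σ ℝ}
    (hq : ∀ i, MvPowerSeries.constantCoeff (q i) = 0) :
    MvPowerSeries.subst q (0 : MvPowerSeries (Fin d) ℝ) = 0 := by
  have := hasFormalSum_subst hq (0 : MvPowerSeries (Fin d) ℝ)
  simp only [map_zero, zero_mul] at this
  exact this.unique hasFormalSum_zero

variable [DecidableEq σ] {deg : (σ →₀ ℕ) →+ ℕ} {V : Set (Pt d)} {G : Pt d → MvPowerSeries σ ℝ}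
  {S : MvPowerSeries (Fin d) ℝ} {q y q' y' : Fin d → MvPowerSeries σ ℝ}

theorem evalSmooth_zero (y : Fin d → MvPowerSeries σ ℝ) :
    evalSmooth (fun _ : Pt d => (0 : ℝ)) y = 0 := by
  have h0 : ∀ a : Pt d, taylorAt (fun _ : Pt d => (0 : ℝ)) a = 0 := by
    intro a
    ext α
    change mixedPartial _ _ a / _ = _
    rw [mixedPartial_zero, zero_div]
    rfl
  rw [evalSmooth, h0, subst_zero_series]
  simp

theorem IsLinearFamily.coeff_zero_familyPartial (hG : IsLinearFamily deg V G) (i : Fin d) :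
    (fun z => MvPowerSeries.coeff 0 (familyPartial i G z)) = fun _ => (0 : ℝ) := by
  ext z
  change fderiv ℝ (fun z' => MvPowerSeries.coeff 0 (G z')) z _ = 0
  simp [hG.linear 0 (by simp)]

theorem coeff_evalFamily (G : Pt d → MvPowerSeries σ ℝ) (y : Fin d → MvPowerSeries σ ℝ)
    (m : σ →₀ ℕ) : MvPowerSeries.coeff m (evalFamily G y) =
      ∑ p ∈ HasAntidiagonal.antidiagonal m,
        MvPowerSeries.coeff p.2 (evalSmooth (fun z => MvPowerSeries.coeff p.1 (G z)) y) := rfl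

theorem SolvesSystem.constantCoeff_q (hG : IsLinearFamily deg V G) (h : SolvesSystem S G q y)
    (i : Fin d) : MvPowerSeries.constantCoeff (q i) = 0 := by
  rw [h.q_eq, ← MvPowerSeries.coeff_zero_eq_constantCoeff_apply, coeff_evalFamily]
  refine sum_eq_zero fun p hp => ?_
  rw [HasAntidiagonal.mem_antidiagonal, add_eq_zero] at hp
  rw [hp.1, hG.coeff_zero_familyPartial, evalSmooth_zero, map_zero]

theorem SolvesSystem.constantCoeff_y (hG : IsLinearFamily deg V G) (h : SolvesSystem S G q y)
    (i : Fin d) : MvPowerSeries.constantCoeff (y i) = linearPart S i := by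
  have h1 := hasFormalSum_subst (h.constantCoeff_q hG) (MvPowerSeries.pderiv ℝ i S)
  rw [← h.y_eq] at h1
  rw [← MvPowerSeries.coeff_zero_eq_constantCoeff_apply, ← (h1 0).2, finsum_eq_single _ 0]
  · simp [MvPowerSeries.coeff_pderiv, linearPart]
  · intro α hα
    dsimp only
    rw [C_coeff_mul_prod, MvPowerSeries.coeff_zero_eq_constantCoeff_apply, map_mul,
      constantCoeff_dividedMonomial (h.constantCoeff_q hG) hα, mul_zero]

/-- Agreement of `q` below order `N` gives agreement of `y` below order `N`. Since `G` has no term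
of order zero, this gives agreement of `q` below order `N + 1`. -/
theorem SolvesSystem.sub_mem (hG : IsLinearFamily deg V G) (h : SolvesSystem S G q y)
    (h' : SolvesSystem S G q' y') (N : ℕ) :
    (∀ i, q i - q' i ∈ orderIdeal σ N) ∧ ∀ i, y i - y' i ∈ orderIdeal σ N := by
  have hy : ∀ N, (∀ i, q i - q' i ∈ orderIdeal σ N) → ∀ i, y i - y' i ∈ orderIdeal σ N := by
    intro N hN i
    rw [h.y_eq, h'.y_eq]
    exact subst_sub_mem (h.constantCoeff_q hG) (h'.constantCoeff_q hG) hN _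
  suffices hq : ∀ i, q i - q' i ∈ orderIdeal σ N from ⟨hq, hy N hq⟩
  induction N with
  | zero => exact fun i m hm => absurd hm (Nat.not_lt_zero _)
  | succ N ih =>
    intro i m hm
    rw [map_sub, h.q_eq, h'.q_eq, coeff_evalFamily, coeff_evalFamily, ← sum_sub_distrib]
    refine sum_eq_zero fun p hp => ?_
    rw [HasAntidiagonal.mem_antidiagonal] at hp
    by_cases hp1 : p.1 = 0
    · rw [hp1, hG.coeff_zero_familyPartial, evalSmooth_zero, evalSmooth_zero, map_zero, sub_zero]
    · have hd : p.2.degree < N := by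
        have := (Finsupp.degree_eq_zero_iff p.1).not.2 hp1
        rw [← hp, map_add] at hm
        omega
      have e1 : (fun i => MvPowerSeries.constantCoeff (y i)) = linearPart S :=
        funext (h.constantCoeff_y hG)
      have e2 : (fun i => MvPowerSeries.constantCoeff (y' i)) = linearPart S :=
        funext (h'.constantCoeff_y hG)
      rw [← map_sub, evalSmooth, evalSmooth, e1, e2]
      refine subst_sub_mem (by simp) (by simp) ?_ _ p.2 hd
      intro j
      rw [h.constantCoeff_y hG, h'.constantCoeff_y hG, sub_sub_sub_cancel_right]
      exact hy N ih j

theorem SolvesSystem.unique (hG : IsLinearFamily deg V G) (h : SolvesSystem S G q y)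
    (h' : SolvesSystem S G q' y') : q = q' ∧ y = y' := by
  constructor
  · ext i m
    exact sub_eq_zero.1 (((h.sub_mem hG h' (m.degree + 1)).1 i) m (Nat.lt_succ_self _))
  · ext i m
    exact sub_eq_zero.1 (((h.sub_mem hG h' (m.degree + 1)).2 i) m (Nat.lt_succ_self _))

end Uniqueness

/-! ### Bipartite trees as directed labelled trees. -/

section LabelledEdges
variable {b w : ℕ} {J : Type} [DecidableEq J]

/-- The edges of a bipartite graph, directed from black to white vertices and labelled by `l`. -/
def labelledEdges (E : Finset (Fin b × Fin w)) (l : E → J) :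
    Finset ((Fin b ⊕ Fin w) × (Fin b ⊕ Fin w) × J) :=
  (univ : Finset E).map ⟨fun e => (Sum.inl e.1.1, Sum.inr e.1.2, l e), fun e e' h => by
    simp only [Prod.mk.injEq, Sum.inl.injEq, Sum.inr.injEq] at h
    exact Subtype.ext (Prod.ext h.1 h.2.1)⟩

theorem mem_labelledEdges {E : Finset (Fin b × Fin w)} {l : E → J}
    {e : (Fin b ⊕ Fin w) × (Fin b ⊕ Fin w) × J} : e ∈ labelledEdges E l ↔
      ∃ e' : E, (Sum.inl e'.1.1, Sum.inr e'.1.2, l e') = e := by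
  rw [labelledEdges, mem_map]
  simp only [mem_univ, true_and]
  rfl

theorem bipartiteGraph_adj {E : Finset (Fin b × Fin w)} {u v : Fin b ⊕ Fin w} :
    (bipartiteGraph E).Adj u v ↔ (∃ x y, u = Sum.inl x ∧ v = Sum.inr y ∧ (x, y) ∈ E) ∨
      ∃ x y, v = Sum.inl x ∧ u = Sum.inr y ∧ (x, y) ∈ E := by
  rw [bipartiteGraph, SimpleGraph.fromRel_adj, and_iff_right_iff_imp]
  rintro (⟨x, y, rfl, rfl, -⟩ | ⟨x, y, rfl, rfl, -⟩) <;> simp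

theorem card_edgeSet_bipartiteGraph (E : Finset (Fin b × Fin w)) :
    Nat.card (bipartiteGraph E).edgeSet = E.card := by
  have h : (bipartiteGraph E).edgeSet =
      (fun e : Fin b × Fin w => (s(Sum.inl e.1, Sum.inr e.2) : Sym2 (Fin b ⊕ Fin w))) '' E := by
    ext z
    induction z using Sym2.ind with
    | _ u v =>
      rw [SimpleGraph.mem_edgeSet, bipartiteGraph_adj]
      constructor
      · rintro (⟨x, y, rfl, rfl, h⟩ | ⟨x, y, rfl, rfl, h⟩)
        · exact ⟨(x, y), h, rfl⟩
        · exact ⟨(x, y), h, Sym2.eq_swap⟩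
      · rintro ⟨⟨x, y⟩, h, heq⟩
        rcases Sym2.eq_iff.1 heq with ⟨rfl, rfl⟩ | ⟨rfl, rfl⟩
        · exact Or.inl ⟨x, y, rfl, rfl, h⟩
        · exact Or.inr ⟨x, y, rfl, rfl, h⟩
  rw [h, Nat.card_image_of_injective]
  · simp
  · rintro ⟨x, y⟩ ⟨x', y'⟩ h
    rcases Sym2.eq_iff.1 h with ⟨h1, h2⟩ | ⟨h1, h2⟩
    · exact Prod.ext (Sum.inl_injective h1) (Sum.inr_injective h2)
    · exact absurd h1 Sum.inl_ne_inr

/-- Closed vertex sets are unions of reachability classes, and both notions of tree prescribe the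
same number of edges. -/
theorem spansTree_labelledEdges {E : Finset (Fin b × Fin w)} {l : E → J} :
    SpansTree univ (labelledEdges E l) ↔ (bipartiteGraph E).IsTree := by
  classical
  rw [SimpleGraph.isTree_iff_connected_and_card, card_edgeSet_bipartiteGraph]
  have hcard : (labelledEdges E l).card = E.card := by simp [labelledEdges]
  have hadj : ∀ Q : Finset (Fin b ⊕ Fin w), EdgeClosed (labelledEdges E l) Q ↔
      ∀ u v, (bipartiteGraph E).Adj u v → (u ∈ Q ↔ v ∈ Q) := by
    intro Q
    constructor
    · intro h u v huv
      rcases bipartiteGraph_adj.1 huv with ⟨x, y, rfl, rfl, he⟩ | ⟨x, y, rfl, rfl, he⟩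
      · exact h _ (mem_labelledEdges.2 ⟨⟨_, he⟩, rfl⟩)
      · exact (h _ (mem_labelledEdges.2 ⟨⟨_, he⟩, rfl⟩)).symm
    · intro h e he
      obtain ⟨e', rfl⟩ := mem_labelledEdges.1 he
      exact h _ _ (bipartiteGraph_adj.2 (Or.inl ⟨_, _, rfl, rfl, e'.2⟩))
  constructor
  · intro h
    obtain ⟨z, -⟩ := h.nonempty
    have : Nonempty (Fin b ⊕ Fin w) := ⟨z⟩
    refine ⟨⟨?_⟩, by rw [← hcard, h.card_eq]; simp⟩
    · intro u v
      have := h.conn (univ.filter fun x => (bipartiteGraph E).Reachable u x) (subset_univ _)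
        ⟨u, by simp⟩ ((hadj _).2 fun x y hxy => by
          simp only [mem_filter, mem_univ, true_and]
          exact ⟨fun h => h.trans hxy.reachable, fun h => h.trans hxy.symm.reachable⟩)
      have hv := mem_univ v
      rw [← this] at hv
      exact (mem_filter.1 hv).2
  · rintro ⟨hc, he⟩
    refine ⟨⟨by simp, ?_, ?_⟩, by rw [hcard, he]; simp⟩
    · obtain ⟨x⟩ := hc.nonempty
      exact ⟨x, mem_univ x⟩
    · intro Q _ ⟨x, hx⟩ hQ
      rw [eq_univ_iff_forall]
      intro y
      obtain ⟨p⟩ := hc.preconnected x y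
      induction p with
      | nil => exact hx
      | cons hxy _ ih => exact ih (((hadj Q).1 hQ _ _ hxy).1 hx)

/-- After cutting the first edge no other edge runs between the two parts, so a parallel edge with
another label cannot exist. -/
theorem SpansTree.label_unique {V : Type} [DecidableEq V] {P : Finset V}
    {E : Finset (V × V × J)} (h : SpansTree P E) {u v : V} {i j : J} (hi : (u, v, i) ∈ E)
    (hj : (u, v, j) ∈ E) : i = j := by
  obtain ⟨C, hC, E₁, E₂, h1, h2, hu, hv, rfl⟩ := h.exists_cut hi
  rcases mem_insert.1 hj with hj | hj
  · simpa using hj.symm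
  · exact absurd hj (notMem_union_of_cross (e := (u, v, j)) h1.inside h2.inside hu hv)

/-- The edges at a black vertex. -/
def blackEdges (E : Finset (Fin b × Fin w)) (x : Fin b) : Finset E := univ.filter fun e => e.1.1 = x

/-- The edges at a white vertex. -/
def whiteEdges (E : Finset (Fin b × Fin w)) (y : Fin w) : Finset E := univ.filter fun e => e.1.2 = y

theorem toFinsupp_map {T : Type} (I : Finset T) (l : T → J) :
    Multiset.toFinsupp (I.val.map l) = ∑ e ∈ I, Finsupp.single (l e) 1 := by
  classical
  induction I using Finset.induction_on with
  | empty => simp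
  | insert a I ha ih =>
    rw [sum_insert ha, insert_val_of_notMem ha, Multiset.map_cons, ← Multiset.singleton_add, map_add,
      ih, Multiset.toFinsupp_singleton]

theorem endLabels_labelledEdges (E : Finset (Fin b × Fin w)) (l : E → J) (v : Fin b ⊕ Fin w) :
    endLabels (labelledEdges E l) v = ∑ e : E, ((if Sum.inl e.1.1 = v then
      Finsupp.single (Sum.inl (l e)) 1 else 0) + if Sum.inr e.1.2 = v then
        Finsupp.single (Sum.inr (l e)) 1 else 0) := by
  rw [endLabels, labelledEdges, sum_map]
  rfl

theorem leftPart_sum {T : Type} [Fintype J] (I : Finset T) (f : T → J ⊕ J →₀ ℕ) :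
    leftPart (∑ e ∈ I, f e) = ∑ e ∈ I, leftPart (f e) := by
  rw [leftPart, map_sum, Prod.fst_sum]
  rfl

theorem rightPart_sum {T : Type} [Fintype J] (I : Finset T) (f : T → J ⊕ J →₀ ℕ) :
    rightPart (∑ e ∈ I, f e) = ∑ e ∈ I, rightPart (f e) := by
  rw [rightPart, map_sum, Prod.snd_sum]
  rfl

@[simp] theorem leftPart_zero [Fintype J] : leftPart (0 : J ⊕ J →₀ ℕ) = 0 := by
  rw [leftPart, map_zero, Prod.fst_zero]

@[simp] theorem rightPart_zero [Fintype J] : rightPart (0 : J ⊕ J →₀ ℕ) = 0 := by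
  rw [rightPart, map_zero, Prod.snd_zero]

variable [Fintype J]

theorem leftPart_single_inl (i : J) :
    leftPart (Finsupp.single (Sum.inl i) 1) = Finsupp.single i 1 := by
  ext j
  simp [leftPart, Finsupp.single_apply]

theorem rightPart_single_inl (i : J) : rightPart (Finsupp.single (Sum.inl i) 1 : J ⊕ J →₀ ℕ) = 0 := by
  ext j
  simp [rightPart]

theorem leftPart_single_inr (i : J) : leftPart (Finsupp.single (Sum.inr i) 1 : J ⊕ J →₀ ℕ) = 0 := by
  ext j
  simp [leftPart]

theorem rightPart_single_inr (i : J) :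
    rightPart (Finsupp.single (Sum.inr i) 1) = Finsupp.single i 1 := by
  ext j
  simp [rightPart, Finsupp.single_apply]

theorem leftPart_endLabels_inl (E : Finset (Fin b × Fin w)) (l : E → J) (x : Fin b) :
    leftPart (endLabels (labelledEdges E l) (Sum.inl x)) =
      Multiset.toFinsupp ((blackEdges E x).val.map l) := by
  rw [endLabels_labelledEdges, leftPart_sum, toFinsupp_map, blackEdges, sum_filter]
  refine sum_congr rfl fun e _ => ?_
  simp only [Sum.inl.injEq, reduceCtorEq, if_false, add_zero]
  split_ifs
  · exact leftPart_single_inl _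
  · exact leftPart_zero

theorem rightPart_endLabels_inl (E : Finset (Fin b × Fin w)) (l : E → J) (x : Fin b) :
    rightPart (endLabels (labelledEdges E l) (Sum.inl x)) = 0 := by
  rw [endLabels_labelledEdges, rightPart_sum]
  refine sum_eq_zero fun e _ => ?_
  simp only [Sum.inl.injEq, reduceCtorEq, if_false, add_zero]
  split_ifs
  · exact rightPart_single_inl _
  · exact rightPart_zero

theorem leftPart_endLabels_inr (E : Finset (Fin b × Fin w)) (l : E → J) (y : Fin w) :
    leftPart (endLabels (labelledEdges E l) (Sum.inr y)) = 0 := by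
  rw [endLabels_labelledEdges, leftPart_sum]
  refine sum_eq_zero fun e _ => ?_
  simp only [Sum.inr.injEq, reduceCtorEq, if_false, zero_add]
  split_ifs
  · exact leftPart_single_inr _
  · exact leftPart_zero

theorem rightPart_endLabels_inr (E : Finset (Fin b × Fin w)) (l : E → J) (y : Fin w) :
    rightPart (endLabels (labelledEdges E l) (Sum.inr y)) =
      Multiset.toFinsupp ((whiteEdges E y).val.map l) := by
  rw [endLabels_labelledEdges, rightPart_sum, toFinsupp_map, whiteEdges, sum_filter]
  refine sum_congr rfl fun e _ => ?_
  simp only [Sum.inr.injEq, reduceCtorEq, if_false, zero_add]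
  split_ifs
  · exact rightPart_single_inr _
  · exact rightPart_zero

theorem labelledEdges_inj {E E' : Finset (Fin b × Fin w)} {l : E → J} {l' : E' → J}
    (h : labelledEdges E l = labelledEdges E' l') :
    (⟨E, l⟩ : (E : Finset (Fin b × Fin w)) × (E → J)) = ⟨E', l'⟩ := by
  have key : ∀ {E E' : Finset (Fin b × Fin w)} {l : E → J} {l' : E' → J},
      labelledEdges E l = labelledEdges E' l' → ∀ e : E, ∃ h : e.1 ∈ E', l' ⟨e.1, h⟩ = l e := by
    intro E E' l l' h e
    have he : (Sum.inl e.1.1, Sum.inr e.1.2, l e) ∈ labelledEdges E' l' :=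
      h ▸ mem_labelledEdges.2 ⟨e, rfl⟩
    obtain ⟨e', he'⟩ := mem_labelledEdges.1 he
    simp only [Prod.mk.injEq, Sum.inl.injEq, Sum.inr.injEq] at he'
    have h2 : e'.1 = e.1 := Prod.ext he'.1 he'.2.1
    exact ⟨h2 ▸ e'.2, by rw [← he'.2.2]; exact congrArg l' (Subtype.ext h2.symm)⟩
  have hE : E = E' := Finset.Subset.antisymm (fun e he => (key h ⟨e, he⟩).1)
    fun e he => (key h.symm ⟨e, he⟩).1
  subst hE
  congr 1
  ext e
  exact (key h e).2.symm

/-- The conditions on half-edges force every edge to run from black to white, and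
`SpansTree.label_unique` makes the label a function of the edge. -/
theorem exists_labelledEdges {E' : Finset ((Fin b ⊕ Fin w) × (Fin b ⊕ Fin w) × J)}
    (h : SpansTree univ E') (hb : ∀ x, rightPart (endLabels E' (Sum.inl x)) = 0)
    (hw : ∀ y, leftPart (endLabels E' (Sum.inr y)) = 0) :
    ∃ (E : Finset (Fin b × Fin w)) (l : E → J), labelledEdges E l = E' := by
  classical
  have hform : ∀ e ∈ E', ∃ x y, e.1 = Sum.inl x ∧ e.2.1 = Sum.inr y := by
    rintro ⟨u, v, i⟩ he
    rcases u with x | y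
    · rcases v with x' | y
      · exfalso
        have h0 := DFunLike.congr_fun (hb x') i
        change endLabels E' (Sum.inl x') (Sum.inr i) = 0 at h0
        rw [endLabels_inr, sum_eq_zero_iff] at h0
        simpa using h0 _ he
      · exact ⟨x, y, rfl, rfl⟩
    · exfalso
      have h0 := DFunLike.congr_fun (hw y) i
      change endLabels E' (Sum.inr y) (Sum.inl i) = 0 at h0
      rw [endLabels_inl, sum_eq_zero_iff] at h0
      simpa using h0 _ he
  let E : Finset (Fin b × Fin w) :=
    univ.filter fun p => ∃ i, (Sum.inl p.1, Sum.inr p.2, i) ∈ E'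
  have hE : ∀ e : E, ∃ i, (Sum.inl e.1.1, Sum.inr e.1.2, i) ∈ E' := fun e => (mem_filter.1 e.2).2
  choose l hl using hE
  refine ⟨E, l, ?_⟩
  ext ⟨u, v, i⟩
  rw [mem_labelledEdges]
  constructor
  · rintro ⟨e, he⟩
    rw [← he]
    exact hl e
  · intro he
    obtain ⟨x, y, hx, hy⟩ := hform _ he
    dsimp only at hx hy
    subst hx hy
    refine ⟨⟨(x, y), mem_filter.2 ⟨mem_univ _, i, he⟩⟩, ?_⟩
    rw [h.label_unique (hl ⟨(x, y), mem_filter.2 ⟨mem_univ _, i, he⟩⟩) he]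

end LabelledEdges

/-! ### From trees with two kinds of factors to bipartite trees. -/

section Conversion
variable {σ : Type} {d : ℕ}

/-- The sets of edges of bipartite trees. -/
def treeEdges (b w : ℕ) : Finset (Finset (Fin b × Fin w)) := by
  classical exact univ.filter fun E => (bipartiteGraph E).IsTree

theorem mem_treeEdges {b w : ℕ} {E : Finset (Fin b × Fin w)} :
    E ∈ treeEdges b w ↔ (bipartiteGraph E).IsTree := by
  classical
  simp [treeEdges]

/-- The contraction of factors `β` at the black vertices and `D y` at the white vertices `y`. -/
def edgeTerm (β : (Fin d →₀ ℕ) → ℝ) {b w : ℕ} (D : Fin w → (Fin d →₀ ℕ) → MvPowerSeries σ ℝ)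
    (E : Finset (Fin b × Fin w)) : MvPowerSeries σ ℝ :=
  ∑ l : E → Fin d, MvPowerSeries.C (∏ x, β (Multiset.toFinsupp ((blackEdges E x).val.map l))) *
    ∏ y, D y (Multiset.toFinsupp ((whiteEdges E y).val.map l))

/-- The factors at black vertices. -/
def blackFactor (β : (Fin d →₀ ℕ) → ℝ) (s : Fin d ⊕ Fin d →₀ ℕ) : MvPowerSeries σ ℝ :=
  if rightPart s = 0 then MvPowerSeries.C (β (leftPart s)) else 0

/-- The factors at white vertices. -/
def whiteFactor (g : (Fin d →₀ ℕ) → MvPowerSeries σ ℝ) (s : Fin d ⊕ Fin d →₀ ℕ) :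
    MvPowerSeries σ ℝ :=
  if leftPart s = 0 then g (rightPart s) else 0

variable (β : (Fin d →₀ ℕ) → ℝ) (g : (Fin d →₀ ℕ) → MvPowerSeries σ ℝ)

/-- Terms that are not of bipartite form vanish: a black factor kills incoming half-edges, a white
factor outgoing ones. The edge labels of the other trees are the summation indices of the
contraction. -/
theorem sum_spanningTrees_bipartite (b w : ℕ) :
    ∑ E ∈ spanningTrees (Fin d) (univ : Finset (Fin b ⊕ Fin w)),
      (∏ x, blackFactor β (endLabels E (Sum.inl x))) * ∏ y, whiteFactor g (endLabels E (Sum.inr y)) =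
    ∑ E ∈ treeEdges b w, edgeTerm β (fun _ => g) E := by
  simp only [edgeTerm]
  rw [sum_sigma']
  symm
  refine sum_of_injOn (fun x => labelledEdges x.1 x.2) ?_ ?_ ?_ ?_
  · rintro ⟨E, l⟩ _ ⟨E', l'⟩ _ h
    exact labelledEdges_inj h
  · rintro ⟨E, l⟩ h
    simp only [coe_sigma, Set.mem_sigma_iff, mem_coe, mem_treeEdges] at h
    exact mem_coe.2 (mem_spanningTrees.2 (spansTree_labelledEdges.2 h.1))
  · intro E' hE' hn
    by_contra hne
    rw [mem_spanningTrees] at hE'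
    have h1 := left_ne_zero_of_mul hne
    have h2 := right_ne_zero_of_mul hne
    obtain ⟨E, l, rfl⟩ := exists_labelledEdges hE' (fun x => by
      by_contra h
      exact h1 (prod_eq_zero (mem_univ x) (if_neg h))) (fun y => by
      by_contra h
      exact h2 (prod_eq_zero (mem_univ y) (if_neg h)))
    exact hn ⟨⟨E, l⟩, by simpa [mem_treeEdges] using spansTree_labelledEdges.1 hE', rfl⟩
  · rintro ⟨E, l⟩ _
    simp only [blackFactor, whiteFactor, leftPart_endLabels_inl, rightPart_endLabels_inl,
      leftPart_endLabels_inr, rightPart_endLabels_inr, if_true, map_prod]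

theorem sum_spanningTrees_coloured {n : ℕ} (B : Finset (Fin n)) :
    ∑ E ∈ spanningTrees (Fin d) (univ : Finset (Fin n)),
      (∏ v ∈ B, blackFactor β (endLabels E v)) * ∏ v ∈ univ \ B, whiteFactor g (endLabels E v) =
    ∑ E ∈ treeEdges B.card (n - B.card), edgeTerm β (fun _ => g) E := by
  have hc : (univ \ B).card = n - B.card := by
    rw [card_sdiff_of_subset (subset_univ _), card_univ, Fintype.card_fin]
  rw [← hc, ← sum_spanningTrees_bipartite]
  let f : Fin B.card ⊕ Fin (univ \ B).card → Fin n :=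
    Sum.elim (fun x => (B.equivFin.symm x).1) fun y => ((univ \ B).equivFin.symm y).1
  have hf : Function.Injective f := by
    rintro (x | x) (y | y) h
    · exact congrArg Sum.inl (B.equivFin.symm.injective (Subtype.ext h))
    · have h1 : (B.equivFin.symm x).1 = ((univ \ B).equivFin.symm y).1 := h
      exact absurd (h1 ▸ (B.equivFin.symm x).2) (mem_sdiff.1 ((univ \ B).equivFin.symm y).2).2
    · have h1 : ((univ \ B).equivFin.symm x).1 = (B.equivFin.symm y).1 := h
      exact absurd (h1 ▸ (B.equivFin.symm y).2) (mem_sdiff.1 ((univ \ B).equivFin.symm x).2).2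
    · exact congrArg Sum.inr ((univ \ B).equivFin.symm.injective (Subtype.ext h))
  have hu : (univ : Finset (Fin n)) = univ.map ⟨f, hf⟩ := by
    symm
    rw [eq_univ_iff_forall]
    intro v
    by_cases hv : v ∈ B
    · exact mem_map.2 ⟨Sum.inl (B.equivFin ⟨v, hv⟩), mem_univ _, by simp [f]⟩
    · exact mem_map.2 ⟨Sum.inr ((univ \ B).equivFin ⟨v, by simp [hv]⟩), mem_univ _, by simp [f]⟩
  have key := sum_spanningTrees_map (J := Fin d) ⟨f, hf⟩ univ fun E =>
    (∏ v ∈ B, blackFactor β (endLabels E v)) * ∏ v ∈ univ \ B, whiteFactor g (endLabels E v)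
  rw [← hu] at key
  rw [key]
  refine sum_congr rfl fun E _ => ?_
  congr 1
  · rw [← prod_coe_sort B, ← Equiv.prod_comp B.equivFin.symm]
    exact prod_congr rfl fun x _ => congrArg _ (endLabels_map ⟨f, hf⟩ E (Sum.inl x))
  · rw [← prod_coe_sort (univ \ B), ← Equiv.prod_comp (univ \ B).equivFin.symm]
    exact prod_congr rfl fun x _ => congrArg _ (endLabels_map ⟨f, hf⟩ E (Sum.inr x))

/-- Trees whose vertices carry either of two factors are bipartite trees. -/
theorem treeCoeff_vertexFactor (n : ℕ) :
    treeCoeff (vertexFactor β g) n = ∑ p ∈ antidiagonal n,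
      (1 / ((p.2.factorial : ℝ) * (p.1.factorial : ℝ))) •
        ∑ E ∈ treeEdges p.1 p.2, edgeTerm β (fun _ => g) E := by
  -- Expanding the product chooses a colour for each vertex, with `B` the set of black vertices.
  have h : ∀ E : Finset (Fin n × Fin n × Fin d), ∏ v, vertexFactor β g (endLabels E v) =
      ∑ B ∈ (univ : Finset (Fin n)).powerset,
        (∏ v ∈ B, blackFactor β (endLabels E v)) * ∏ v ∈ univ \ B, whiteFactor g (endLabels E v) :=
    fun E => prod_add _ _ _
  simp_rw [treeCoeff, h]
  rw [sum_comm]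
  simp_rw [sum_spanningTrees_coloured]
  -- There are `n.choose k` colourings with `k` black vertices, and division by `n!` leaves `1 / (k!
  -- (n - k)!)`.
  rw [sum_powerset_apply_card (fun k => ∑ E ∈ treeEdges k (n - k), edgeTerm β (fun _ => g) E),
    Nat.sum_antidiagonal_eq_sum_range_succ (fun i j => (1 / ((j.factorial : ℝ) * (i.factorial : ℝ))) •
        ∑ E ∈ treeEdges i j, edgeTerm β (fun _ => g) E), smul_sum, card_univ, Fintype.card_fin]
  refine sum_congr rfl fun k hk => ?_
  have hk' : k ≤ n := Nat.lt_succ_iff.1 (mem_range.1 hk)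
  rw [← Nat.cast_smul_eq_nsmul ℝ, smul_smul]
  congr 1
  have := Nat.choose_pos hk'
  rw [← Nat.choose_mul_factorial_mul_factorial hk']
  push_cast
  field_simp

end Conversion

/-! ### Fibrewise sums and products of formal sums. -/

section Products
variable {σ T N : Type}

/-- Unlike `hasFormalSum_fiberwise`, finiteness is not presupposed for the whole family: it follows
from finiteness in each fibre and finitely many contributing fibres per coefficient. -/
theorem hasFormalSum_of_fiberwise {f : T → MvPowerSeries σ ℝ} (p : T → N)
    {g : N → MvPowerSeries σ ℝ} (hfin : ∀ n, ∃ I : Set N, I.Finite ∧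
      ∀ t, MvPowerSeries.coeff n (f t) ≠ 0 → p t ∈ I)
    (hg : ∀ x, HasFormalSum (fun t : {t // p t = x} => f t) (g x))
    {s : MvPowerSeries σ ℝ} (h : HasFormalSum g s) : HasFormalSum f s := by
  classical
  have hg' : ∀ x, HasFormalSum (fun t => if p t = x then f t else 0) (g x) := by
    intro x
    refine (hasFormalSum_comp_injective (Subtype.val_injective (p := fun t => p t = x)) ?_).1 ?_
    · intro t ht
      exact if_neg fun h => ht ⟨⟨t, h⟩, rfl⟩
    · convert hg x using 2 with t
      exact if_pos t.2
  refine (hasFormalSum_fiberwise ?_ p (g := g) ?_).2 h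
  · intro n
    obtain ⟨I, hI, hf⟩ := hfin n
    refine (hI.biUnion fun x _ => (hg' x n).1).subset fun t ht => ?_
    refine Set.mem_biUnion (hf t ht) ?_
    simpa using ht
  · exact fun x => by convert hg' x

theorem HasFormalSum.mul {f : T → MvPowerSeries σ ℝ} {g : N → MvPowerSeries σ ℝ}
    {s t : MvPowerSeries σ ℝ} (hf : HasFormalSum f s) (hg : HasFormalSum g t) :
    HasFormalSum (fun x : T × N => f x.1 * g x.2) (s * t) := by
  classical
  refine hasFormalSum_of_fiberwise Prod.fst (g := fun x => f x * t) ?_ ?_ ?_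
  · intro n
    refine ⟨⋃ p ∈ (HasAntidiagonal.antidiagonal n : Finset _),
      Function.support fun x => MvPowerSeries.coeff p.1 (f x),
      (HasAntidiagonal.antidiagonal n).finite_toSet.biUnion fun p _ => (hf p.1).1, ?_⟩
    intro x hx
    rw [MvPowerSeries.coeff_mul] at hx
    obtain ⟨p, hp, hne⟩ := exists_ne_zero_of_sum_ne_zero hx
    exact Set.mem_biUnion hp (left_ne_zero_of_mul hne)
  · intro x
    refine (hasFormalSum_comp_injective (e := fun y : N => (⟨(x, y), rfl⟩ : {q : T × N // q.1 = x}))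
      ?_ ?_).1 (hg.mul_left (f x))
    · intro y y' h
      simpa using h
    · rintro ⟨⟨x', y⟩, rfl⟩ h
      exact absurd ⟨y, rfl⟩ h
  · simpa only [mul_comm] using hf.mul_left t

theorem HasFormalSum.prod {k : ℕ} {f : Fin k → T → MvPowerSeries σ ℝ}
    {s : Fin k → MvPowerSeries σ ℝ} (h : ∀ y, HasFormalSum (f y) (s y)) :
    HasFormalSum (fun l : Fin k → T => ∏ y, f y (l y)) (∏ y, s y) := by
  induction k with
  | zero =>
    convert hasFormalSum_of_support_subset (univ : Finset (Fin 0 → T))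
      (f := fun l : Fin 0 → T => ∏ y, f y (l y)) fun t ht => absurd (mem_univ t) ht
    simp
  | succ k ih =>
    refine (hasFormalSum_comp_injective (Fin.consEquiv fun _ => T).injective ?_).1 ?_
    · intro t ht
      exact absurd ((Fin.consEquiv fun _ => T).surjective t) ht
    · rw [Fin.prod_univ_succ]
      convert (h 0).mul (ih fun y => h y.succ) using 2 with x
      rw [Fin.prod_univ_succ]
      rfl

end Products

/-! ### Contractions over a bipartite tree. -/

section EdgeTerm
variable {σ : Type} {d b w : ℕ} {β : (Fin d →₀ ℕ) → ℝ} {E : Finset (Fin b × Fin w)}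

/-- The tensors `m! S^{i₁ … i_m}`. -/
def fullTensor (S : MvPowerSeries (Fin d) ℝ) (α : Fin d →₀ ℕ) : ℝ :=
  (∏ i, ((α i).factorial : ℝ)) * MvPowerSeries.coeff α S

theorem edgeTerm_blackTensor (S : MvPowerSeries (Fin d) ℝ)
    (D : Fin w → (Fin d →₀ ℕ) → MvPowerSeries σ ℝ) (h : ∀ x, (blackEdges E x).card ≠ 1) :
    edgeTerm (blackTensor S) D E = edgeTerm (fullTensor S) D E := by
  refine sum_congr rfl fun l _ => ?_
  congr 2
  refine prod_congr rfl fun x _ => ?_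
  rw [blackTensor, if_neg]
  · rfl
  · rw [toFinsupp_map, map_sum]
    simpa using h x

theorem edgeTerm_blackTensor_eq_zero (S : MvPowerSeries (Fin d) ℝ)
    (D : Fin w → (Fin d →₀ ℕ) → MvPowerSeries σ ℝ) {x : Fin b} (h : (blackEdges E x).card = 1) :
    edgeTerm (blackTensor S) D E = 0 := by
  refine sum_eq_zero fun l _ => ?_
  rw [prod_eq_zero (mem_univ x), map_zero, zero_mul]
  rw [blackTensor, if_pos]
  rw [toFinsupp_map, map_sum]
  simpa using h

/-- Each white vertex contributes order one and black vertices contribute constants, so the order is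
the number of white vertices. -/
theorem eq_deg_of_coeff_edgeTerm_ne_zero {deg : (σ →₀ ℕ) →+ ℕ}
    {D : Fin w → (Fin d →₀ ℕ) → MvPowerSeries σ ℝ}
    (hD : ∀ y α n, MvPowerSeries.coeff n (D y α) ≠ 0 → deg n = 1) {m : σ →₀ ℕ}
    (hm : MvPowerSeries.coeff m (edgeTerm β D E) ≠ 0) : w = deg m := by
  classical
  rw [edgeTerm, map_sum] at hm
  obtain ⟨l, -, hl⟩ := exists_ne_zero_of_sum_ne_zero hm
  rw [MvPowerSeries.coeff_C_mul] at hl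
  have h := right_ne_zero_of_mul hl
  rw [MvPowerSeries.coeff_prod] at h
  obtain ⟨k, hk, hne⟩ := exists_ne_zero_of_sum_ne_zero h
  rw [mem_finsuppAntidiag] at hk
  rw [← hk.1, map_sum, sum_congr rfl fun y hy => hD y _ _ (prod_ne_zero_iff.1 hne y hy)]
  simp

theorem edgeTerm_mul (c : Fin w → MvPowerSeries σ ℝ)
    (D : Fin w → (Fin d →₀ ℕ) → MvPowerSeries σ ℝ) :
    edgeTerm β (fun y α => c y * D y α) E = (∏ y, c y) * edgeTerm β D E := by
  rw [edgeTerm, edgeTerm, mul_sum]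
  refine sum_congr rfl fun l _ => ?_
  rw [prod_mul_distrib, mul_left_comm]

theorem edgeTerm_sum {K : Fin w → Type} [∀ y, Fintype (K y)]
    (D : (y : Fin w) → K y → (Fin d →₀ ℕ) → MvPowerSeries σ ℝ) :
    edgeTerm β (fun y α => ∑ k, D y k α) E =
      ∑ k : (y : Fin w) → K y, edgeTerm β (fun y => D y (k y)) E := by
  simp only [edgeTerm]
  rw [sum_comm]
  refine sum_congr rfl fun l _ => ?_
  rw [prod_univ_sum, Fintype.piFinset_univ, mul_sum]

theorem hasFormalSum_edgeTerm {T : Type} {f : T → (Fin d →₀ ℕ) → MvPowerSeries σ ℝ}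
    {g : (Fin d →₀ ℕ) → MvPowerSeries σ ℝ} (h : ∀ α, HasFormalSum (fun t => f t α) (g α)) :
    HasFormalSum (fun k : Fin w → T => edgeTerm β (fun y => f (k y)) E)
      (edgeTerm β (fun _ => g) E) :=
  HasFormalSum.sum univ fun _ _ => (HasFormalSum.prod fun _ => h _).mul_left _

theorem sum_card_blackEdges : ∑ x, (blackEdges E x).card = E.card := by
  rw [← Fintype.card_coe E, ← card_univ]
  exact (card_eq_sum_card_fiberwise fun e _ => mem_univ e.1.1).symm

/-- If every black vertex has degree at least two, then `2 * b ≤ E.card = b + w - 1`. The remaining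
case is an isolated black vertex, which is the whole tree and makes the bound `w + 1` necessary. -/
theorem le_succ_of_isTree (h : (bipartiteGraph E).IsTree) (hE : ∀ x, (blackEdges E x).card ≠ 1) :
    b ≤ w + 1 := by
  have hs := (spansTree_labelledEdges (l := fun _ : E => ())).2 h
  have hcard : E.card + 1 = b + w := by
    have := hs.card_eq
    simpa [labelledEdges] using this
  by_cases h0 : ∃ x, (blackEdges E x).card = 0
  · obtain ⟨x, hx⟩ := h0
    have hc := hs.conn {Sum.inl x} (subset_univ _) (singleton_nonempty _) ?_
    · have := congrArg Finset.card hc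
      simp at this
      omega
    · intro e he
      obtain ⟨e', rfl⟩ := mem_labelledEdges.1 he
      have : e'.1.1 ≠ x := by
        intro h
        rw [card_eq_zero] at hx
        exact notMem_empty e' (hx ▸ mem_filter.2 ⟨mem_univ _, h⟩)
      simp [this]
  · push Not at h0
    have : ∑ x : Fin b, 2 ≤ ∑ x, (blackEdges E x).card := by
      refine sum_le_sum fun x _ => ?_
      have h1 := hE x
      have h2 := h0 x
      omega
    rw [sum_card_blackEdges, sum_const, card_univ, Fintype.card_fin, smul_eq_mul] at this
    omega

end EdgeTerm

/-! ### The sum over white-leaved bipartite trees. -/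

section Trees
variable {σ : Type} {d : ℕ} {deg : (σ →₀ ℕ) →+ ℕ}

/-- The bipartite trees with given numbers of vertices. -/
def treeEquiv : (Σ p : ℕ × ℕ, {E : Finset (Fin p.1 × Fin p.2) // (bipartiteGraph E).IsTree}) ≃
    BipartiteTree where
  toFun x := ⟨x.1.1, x.1.2, x.2.1, x.2.2⟩
  invFun t := ⟨(t.nB, t.nW), ⟨t.edges, t.isTree⟩⟩
  left_inv _ := rfl
  right_inv _ := rfl

theorem hasFormalSum_treeCoeff_bipartite (β : (Fin d →₀ ℕ) → ℝ)
    (g : (Fin d →₀ ℕ) → MvPowerSeries σ ℝ) (n : ℕ) :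
    HasFormalSum (fun t : {t : BipartiteTree // t.nB + t.nW = n} =>
      t.1.labelFactor • edgeTerm β (fun _ => g) t.1.edges) (treeCoeff (vertexFactor β g) n) := by
  classical
  have h : HasFormalSum (fun t : BipartiteTree => if t.nB + t.nW = n then
      t.labelFactor • edgeTerm β (fun _ => g) t.edges else 0)
      (treeCoeff (vertexFactor β g) n) := by
    refine (hasFormalSum_comp_injective treeEquiv.injective
      fun t ht => absurd (treeEquiv.surjective t) ht).1 ?_
    convert hasFormalSum_of_support_subset ((antidiagonal n).sigma fun p =>
      (univ : Finset {E : Finset (Fin p.1 × Fin p.2) // (bipartiteGraph E).IsTree})) ?_ using 1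
    · rw [sum_sigma, treeCoeff_vertexFactor]
      refine sum_congr rfl fun p hp => ?_
      rw [smul_sum, sum_subtype (treeEdges p.1 p.2) (fun _ => mem_treeEdges)]
      refine sum_congr rfl fun E _ => ?_
      exact (if_pos (mem_antidiagonal.1 hp)).symm
    · intro x hx
      refine if_neg fun h => hx ?_
      exact mem_sigma.2 ⟨mem_antidiagonal.2 h, mem_univ _⟩
  convert (hasFormalSum_comp_injective (Subtype.val_injective
    (p := fun t : BipartiteTree => t.nB + t.nW = n)) fun t ht => ?_).2 h using 2 with t
  · exact (if_pos t.2).symm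
  · exact if_neg fun h => ht ⟨⟨t, h⟩, rfl⟩

theorem nB_le_succ (t : WhiteLeavedTree) : t.1.nB ≤ t.1.nW + 1 :=
  le_succ_of_isTree t.1.isTree t.2

theorem finite_trees (k : ℕ) : {t : WhiteLeavedTree | t.1.nW = k}.Finite := by
  classical
  refine Set.Finite.of_finite_image (f := fun t => treeEquiv.symm t.1) ?_
    (treeEquiv.symm.injective.comp Subtype.val_injective).injOn
  refine (((range (k + 2)) ×ˢ {k}).sigma fun p => univ).finite_toSet.subset ?_
  rintro _ ⟨t, ht, rfl⟩
  refine mem_coe.2 (mem_sigma.2 ⟨mem_product.2 ⟨mem_range.2 ?_, mem_singleton.2 ht⟩, mem_univ _⟩)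
  have := nB_le_succ t
  rw [ht] at this
  exact Nat.lt_succ_of_le this

/-- The sum over vertex-coloured trees as a sum over white-leaved bipartite trees. -/
theorem hasFormalSum_whiteLeaved {S : MvPowerSeries (Fin d) ℝ}
    {g : (Fin d →₀ ℕ) → MvPowerSeries σ ℝ}
    (hg : ∀ α n, MvPowerSeries.coeff n (g α) ≠ 0 → deg n = 1) {s : MvPowerSeries σ ℝ}
    (h : HasFormalSum (treeCoeff (vertexFactor (blackTensor S) g)) s) :
    HasFormalSum (fun t : WhiteLeavedTree =>
      t.1.labelFactor • edgeTerm (fullTensor S) (fun _ => g) t.1.edges) s := by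
  have h1 : HasFormalSum (fun t : BipartiteTree =>
      t.labelFactor • edgeTerm (blackTensor S) (fun _ => g) t.edges) s := by
    refine hasFormalSum_of_fiberwise (fun t => t.nB + t.nW) ?_
      (hasFormalSum_treeCoeff_bipartite _ _) h
    intro n
    -- A contributing tree has `deg n` white vertices and, being white-leaved, at most `deg n + 1`
    -- black ones.
    refine ⟨Set.Iic (2 * deg n + 1), Set.finite_Iic _, fun t ht => ?_⟩
    rw [MvPowerSeries.coeff_smul] at ht
    have hne := right_ne_zero_of_mul ht
    have hw := eq_deg_of_coeff_edgeTerm_ne_zero (fun _ => hg) hne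
    have hl : t.WhiteLeaved := by
      intro x hx
      rw [edgeTerm_blackTensor_eq_zero S _ hx, map_zero] at hne
      exact hne rfl
    have := nB_le_succ ⟨t, hl⟩
    simp only [Set.mem_Iic]
    dsimp only at this
    omega
  convert (hasFormalSum_comp_injective (Subtype.val_injective
    (p := fun t : BipartiteTree => t.WhiteLeaved)) fun t ht => ?_).2 h1 using 2 with t
  · rw [edgeTerm_blackTensor S _ t.2]
  · have : ¬ t.WhiteLeaved := fun h => ht ⟨⟨t, h⟩, rfl⟩
    rw [BipartiteTree.WhiteLeaved] at this
    push Not at this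
    obtain ⟨x, hx⟩ := this
    rw [edgeTerm_blackTensor_eq_zero S _ hx, smul_zero]

end Trees

/-! ### Renumberings, automorphisms and the size of an isomorphism class. -/

section Orbits

/-- Orbit–stabiliser counting without a group action: `P` consists of the renumberings, `X` of the
trees in a class, and the fibres are copies of the automorphisms. -/
theorem card_mul_of_fibers {P X : Type} [Finite P] [Nonempty P] (π : P → X)
    (hπ : Function.Surjective π) {R : Type} (h : ∀ x, Nonempty ({p // π p = x} ≃ R)) :
    Finite X ∧ 0 < Nat.card R ∧ Nat.card X * Nat.card R = Nat.card P := by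
  have hX : Finite X := Finite.of_surjective π hπ
  have e : P ≃ X × R := (Equiv.sigmaFiberEquiv π).symm.trans
    (Equiv.sigmaEquivProdOfEquiv fun x => Classical.choice (h x))
  have hc : Nat.card X * Nat.card R = Nat.card P := by rw [Nat.card_congr e, Nat.card_prod]
  refine ⟨hX, Nat.pos_of_ne_zero fun h0 => ?_, hc⟩
  rw [h0, mul_zero] at hc
  exact Nat.card_pos.ne hc

namespace BipartiteTree

/-- The tree obtained by renumbering the vertices. -/
def relabel (t : BipartiteTree) (ρ : Equiv.Perm (Fin t.nB) × Equiv.Perm (Fin t.nW)) :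
    BipartiteTree where
  nB := t.nB
  nW := t.nW
  edges := t.edges.map (ρ.1.prodCongr ρ.2).toEmbedding
  isTree := by
    refine (SimpleGraph.Iso.isTree_iff ⟨ρ.1.sumCongr ρ.2, ?_⟩).1 t.isTree
    intro u v
    rcases u with u | u <;> rcases v with v | v <;> simp [bipartiteGraph_adj]

theorem mem_relabel {t : BipartiteTree} {ρ : Equiv.Perm (Fin t.nB) × Equiv.Perm (Fin t.nW)}
    (x : Fin t.nB) (y : Fin t.nW) :
    (ρ.1 x, ρ.2 y) ∈ (t.relabel ρ).edges ↔ (x, y) ∈ t.edges := by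
  change (ρ.1 x, ρ.2 y) ∈ t.edges.map (ρ.1.prodCongr ρ.2).toEmbedding ↔ _
  simp

/-- The isomorphism from a tree to a renumbered tree. -/
def isoRelabel (t : BipartiteTree) (ρ : Equiv.Perm (Fin t.nB) × Equiv.Perm (Fin t.nW)) :
    Iso t (t.relabel ρ) := ⟨ρ.1, ρ.2, fun x y => (mem_relabel x y).symm⟩

/-- Isomorphic trees have the same numbers of vertices, and once these are identified an isomorphism
is a pair of permutations. -/
theorem exists_relabel {t t' : BipartiteTree} (f : Iso t t') : ∃ ρ, t.relabel ρ = t' := by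
  obtain ⟨f, g, h⟩ := f
  obtain ⟨b, w, E, hE⟩ := t
  obtain ⟨b', w', E', hE'⟩ := t'
  obtain rfl : b = b' := by simpa using Fintype.card_congr f
  obtain rfl : w = w' := by simpa using Fintype.card_congr g
  refine ⟨(f, g), ?_⟩
  rw [relabel]
  congr 1
  ext ⟨x, y⟩
  obtain ⟨x, rfl⟩ := f.surjective x
  obtain ⟨y, rfl⟩ := g.surjective y
  simpa using h x y

theorem relabel_eq_iff {t : BipartiteTree}
    {ρ ρ' : Equiv.Perm (Fin t.nB) × Equiv.Perm (Fin t.nW)} :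
    t.relabel ρ = t.relabel ρ' ↔
      ∀ x y, (x, y) ∈ t.edges ↔ (ρ'.1.symm (ρ.1 x), ρ'.2.symm (ρ.2 y)) ∈ t.edges := by
  have h : t.relabel ρ = t.relabel ρ' ↔ t.edges.map (ρ.1.prodCongr ρ.2).toEmbedding =
      t.edges.map (ρ'.1.prodCongr ρ'.2).toEmbedding := by
    simp [relabel]
  rw [h, Finset.ext_iff]
  have h2 : ∀ x y, (ρ.1 x, ρ.2 y) ∈ (t.relabel ρ').edges ↔
      (ρ'.1.symm (ρ.1 x), ρ'.2.symm (ρ.2 y)) ∈ t.edges := by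
    intro x y
    rw [← mem_relabel (ρ := ρ'), Equiv.apply_symm_apply, Equiv.apply_symm_apply]
  constructor
  · intro h x y
    rw [← h2, ← mem_relabel (ρ := ρ)]
    exact h _
  · rintro h ⟨x, y⟩
    obtain ⟨x, rfl⟩ := ρ.1.surjective x
    obtain ⟨y, rfl⟩ := ρ.2.surjective y
    exact (mem_relabel x y).trans ((h x y).trans (h2 x y).symm)

/-- The renumberings with a given result are a torsor under the automorphisms. -/
def relabelEquiv (t : BipartiteTree) (ρ' : Equiv.Perm (Fin t.nB) × Equiv.Perm (Fin t.nW)) :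
    {ρ // t.relabel ρ = t.relabel ρ'} ≃ Iso t t where
  toFun ρ := ⟨ρ.1.1.trans ρ'.1.symm, ρ.1.2.trans ρ'.2.symm, relabel_eq_iff.1 ρ.2⟩
  invFun f := ⟨(f.black.trans ρ'.1, f.white.trans ρ'.2), relabel_eq_iff.2 fun x y => by
    simpa using f.map_edges x y⟩
  left_inv ρ := by ext <;> simp
  right_inv f := by cases f; simp [Equiv.trans_assoc]

theorem card_iso_class (t : BipartiteTree) :
    Finite {t' : BipartiteTree // Nonempty (Iso t t')} ∧ 0 < t.symCard ∧
      Nat.card {t' : BipartiteTree // Nonempty (Iso t t')} * t.symCard =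
        t.nB.factorial * t.nW.factorial := by
  have := card_mul_of_fibers (X := {t' : BipartiteTree // Nonempty (Iso t t')})
    (R := Iso t t) (fun ρ => ⟨t.relabel ρ, ⟨t.isoRelabel ρ⟩⟩)
    (fun ⟨t', ⟨f⟩⟩ => (exists_relabel f).imp fun ρ h => Subtype.ext h) (by
      rintro ⟨t', ⟨f⟩⟩
      obtain ⟨ρ', rfl⟩ := exists_relabel f
      exact ⟨(Equiv.subtypeEquivRight fun ρ => Subtype.ext_iff).trans (t.relabelEquiv ρ')⟩)
  rw [Nat.card_prod, Nat.card_perm, Nat.card_perm, Nat.card_fin, Nat.card_fin] at this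
  exact this

/-- The bijection between the edges of isomorphic trees. -/
def Iso.edgeEquiv {t t' : BipartiteTree} (f : Iso t t') : t.edges ≃ t'.edges :=
  (f.black.prodCongr f.white).subtypeEquiv fun e => f.map_edges e.1 e.2

theorem Iso.blackEdges_eq {t t' : BipartiteTree} (f : Iso t t') (x : Fin t.nB) :
    blackEdges t'.edges (f.black x) = (blackEdges t.edges x).map f.edgeEquiv.toEmbedding := by
  ext e
  obtain ⟨e, rfl⟩ := f.edgeEquiv.surjective e
  rw [show f.edgeEquiv e = f.edgeEquiv.toEmbedding e from rfl, mem_map']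
  simp only [blackEdges, mem_filter, mem_univ, true_and]
  exact f.black.injective.eq_iff

theorem Iso.whiteEdges_eq {t t' : BipartiteTree} (f : Iso t t') (y : Fin t.nW) :
    whiteEdges t'.edges (f.white y) = (whiteEdges t.edges y).map f.edgeEquiv.toEmbedding := by
  ext e
  obtain ⟨e, rfl⟩ := f.edgeEquiv.surjective e
  rw [show f.edgeEquiv e = f.edgeEquiv.toEmbedding e from rfl, mem_map']
  simp only [whiteEdges, mem_filter, mem_univ, true_and]
  exact f.white.injective.eq_iff

theorem Iso.whiteLeaved {t t' : BipartiteTree} (f : Iso t t') (h : t.WhiteLeaved) :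
    t'.WhiteLeaved := by
  intro x
  obtain ⟨x, rfl⟩ := f.black.surjective x
  change (blackEdges t'.edges _).card ≠ 1
  rw [f.blackEdges_eq, card_map]
  exact h x

/-- The isomorphism carries edges to edges, so it only renames the summation indices and reorders
the factors. Letting `D` depend on the white vertex covers weighted trees. -/
theorem Iso.edgeTerm_eq {σ : Type} {d : ℕ} {β : (Fin d →₀ ℕ) → ℝ} {t t' : BipartiteTree}
    (f : Iso t t') {D : Fin t.nW → (Fin d →₀ ℕ) → MvPowerSeries σ ℝ}
    {D' : Fin t'.nW → (Fin d →₀ ℕ) → MvPowerSeries σ ℝ} (h : ∀ y, D' (f.white y) = D y) :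
    edgeTerm β D t.edges = edgeTerm β D' t'.edges := by
  rw [edgeTerm, edgeTerm, ← Equiv.sum_comp (f.edgeEquiv.arrowCongr (Equiv.refl (Fin d)))]
  refine sum_congr rfl fun l _ => ?_
  rw [← Equiv.prod_comp f.black, ← Equiv.prod_comp f.white]
  have hl : (f.edgeEquiv.arrowCongr (Equiv.refl (Fin d)) l) ∘ f.edgeEquiv = l := by
    ext e
    simp [Equiv.arrowCongr]
  simp only [f.blackEdges_eq, f.whiteEdges_eq, h, map_val, Multiset.map_map,
    Equiv.coe_toEmbedding, hl]

end BipartiteTree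

namespace WeightedTree
open BipartiteTree

/-- The weighted tree obtained by renumbering the vertices. -/
def relabel (t : WeightedTree) (ρ : Equiv.Perm (Fin t.tree.nB) × Equiv.Perm (Fin t.tree.nW)) :
    WeightedTree :=
  ⟨t.tree.relabel ρ, (t.tree.isoRelabel ρ).whiteLeaved t.whiteLeaved, t.weight ∘ ρ.2.symm⟩

/-- The isomorphism from a weighted tree to a renumbered one. -/
def isoRelabel (t : WeightedTree)
    (ρ : Equiv.Perm (Fin t.tree.nB) × Equiv.Perm (Fin t.tree.nW)) : Iso t (t.relabel ρ) :=
  ⟨t.tree.isoRelabel ρ, fun y => congrArg t.weight (ρ.2.symm_apply_apply y)⟩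

theorem exists_relabel {t t' : WeightedTree} (f : Iso t t') : ∃ ρ, t.relabel ρ = t' := by
  obtain ⟨⟨f, g, h⟩, hw⟩ := f
  obtain ⟨⟨b, w, E, hE⟩, ht, l⟩ := t
  obtain ⟨⟨b', w', E', hE'⟩, ht', l'⟩ := t'
  obtain rfl : b = b' := by simpa using Fintype.card_congr f
  obtain rfl : w = w' := by simpa using Fintype.card_congr g
  have hE'' : E' = E.map (f.prodCongr g).toEmbedding := by
    ext ⟨x, y⟩
    obtain ⟨x, rfl⟩ := f.surjective x
    obtain ⟨y, rfl⟩ := g.surjective y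
    simpa using (h x y).symm
  refine ⟨(f, g), ?_⟩
  rw [relabel, WeightedTree.mk.injEq]
  refine ⟨?_, heq_of_eq ?_⟩
  · rw [BipartiteTree.relabel]
    congr 1
    exact hE''.symm
  ext y
  exact (hw (g.symm y)).symm.trans (congrArg l' (g.apply_symm_apply y))

theorem relabel_eq_iff {t : WeightedTree}
    {ρ ρ' : Equiv.Perm (Fin t.tree.nB) × Equiv.Perm (Fin t.tree.nW)} :
    t.relabel ρ = t.relabel ρ' ↔
      (∀ x y, (x, y) ∈ t.tree.edges ↔ (ρ'.1.symm (ρ.1 x), ρ'.2.symm (ρ.2 y)) ∈ t.tree.edges) ∧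
      ∀ y, t.weight (ρ'.2.symm (ρ.2 y)) = t.weight y := by
  rw [← BipartiteTree.relabel_eq_iff, relabel, relabel, WeightedTree.mk.injEq]
  refine and_congr_right fun _ => ?_
  change HEq (t.weight ∘ ρ.2.symm : Fin t.tree.nW → ℕ)
    (t.weight ∘ ρ'.2.symm : Fin t.tree.nW → ℕ) ↔ _
  rw [heq_iff_eq, funext_iff, ← ρ.2.forall_congr_right]
  simp [eq_comm]

/-- The renumberings with a given result are a torsor under the automorphisms. -/
def relabelEquiv (t : WeightedTree)
    (ρ' : Equiv.Perm (Fin t.tree.nB) × Equiv.Perm (Fin t.tree.nW)) :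
    {ρ // t.relabel ρ = t.relabel ρ'} ≃ Iso t t where
  toFun ρ := ⟨⟨ρ.1.1.trans ρ'.1.symm, ρ.1.2.trans ρ'.2.symm, (relabel_eq_iff.1 ρ.2).1⟩,
    (relabel_eq_iff.1 ρ.2).2⟩
  invFun f := ⟨(f.black.trans ρ'.1, f.white.trans ρ'.2), relabel_eq_iff.2
    ⟨fun x y => by simpa using f.map_edges x y, fun y => by simpa using f.map_weight y⟩⟩
  left_inv ρ := by ext <;> simp
  right_inv f := by rcases f with ⟨⟨⟩⟩; simp [Equiv.trans_assoc]

theorem card_iso_class (t : WeightedTree) :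
    Finite {t' : WeightedTree // Nonempty (Iso t t')} ∧ 0 < t.symCard ∧
      Nat.card {t' : WeightedTree // Nonempty (Iso t t')} * t.symCard =
        t.tree.nB.factorial * t.tree.nW.factorial := by
  have := card_mul_of_fibers (X := {t' : WeightedTree // Nonempty (Iso t t')})
    (R := Iso t t) (fun ρ => ⟨t.relabel ρ, ⟨t.isoRelabel ρ⟩⟩)
    (fun ⟨t', ⟨f⟩⟩ => (exists_relabel f).imp fun ρ h => Subtype.ext h) (by
      rintro ⟨t', ⟨f⟩⟩
      obtain ⟨ρ', rfl⟩ := exists_relabel f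
      exact ⟨(Equiv.subtypeEquivRight fun ρ => Subtype.ext_iff).trans (t.relabelEquiv ρ')⟩)
  rw [Nat.card_prod, Nat.card_perm, Nat.card_perm, Nat.card_fin, Nat.card_fin] at this
  exact this

end WeightedTree
end Orbits

/-! ### Sums over isomorphism classes. -/

section Classes
variable {σ : Type}

/-- The family is constant on finite classes, so each class contributes its cardinality times the
value at a representative. -/
theorem hasFormalSum_quotient {T : Type} [r : Setoid T] {f : T → MvPowerSeries σ ℝ}
    {s : MvPowerSeries σ ℝ} (hf : ∀ t t', t ≈ t' → f t = f t')
    (hfin : ∀ t : T, Finite {t' // t ≈ t'}) (h : HasFormalSum f s) :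
    HasFormalSum (fun c : Quotient r => (Nat.card {t' // c.out ≈ t'} : ℝ) • f c.out) s := by
  classical
  refine (hasFormalSum_fiberwise (fun n => (h n).1) (fun t => (⟦t⟧ : Quotient r)) ?_).1 h
  intro c
  have := Fintype.ofFinite {t' // c.out ≈ t'}
  have hc : ∀ t : T, ⟦t⟧ = c ↔ c.out ≈ t := by
    intro t
    conv_lhs => rw [← c.out_eq, Quotient.eq]
    exact ⟨Setoid.symm, Setoid.symm⟩
  have key := hasFormalSum_of_support_subset (univ : Finset {t' // c.out ≈ t'})
    (f := fun t => f c.out) fun t ht => absurd (mem_univ t) ht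
  rw [sum_const, card_univ, ← Nat.card_eq_fintype_card, ← Nat.cast_smul_eq_nsmul ℝ] at key
  refine (hasFormalSum_comp_injective (Subtype.val_injective (p := fun t => c.out ≈ t)) ?_).1 ?_
  · intro t ht
    exact if_neg fun h => ht ⟨⟨t, (hc t).1 h⟩, rfl⟩
  · convert key using 2 with t
    rw [if_pos ((hc _).2 t.2)]
    exact (hf _ _ t.2).symm

theorem BipartiteTree.labelFactor_eq {t t' : BipartiteTree} (f : Iso t t') :
    t.labelFactor = t'.labelFactor := by
  have h1 : t.nB = t'.nB := by simpa using Fintype.card_congr f.black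
  have h2 : t.nW = t'.nW := by simpa using Fintype.card_congr f.white
  rw [labelFactor, labelFactor, h1, h2]

theorem BipartiteTree.mul_labelFactor (t : BipartiteTree) {N s : ℕ} (hs : 0 < s)
    (h : N * s = t.nB.factorial * t.nW.factorial) : (N : ℝ) * t.labelFactor = 1 / s := by
  have h' : (N : ℝ) * s = t.nB.factorial * t.nW.factorial := by exact_mod_cast h
  have : (s : ℝ) ≠ 0 := by positivity
  rw [labelFactor]
  field_simp
  linarith

theorem hasFormalSum_whiteLeavedClass {f : BipartiteTree → MvPowerSeries σ ℝ}
    {s : MvPowerSeries σ ℝ} (hf : ∀ t t', Nonempty (BipartiteTree.Iso t t') → f t = f t')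
    (h : HasFormalSum (fun t : WhiteLeavedTree => t.1.labelFactor • f t.1) s) :
    HasFormalSum (fun c : WhiteLeavedClass => (1 / (c.rep.symCard : ℝ)) • f c.rep) s := by
  -- Isomorphisms preserve the absence of black leaves, so the class inside `WhiteLeavedTree` is the
  -- full class counted by `card_iso_class`.
  have e : ∀ t : WhiteLeavedTree, {t' : WhiteLeavedTree // t ≈ t'} ≃
      {t' : BipartiteTree // Nonempty (BipartiteTree.Iso t.1 t')} := fun t =>
    { toFun := fun x => ⟨x.1.1, x.2⟩
      invFun := fun x => ⟨⟨x.1, x.2.elim fun f => f.whiteLeaved t.2⟩, x.2⟩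
      left_inv := fun _ => rfl
      right_inv := fun _ => rfl }
  convert hasFormalSum_quotient ?_ ?_ h using 2 with c
  · rw [smul_smul, Nat.card_congr (e _)]
    obtain ⟨-, hpos, hc⟩ := c.rep.card_iso_class
    congr 1
    exact (c.rep.mul_labelFactor hpos hc).symm
  · rintro t t' ⟨g⟩
    rw [BipartiteTree.labelFactor_eq g, hf _ _ ⟨g⟩]
  · intro t
    have := t.1.card_iso_class.1
    exact Finite.of_equiv _ (e t).symm

theorem hasFormalSum_weightedClass {f : WeightedTree → MvPowerSeries σ ℝ}
    {s : MvPowerSeries σ ℝ} (hf : ∀ t t', Nonempty (WeightedTree.Iso t t') → f t = f t')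
    (h : HasFormalSum (fun t : WeightedTree => t.tree.labelFactor • f t) s) :
    HasFormalSum (fun c : WeightedClass => (1 / (c.rep.symCard : ℝ)) • f c.rep) s := by
  convert hasFormalSum_quotient ?_ ?_ h using 2 with c
  · rw [smul_smul]
    obtain ⟨-, hpos, hc⟩ := c.rep.card_iso_class
    congr 1
    exact (c.rep.tree.mul_labelFactor hpos hc).symm
  · rintro t t' ⟨g⟩
    rw [BipartiteTree.labelFactor_eq g.toIso, hf _ _ ⟨g⟩]
  · exact fun t => t.card_iso_class.1

end Classes

/-! ### The terms of the theorem as contractions. -/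

section Terms
variable {σ : Type} {d : ℕ}

/-- The `m!` at a black vertex cancels the denominator of the symmetric tensor and leaves `α!` times
the coefficient, a derivative of `S` at zero. -/
theorem card_factorial_mul_symCoeff (S : MvPowerSeries (Fin d) ℝ) (s : Multiset (Fin d)) :
    (s.card.factorial : ℝ) * symCoeff S s = fullTensor S (Multiset.toFinsupp s) := by
  have : (s.card.factorial : ℝ) ≠ 0 := by positivity
  simp only [symCoeff, fullTensor, Multiset.toFinsupp_apply]
  field_simp

theorem C_contraction (S : MvPowerSeries (Fin d) ℝ) (t : BipartiteTree)
    (D : Fin t.nW → Multiset (Fin d) → ℝ) :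
    (MvPowerSeries.C (t.contraction S D) : MvPowerSeries σ ℝ) = edgeTerm (fullTensor S)
      (fun y α => MvPowerSeries.C (D y (Finsupp.toMultiset α))) t.edges := by
  rw [BipartiteTree.contraction, map_sum]
  refine sum_congr rfl fun l _ => ?_
  rw [map_mul, map_prod MvPowerSeries.C (fun y => D y _)]
  simp only [Multiset.toFinsupp_toMultiset]
  congr 2
  refine prod_congr rfl fun x _ => ?_
  rw [← card_factorial_mul_symCoeff, Multiset.card_map]
  rfl

/-- The derivatives of `λ G`. -/
def orderedFactor (G : Pt d → ℝ) (a : Pt d) (α : Fin d →₀ ℕ) : MvPowerSeries Unit ℝ :=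
  MvPowerSeries.X () * MvPowerSeries.C (mixedPartial (Finsupp.toMultiset α) G a)

theorem ordered_eq (S : MvPowerSeries (Fin d) ℝ) (G : Pt d → ℝ) (t : BipartiteTree) :
    t.ordered S G = edgeTerm (fullTensor S) (fun _ => orderedFactor G (linearPart S)) t.edges := by
  rw [BipartiteTree.ordered, BipartiteTree.term, C_contraction]
  exact (by simp : _ = (∏ _y : Fin t.nW, MvPowerSeries.X ()) * _).trans (edgeTerm_mul _ _).symm

/-- The derivatives of `Y^a q_a`. -/
def coordFactor (Y : Pt d → Pt d) (a : Pt d) (α : Fin d →₀ ℕ) : MvPowerSeries (Fin d) ℝ :=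
  ∑ i, MvPowerSeries.X i *
    MvPowerSeries.C (mixedPartial (Finsupp.toMultiset α) (fun y => Y y i) a)

theorem coordContracted_eq (S : MvPowerSeries (Fin d) ℝ) (Y : Pt d → Pt d) (t : BipartiteTree) :
    t.coordContracted S Y =
      edgeTerm (fullTensor S) (fun _ => coordFactor Y (linearPart S)) t.edges := by
  refine Eq.trans ?_ (edgeTerm_sum fun (_ : Fin t.nW) (i : Fin d) α => MvPowerSeries.X i *
    MvPowerSeries.C (mixedPartial (Finsupp.toMultiset α) (fun y => Y y i) (linearPart S))).symm
  refine sum_congr rfl fun a _ => ?_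
  rw [BipartiteTree.coordTerm, C_contraction, mul_comm]
  exact (edgeTerm_mul _ _).symm

/-- The derivatives of `λ G^{a_1 … a_k} r_{a_1} ⋯ r_{a_k}`. -/
def weightedFactor {e : ℕ} (G : Pt d → MvPowerSeries (Fin e) ℝ) (a : Pt d) (k : ℕ)
    (α : Fin d →₀ ℕ) : MvPowerSeries (Option (Fin e)) ℝ :=
  MvPowerSeries.X none * ∑ i : Fin k → Fin e, (∏ j, MvPowerSeries.X (some (i j))) *
    MvPowerSeries.C (mixedPartial (Finsupp.toMultiset α)
      (fun y => symCoeff (G y) (univ.val.map i)) a)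

theorem contracted_eq {e : ℕ} (S : MvPowerSeries (Fin d) ℝ) (G : Pt d → MvPowerSeries (Fin e) ℝ)
    (t : WeightedTree) : t.contracted S G = edgeTerm (fullTensor S)
      (fun y => weightedFactor G (linearPart S) (t.weight y)) t.tree.edges := by
  refine Eq.trans ?_ (edgeTerm_mul (fun _ => MvPowerSeries.X none) fun y α => ∑ i : Fin (t.weight y) →
    Fin e, (∏ j, MvPowerSeries.X (some (i j))) * MvPowerSeries.C (mixedPartial
      (Finsupp.toMultiset α) (fun y => symCoeff (G y) (univ.val.map i)) (linearPart S))).symm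
  rw [WeightedTree.contracted, prod_const, card_univ, Fintype.card_fin, edgeTerm_sum]
  congr 1
  refine sum_congr rfl fun I _ => ?_
  rw [WeightedTree.term, C_contraction, mul_comm]
  exact (edgeTerm_mul _ _).symm

theorem ordered_iso (S : MvPowerSeries (Fin d) ℝ) (G : Pt d → ℝ) {t t' : BipartiteTree}
    (f : t.Iso t') : t.ordered S G = t'.ordered S G := by
  rw [ordered_eq, ordered_eq]
  exact f.edgeTerm_eq fun _ => rfl

theorem coordContracted_iso (S : MvPowerSeries (Fin d) ℝ) (Y : Pt d → Pt d) {t t' : BipartiteTree}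
    (f : t.Iso t') : t.coordContracted S Y = t'.coordContracted S Y := by
  rw [coordContracted_eq, coordContracted_eq]
  exact f.edgeTerm_eq fun _ => rfl

theorem contracted_iso {e : ℕ} (S : MvPowerSeries (Fin d) ℝ) (G : Pt d → MvPowerSeries (Fin e) ℝ)
    {t t' : WeightedTree} (f : t.Iso t') : t.contracted S G = t'.contracted S G := by
  rw [contracted_eq, contracted_eq]
  exact f.edgeTerm_eq fun y => by rw [f.map_weight]

theorem term_iso (S : MvPowerSeries (Fin d) ℝ) (G : Pt d → ℝ) {t t' : BipartiteTree}
    (f : t.Iso t') : t.term S G = t'.term S G := by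
  have h : (MvPowerSeries.C (t.term S G) : MvPowerSeries Unit ℝ) =
      MvPowerSeries.C (t'.term S G) := by
    rw [BipartiteTree.term, BipartiteTree.term, C_contraction, C_contraction]
    exact f.edgeTerm_eq fun _ => rfl
  exact MvPowerSeries.C_injective h

end Terms

/-! ### The three linear families and their derivatives. -/

section Derivatives
variable {d e : ℕ} {V : Set (Pt d)}

theorem mixedPartial_sum_mul (hV : IsOpen V) {ι : Type} (I : Finset ι) (c : ι → ℝ)
    {f : ι → Pt d → ℝ} (hf : ∀ i ∈ I, ContDiffOn ℝ ∞ (f i) V) {a : Pt d} (ha : a ∈ V)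
    (s : Multiset (Fin d)) : mixedPartial s (fun z => ∑ i ∈ I, c i * f i z) a =
      ∑ i ∈ I, c i * mixedPartial s (f i) a := by
  classical
  induction I using Finset.induction_on with
  | empty => simpa using mixedPartial_zero s a
  | insert i I hi ih =>
    have h := fun j hj => hf j (mem_insert_of_mem hj)
    simp only [sum_insert hi]
    rw [← ih h]
    have h1 := mixedPartial_add hV (contDiffOn_const.mul (hf i (mem_insert_self i I)))
      (ContDiffOn.sum fun j hj => contDiffOn_const.mul (h j hj)) ha s (f := fun z => c i * f i z)
      (g := fun z => ∑ j ∈ I, c j * f j z)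
    exact h1.trans (congrArg (· + _) (mixedPartial_smul hV (hf i (mem_insert_self i I)) (c i) ha s))

theorem coeff_X_mul_C {σ : Type} [DecidableEq σ] (n : σ →₀ ℕ) (i : σ) (c : ℝ) :
    MvPowerSeries.coeff n (MvPowerSeries.X i * MvPowerSeries.C c) =
      (if n = Finsupp.single i 1 then 1 else 0) * c := by
  rw [mul_comm, MvPowerSeries.coeff_C_mul, MvPowerSeries.coeff_X, mul_comm]

theorem coeff_scaled (G : Pt d → ℝ) (n : Unit →₀ ℕ) (z : Pt d) :
    MvPowerSeries.coeff n (scaled G z) = (if n = Finsupp.single () 1 then 1 else 0) * G z :=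
  coeff_X_mul_C _ _ _

theorem scaled_isLinearFamily {G : Pt d → ℝ} (hG : ContDiffOn ℝ ∞ G V) :
    IsLinearFamily (Finsupp.applyAddHom ()) V (scaled G) where
  smooth n := by
    simp only [coeff_scaled]
    exact contDiffOn_const.mul hG
  linear n hn z := by
    rw [coeff_scaled, if_neg, zero_mul]
    rintro rfl
    simp at hn

theorem derivTensor_scaled (hV : IsOpen V) {G : Pt d → ℝ} (hG : ContDiffOn ℝ ∞ G V) {a : Pt d}
    (ha : a ∈ V) : derivTensor (scaled G) a = orderedFactor G a := by
  refine funext fun α => MvPowerSeries.ext fun n => ?_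
  rw [coeff_derivTensor, orderedFactor, coeff_X_mul_C]
  simp only [coeff_scaled]
  exact mixedPartial_smul hV hG _ ha _

theorem coeff_coordFamily (Y : Pt d → Pt d) (n : Fin d →₀ ℕ) (z : Pt d) :
    MvPowerSeries.coeff n (coordFamily Y z) =
      ∑ i, (if n = Finsupp.single i 1 then 1 else 0) * Y z i := by
  rw [coordFamily, map_sum]
  refine sum_congr rfl fun i _ => ?_
  rw [mul_comm, coeff_X_mul_C]

theorem coordFamily_isLinearFamily {Y : Pt d → Pt d} (hY : ContDiffOn ℝ ∞ Y V) :
    IsLinearFamily Finsupp.degree V (coordFamily Y) where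
  smooth n := by
    simp only [coeff_coordFamily]
    exact ContDiffOn.sum fun i _ => contDiffOn_const.mul (contDiffOn_pi.1 hY i)
  linear n hn z := by
    rw [coeff_coordFamily]
    refine sum_eq_zero fun i _ => ?_
    rw [if_neg, zero_mul]
    rintro rfl
    simp at hn

theorem derivTensor_coordFamily (hV : IsOpen V) {Y : Pt d → Pt d} (hY : ContDiffOn ℝ ∞ Y V)
    {a : Pt d} (ha : a ∈ V) : derivTensor (coordFamily Y) a = coordFactor Y a := by
  ext α n
  rw [coeff_derivTensor, coordFactor, map_sum]
  simp only [coeff_coordFamily, coeff_X_mul_C]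
  exact mixedPartial_sum_mul hV _ _ (fun i _ => contDiffOn_pi.1 hY i) ha _

theorem coeff_scaledParam (G : Pt d → MvPowerSeries (Fin e) ℝ) (n : Option (Fin e) →₀ ℕ)
    (z : Pt d) : MvPowerSeries.coeff n (scaledParam G z) =
      if n none = 1 then MvPowerSeries.coeff n.some (G z) else 0 := rfl

theorem scaledParam_isLinearFamily (G : SmoothFamily V e) :
    IsLinearFamily (Finsupp.applyAddHom none) V (scaledParam G.1) where
  smooth n := by
    simp only [coeff_scaledParam]
    split_ifs
    · exact G.2 _
    · exact contDiffOn_const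
  linear n hn z := if_neg hn

theorem coeff_weightedFactor (G : Pt d → MvPowerSeries (Fin e) ℝ) (a : Pt d) (k : ℕ)
    (α : Fin d →₀ ℕ) (n : Option (Fin e) →₀ ℕ) :
    MvPowerSeries.coeff n (weightedFactor G a k α) = if n none = 1 then
      ∑ i : Fin k → Fin e with ∑ j, Finsupp.single (i j) 1 = n.some,
        mixedPartial (Finsupp.toMultiset α) (fun y => symCoeff (G y) (univ.val.map i)) a else 0 := by
  rw [weightedFactor, mul_sum, map_sum, ← sum_filter_add_sum_filter_not univ
    (fun i : Fin k → Fin e => n none = 1 ∧ ∑ j, Finsupp.single (i j) 1 = n.some)]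
  have hterm : ∀ (i : Fin k → Fin e) (c : ℝ), MvPowerSeries.coeff n (MvPowerSeries.X none *
      ((∏ j, MvPowerSeries.X (some (i j))) * MvPowerSeries.C c)) =
      if n none = 1 ∧ ∑ j, Finsupp.single (i j) 1 = n.some then c else 0 := by
    intro i c
    have hn : n = Finsupp.single none 1 + ∑ j, Finsupp.single (some (i j)) 1 ↔
        n none = 1 ∧ ∑ j, Finsupp.single (i j) 1 = n.some := by
      rw [Finsupp.ext_iff, Option.forall, Finsupp.ext_iff]
      simp [Finsupp.finsetSum_apply, Finsupp.single_apply, eq_comm]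
    simp only [MvPowerSeries.X_def, MvPowerSeries.prod_monomial, prod_const_one]
    rw [← MvPowerSeries.monomial_zero_eq_C_apply, MvPowerSeries.monomial_mul_monomial,
      MvPowerSeries.monomial_mul_monomial, MvPowerSeries.coeff_monomial]
    simp only [add_zero, one_mul, hn]
  simp only [hterm]
  rw [sum_congr rfl fun i hi => if_pos (mem_filter.1 hi).2,
    sum_congr (s₂ := filter _ _) rfl fun i hi => if_neg (mem_filter.1 hi).2, sum_const_zero,
    add_zero]
  split_ifs with h <;> simp [h]

theorem weightedFactor_linear (G : Pt d → MvPowerSeries (Fin e) ℝ) (a : Pt d) (k : ℕ)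
    (α : Fin d →₀ ℕ) (n : Option (Fin e) →₀ ℕ)
    (h : MvPowerSeries.coeff n (weightedFactor G a k α) ≠ 0) : n none = 1 := by
  by_contra hn
  rw [coeff_weightedFactor, if_neg hn] at h
  exact h rfl

/-- Expansion of a white factor by degree in `r`: a monomial `n` meets only the weight `k =
n.some.degree`, and there the sum over index tuples is `coeff_eq_sum_symCoeff`. -/
theorem hasFormalSum_weightedFactor (hV : IsOpen V) (G : SmoothFamily V e) {a : Pt d}
    (ha : a ∈ V) (α : Fin d →₀ ℕ) :
    HasFormalSum (fun k => weightedFactor G.1 a k α) (derivTensor (scaledParam G.1) a α) := by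
  intro n
  have hk : ∀ k, MvPowerSeries.coeff n (weightedFactor G.1 a k α) ≠ 0 → k = n.some.degree := by
    intro k h
    rw [coeff_weightedFactor] at h
    split_ifs at h
    · obtain ⟨i, hi, -⟩ := exists_ne_zero_of_sum_ne_zero h
      rw [← (mem_filter.1 hi).2, map_sum]
      simp
    · exact absurd rfl h
  refine ⟨(Set.finite_singleton n.some.degree).subset fun k h => hk k h, ?_⟩
  rw [finsum_eq_single _ n.some.degree fun k h => not_imp_comm.1 (hk k) h, coeff_weightedFactor,
    coeff_derivTensor]
  simp only [coeff_scaledParam]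
  split_ifs
  · have hs : ∀ i ∈ (univ.filter fun i : Fin n.some.degree → Fin e =>
        ∑ j, Finsupp.single (i j) 1 = n.some),
        ContDiffOn ℝ ∞ (fun y => symCoeff (G.1 y) (univ.val.map i)) V := fun i _ =>
      (G.2 _).mul contDiffOn_const
    have := mixedPartial_sum_mul hV _ (fun _ => 1) hs ha (Finsupp.toMultiset α)
    simp only [one_mul] at this
    rw [← this]
    congr 1
    ext y
    exact (coeff_eq_sum_symCoeff _ _).symm
  · exact (mixedPartial_zero _ _).symm

end Derivatives

/-! ### The tree formula for each of the three families. -/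

section TreeSums
variable {d : ℕ} {V : Set (Pt d)} {S : MvPowerSeries (Fin d) ℝ}

theorem hasFormalSum_ordered (hV : IsOpen V) (hS : linearPart S ∈ V) {G : Pt d → ℝ}
    (hG : ContDiffOn ℝ ∞ G V) : HasFormalSum (fun t : WhiteLeavedTree =>
      t.1.labelFactor • t.1.ordered S G)
      (resultOf S (scaled G) (solutionQ S (scaled G)) (solutionY S (scaled G))) := by
  have hL := scaled_isLinearFamily hG
  simp_rw [ordered_eq, ← derivTensor_scaled hV hG hS]
  exact hasFormalSum_whiteLeaved (fun α n => not_imp_comm.1 fun h =>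
    hL.coeff_derivTensor_eq_zero h _ α) (hasFormalSum_treeCoeff_resultOf hL S)

theorem hasFormalSum_coordContracted (hV : IsOpen V) (hS : linearPart S ∈ V) {Y : Pt d → Pt d}
    (hY : ContDiffOn ℝ ∞ Y V) : HasFormalSum (fun t : WhiteLeavedTree =>
      t.1.labelFactor • t.1.coordContracted S Y) (resultOf S (coordFamily Y)
        (solutionQ S (coordFamily Y)) (solutionY S (coordFamily Y))) := by
  have hL := coordFamily_isLinearFamily hY
  simp_rw [coordContracted_eq, ← derivTensor_coordFamily hV hY hS]
  exact hasFormalSum_whiteLeaved (fun α n => not_imp_comm.1 fun h =>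
    hL.coeff_derivTensor_eq_zero h _ α) (hasFormalSum_treeCoeff_resultOf hL S)

theorem hasFormalSum_contracted {e : ℕ} (hV : IsOpen V) (hS : linearPart S ∈ V)
    (G : SmoothFamily V e) : HasFormalSum (fun t : WeightedTree =>
      t.tree.labelFactor • t.contracted S G.1) (resultOf S (scaledParam G.1)
        (solutionQ S (scaledParam G.1)) (solutionY S (scaledParam G.1))) := by
  have hL := scaledParam_isLinearFamily G
  have h := hasFormalSum_whiteLeaved (fun α n => not_imp_comm.1 fun h =>
    hL.coeff_derivTensor_eq_zero h (linearPart S) α) (hasFormalSum_treeCoeff_resultOf hL S)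
  -- The fibre over a tree consists of its weight functions. Multiplying out the expansions of all
  -- white factors by weight sums this fibre to the term of the unweighted tree.
  refine hasFormalSum_of_fiberwise (fun t : WeightedTree => (⟨t.tree, t.whiteLeaved⟩ :
    WhiteLeavedTree)) ?_ ?_ h
  · intro n
    refine ⟨_, finite_trees (n none), fun t ht => ?_⟩
    rw [contracted_eq, MvPowerSeries.coeff_smul] at ht
    exact eq_deg_of_coeff_edgeTerm_ne_zero (deg := Finsupp.applyAddHom none)
      (fun y α m hm => weightedFactor_linear _ _ _ _ _ hm) (right_ne_zero_of_mul ht)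
  · intro x
    refine (hasFormalSum_comp_injective (e := fun k : Fin x.1.nW → ℕ =>
      (⟨⟨x.1, x.2, k⟩, rfl⟩ : {t : WeightedTree // (⟨t.tree, t.whiteLeaved⟩ : WhiteLeavedTree) = x}))
      ?_ ?_).1 ?_
    · intro k k' h
      simpa using h
    · rintro ⟨⟨t, ht, k⟩, rfl⟩ h
      exact absurd ⟨k, rfl⟩ h
    · simp only [contracted_eq]
      exact (hasFormalSum_edgeTerm (hasFormalSum_weightedFactor hV G hS)).smul _

end TreeSums

/-! ### Homogeneous polynomial dependence on `G`. -/

section Homogeneous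
variable {E : Type} [AddCommGroup E] [Module ℝ E]

/-- Homogeneous polynomial functions of degree `n`. -/
def IsHomogeneousFun (n : ℕ) (f : E → ℝ) : Prop :=
  ∃ M : MultilinearMap ℝ (fun _ : Fin n => E) ℝ, ∀ G, f G = M fun _ => G

theorem IsHomogeneousFun.add {n : ℕ} {f g : E → ℝ} (hf : IsHomogeneousFun n f)
    (hg : IsHomogeneousFun n g) : IsHomogeneousFun n fun G => f G + g G := by
  obtain ⟨M, hM⟩ := hf
  obtain ⟨N, hN⟩ := hg
  exact ⟨M + N, fun G => congrArg₂ (· + ·) (hM G) (hN G)⟩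

theorem IsHomogeneousFun.const_mul {n : ℕ} {f : E → ℝ} (hf : IsHomogeneousFun n f) (c : ℝ) :
    IsHomogeneousFun n fun G => c * f G := by
  obtain ⟨M, hM⟩ := hf
  exact ⟨c • M, fun G => congrArg (c * ·) (hM G)⟩

theorem isHomogeneousFun_zero (n : ℕ) : IsHomogeneousFun n fun _ : E => (0 : ℝ) :=
  ⟨0, fun _ => rfl⟩

theorem isHomogeneousFun_const (c : ℝ) : IsHomogeneousFun 0 fun _ : E => c :=
  ⟨MultilinearMap.constOfIsEmpty ℝ _ c, fun _ => rfl⟩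

theorem isHomogeneousFun_linear (f : E →ₗ[ℝ] ℝ) : IsHomogeneousFun 1 f :=
  ⟨MultilinearMap.ofSubsingleton ℝ E ℝ 0 f, fun _ => rfl⟩

theorem IsHomogeneousFun.sum {ι : Type} (I : Finset ι) {n : ℕ} {f : ι → E → ℝ}
    (hf : ∀ i ∈ I, IsHomogeneousFun n (f i)) : IsHomogeneousFun n fun G => ∑ i ∈ I, f i G := by
  classical
  induction I using Finset.induction_on with
  | empty => exact isHomogeneousFun_zero n
  | insert a I ha ih =>
    simp only [sum_insert ha]
    exact (hf a (mem_insert_self a I)).add (ih fun i hi => hf i (mem_insert_of_mem hi))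

theorem IsHomogeneousFun.mul {n k : ℕ} {f g : E → ℝ} (hf : IsHomogeneousFun n f)
    (hg : IsHomogeneousFun k g) : IsHomogeneousFun (n + k) fun G => f G * g G := by
  obtain ⟨M, hM⟩ := hf
  obtain ⟨N, hN⟩ := hg
  refine ⟨((LinearMap.mul' ℝ ℝ).compMultilinearMap (M.domCoprod N)).domDomCongr finSumFinEquiv,
    fun G => congrArg₂ (· * ·) (hM G) (hN G)⟩

variable {σ : Type} {deg : (σ →₀ ℕ) →+ ℕ}

/-- Functions with values in formal power series whose coefficients are homogeneous polynomial
functions, with degrees given by `deg`. -/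
def IsHomogeneousSeries (deg : (σ →₀ ℕ) →+ ℕ) (Φ : E → MvPowerSeries σ ℝ) : Prop :=
  ∀ m, IsHomogeneousFun (deg m) fun G => MvPowerSeries.coeff m (Φ G)

theorem IsHomogeneousSeries.add {Φ Ψ : E → MvPowerSeries σ ℝ} (h : IsHomogeneousSeries deg Φ)
    (h' : IsHomogeneousSeries deg Ψ) : IsHomogeneousSeries deg fun G => Φ G + Ψ G := fun m => by
  simpa only [map_add] using (h m).add (h' m)

theorem IsHomogeneousSeries.smul {Φ : E → MvPowerSeries σ ℝ} (h : IsHomogeneousSeries deg Φ)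
    (c : ℝ) : IsHomogeneousSeries deg fun G => c • Φ G := fun m => by
  simpa only [MvPowerSeries.coeff_smul] using (h m).const_mul c

theorem IsHomogeneousSeries.sub {Φ Ψ : E → MvPowerSeries σ ℝ} (h : IsHomogeneousSeries deg Φ)
    (h' : IsHomogeneousSeries deg Ψ) : IsHomogeneousSeries deg fun G => Φ G - Ψ G := by
  simpa only [neg_one_smul, ← sub_eq_add_neg] using h.add (h'.smul (-1))

theorem IsHomogeneousSeries.sum {ι : Type} (I : Finset ι) {Φ : ι → E → MvPowerSeries σ ℝ}
    (h : ∀ i ∈ I, IsHomogeneousSeries deg (Φ i)) :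
    IsHomogeneousSeries deg fun G => ∑ i ∈ I, Φ i G := fun m => by
  simpa only [map_sum] using IsHomogeneousFun.sum I fun i hi => h i hi m

theorem IsHomogeneousSeries.mul {Φ Ψ : E → MvPowerSeries σ ℝ} (h : IsHomogeneousSeries deg Φ)
    (h' : IsHomogeneousSeries deg Ψ) : IsHomogeneousSeries deg fun G => Φ G * Ψ G := fun m => by
  classical
  simp only [MvPowerSeries.coeff_mul]
  refine IsHomogeneousFun.sum _ fun p hp => ?_
  rw [← (HasAntidiagonal.mem_antidiagonal.1 hp), map_add]
  exact (h p.1).mul (h' p.2)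

theorem isHomogeneousSeries_C (c : ℝ) :
    IsHomogeneousSeries deg fun _ : E => (MvPowerSeries.C c : MvPowerSeries σ ℝ) := fun m => by
  classical
  simp only [MvPowerSeries.coeff_C]
  split_ifs with h
  · rw [h, map_zero]
    exact isHomogeneousFun_const c
  · exact isHomogeneousFun_zero _

theorem isHomogeneousSeries_zero :
    IsHomogeneousSeries deg fun _ : E => (0 : MvPowerSeries σ ℝ) := by
  simpa only [map_zero] using isHomogeneousSeries_C (E := E) (deg := deg) (0 : ℝ)

theorem IsHomogeneousSeries.prod {ι : Type} (I : Finset ι) {Φ : ι → E → MvPowerSeries σ ℝ}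
    (h : ∀ i ∈ I, IsHomogeneousSeries deg (Φ i)) :
    IsHomogeneousSeries deg fun G => ∏ i ∈ I, Φ i G := by
  classical
  induction I using Finset.induction_on with
  | empty => simpa only [prod_empty, map_one] using isHomogeneousSeries_C (E := E) (deg := deg) 1
  | insert a I ha ih =>
    simp only [prod_insert ha]
    exact (h a (mem_insert_self a I)).mul (ih fun i hi => h i (mem_insert_of_mem hi))

/-- The finite set of contributing terms must not depend on `G`; otherwise the coefficient need not
be a single polynomial. -/
theorem isHomogeneousSeries_formalSum {T : Type} {f : E → T → MvPowerSeries σ ℝ}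
    (h : ∀ t, IsHomogeneousSeries deg fun G => f G t)
    (hfin : ∀ m, ∃ I : Finset T, ∀ G t, MvPowerSeries.coeff m (f G t) ≠ 0 → t ∈ I) :
    IsHomogeneousSeries deg fun G => formalSum (f G) := fun m => by
  obtain ⟨I, hI⟩ := hfin m
  have : (fun G => MvPowerSeries.coeff m (formalSum (f G))) =
      fun G => ∑ t ∈ I, MvPowerSeries.coeff m (f G t) :=
    funext fun G => finsum_eq_sum_of_support_subset _ fun t ht => hI G t ht
  rw [this]
  exact IsHomogeneousFun.sum I fun t _ => h t m

end Homogeneous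

/-! ### The solution depends polynomially on `G`. -/

section SolutionHomogeneous
variable {E : Type} [AddCommGroup E] [Module ℝ E] {σ : Type} {deg : (σ →₀ ℕ) →+ ℕ}

theorem Admissible.le_of_coeff_rootedCoeff_ne_zero {J : Type} [DecidableEq J] [Fintype J]
    {F : (J ⊕ J →₀ ℕ) → MvPowerSeries σ ℝ} (hF : Admissible deg F)
    (K : (J ⊕ J →₀ ℕ) → MvPowerSeries σ ℝ) {m : σ →₀ ℕ} {n : ℕ}
    (h : MvPowerSeries.coeff m (rootedCoeff F K n) ≠ 0) : n ≤ 2 * deg m := by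
  classical
  rw [← (hasFormalSum_rootedCoeff_select F K n m).2] at h
  obtain ⟨s, hs⟩ := not_forall.1 fun hc => h (finsum_eq_zero_of_forall_eq_zero hc)
  rw [← ne_eq] at hs
  rw [MvPowerSeries.coeff_mul] at hs
  obtain ⟨p, hp, hne⟩ := exists_ne_zero_of_sum_ne_zero hs
  have := (hF.rootedCoeff_bound (right_ne_zero_of_mul hne)).1
  rw [← HasAntidiagonal.mem_antidiagonal.1 hp, map_add]
  omega

/-- Admissibility bounds the number of vertices in terms of `deg m` alone, uniformly in `G`, so each
coefficient is a fixed finite sum of products of vertex factors. -/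
theorem isHomogeneousSeries_markedSeries {J : Type} [DecidableEq J] [Fintype J]
    {F K : E → (J ⊕ J →₀ ℕ) → MvPowerSeries σ ℝ} (hF : ∀ G, Admissible deg (F G))
    (hF' : ∀ s, IsHomogeneousSeries deg fun G => F G s)
    (hK : ∀ s, IsHomogeneousSeries deg fun G => K G s) :
    IsHomogeneousSeries deg fun G => markedSeries (F G) (K G) := by
  refine isHomogeneousSeries_formalSum (fun n => ?_) fun m => ⟨range (2 * deg m + 1),
    fun G n hn => mem_range.2 (Nat.lt_succ_of_le ((hF G).le_of_coeff_rootedCoeff_ne_zero _ hn))⟩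
  exact (IsHomogeneousSeries.sum _ fun E _ => (hK _).mul
    (IsHomogeneousSeries.prod _ fun v _ => hF' _)).smul _

variable {d : ℕ} {V : Set (Pt d)} {L : E →ₗ[ℝ] Pt d → MvPowerSeries σ ℝ}

theorem isHomogeneousSeries_derivTensor (hV : IsOpen V) (hL : ∀ G, IsLinearFamily deg V (L G))
    {a : Pt d} (ha : a ∈ V) (α : Fin d →₀ ℕ) :
    IsHomogeneousSeries deg fun G => derivTensor (L G) a α := by
  intro n
  by_cases hn : deg n = 1
  · rw [hn]
    refine isHomogeneousFun_linear
      { toFun := fun G => MvPowerSeries.coeff n (derivTensor (L G) a α)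
        map_add' := fun G G' => ?_
        map_smul' := fun c G => ?_ }
    · simp only [coeff_derivTensor, map_add, Pi.add_apply]
      exact mixedPartial_add hV ((hL G).smooth n) ((hL G').smooth n) ha _
    · simp only [coeff_derivTensor, map_smul, Pi.smul_apply]
      exact mixedPartial_smul hV ((hL G).smooth n) c ha _
  · simp only [(hL _).coeff_derivTensor_eq_zero hn]
    exact isHomogeneousFun_zero _

theorem isHomogeneousSeries_vertexFactor (hV : IsOpen V) (hL : ∀ G, IsLinearFamily deg V (L G))
    {a : Pt d} (ha : a ∈ V) (S : MvPowerSeries (Fin d) ℝ) (s : Fin d ⊕ Fin d →₀ ℕ) :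
    IsHomogeneousSeries deg fun G => vertexFactor (blackTensor S) (derivTensor (L G) a) s := by
  refine IsHomogeneousSeries.add ?_ ?_
  · split_ifs
    · exact isHomogeneousSeries_C _
    · exact isHomogeneousSeries_zero
  · split_ifs
    · exact isHomogeneousSeries_derivTensor hV hL ha _
    · exact isHomogeneousSeries_zero

variable [DecidableEq σ] {S : MvPowerSeries (Fin d) ℝ}

theorem isHomogeneousSeries_solutionQ (hV : IsOpen V) (hL : ∀ G, IsLinearFamily deg V (L G))
    (hS : linearPart S ∈ V) (i : Fin d) :
    IsHomogeneousSeries deg fun G => solutionQ S (L G) i :=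
  isHomogeneousSeries_markedSeries (fun G => (hL G).admissible S _)
    (isHomogeneousSeries_vertexFactor hV hL hS S)
    fun _ => isHomogeneousSeries_vertexFactor hV hL hS S _

theorem isHomogeneousSeries_solutionH (hV : IsOpen V) (hL : ∀ G, IsLinearFamily deg V (L G))
    (hS : linearPart S ∈ V) (i : Fin d) :
    IsHomogeneousSeries deg fun G => solutionH S (L G) i :=
  isHomogeneousSeries_markedSeries (fun G => (hL G).admissible S _)
    (isHomogeneousSeries_vertexFactor hV hL hS S)
    fun _ => isHomogeneousSeries_vertexFactor hV hL hS S _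

theorem isHomogeneousSeries_solutionY (hV : IsOpen V) (hL : ∀ G, IsLinearFamily deg V (L G))
    (hS : linearPart S ∈ V) (i : Fin d) :
    IsHomogeneousSeries deg fun G => solutionY S (L G) i :=
  (isHomogeneousSeries_C _).add (isHomogeneousSeries_solutionH hV hL hS i)

theorem isHomogeneousSeries_resultOf (hV : IsOpen V) (hL : ∀ G, IsLinearFamily deg V (L G))
    (hS : linearPart S ∈ V) : IsHomogeneousSeries deg fun G =>
      resultOf S (L G) (solutionQ S (L G)) (solutionY S (L G)) := by
  simp only [resultOf_solution (hL _)]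
  exact (isHomogeneousSeries_markedSeries (fun G => (hL G).admissible S _)
    (isHomogeneousSeries_vertexFactor hV hL hS S)
    (isHomogeneousSeries_vertexFactor hV hL hS S)).sub (IsHomogeneousSeries.sum _ fun i _ =>
      (isHomogeneousSeries_solutionH hV hL hS i).mul (isHomogeneousSeries_solutionQ hV hL hS i))

end SolutionHomogeneous

/-! ### Functional power series from series with homogeneous coefficients. -/

section FunctionalSeries
variable {E : Type} [AddCommGroup E] [Module ℝ E] {e : ℕ}

theorem single_unit (n : Unit →₀ ℕ) : Finsupp.single () (n ()) = n := by
  ext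
  simp

/-- The functional power series with given homogeneous components. -/
def IsHomogeneousSeries.toFunctional {Φ : E → MvPowerSeries Unit ℝ}
    (h : IsHomogeneousSeries (Finsupp.applyAddHom ()) Φ) : FunctionalPowerSeries E ℝ where
  comp n G := MvPowerSeries.coeff (Finsupp.single () n) (Φ G)
  homogeneous n := by
    have := h (Finsupp.single () n)
    rwa [Finsupp.applyAddHom_apply, Finsupp.single_eq_same] at this

theorem IsHomogeneousSeries.series_toFunctional {Φ : E → MvPowerSeries Unit ℝ}
    (h : IsHomogeneousSeries (Finsupp.applyAddHom ()) Φ) (G : E) :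
    h.toFunctional.series G = Φ G := by
  refine MvPowerSeries.ext fun n => ?_
  change MvPowerSeries.coeff (Finsupp.single () (n ())) (Φ G) = _
  rw [single_unit]

theorem FunctionalPowerSeries.ext_series {F F' : FunctionalPowerSeries E ℝ}
    (h : ∀ G, F.series G = F'.series G) : F = F' := by
  ext n G
  have := congrArg (MvPowerSeries.coeff (Finsupp.single () n)) (h G)
  change F.comp ((Finsupp.single () n : Unit →₀ ℕ) ()) G =
    F'.comp ((Finsupp.single () n : Unit →₀ ℕ) ()) G at this
  rwa [Finsupp.single_eq_same] at this

/-- The functional power series with given homogeneous components. -/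
def IsHomogeneousSeries.toParamFunctional {Φ : E → MvPowerSeries (Option (Fin e)) ℝ}
    (h : IsHomogeneousSeries (Finsupp.applyAddHom none) Φ) :
    FunctionalPowerSeries E (MvPowerSeries (Fin e) ℝ) where
  comp n G := fun m => MvPowerSeries.coeff (m.optionElim n) (Φ G)
  homogeneous n := by
    have h' : ∀ m : Fin e →₀ ℕ, IsHomogeneousFun n fun G => MvPowerSeries.coeff (m.optionElim n) (Φ G) := by
      intro m
      have := h (m.optionElim n)
      rwa [Finsupp.applyAddHom_apply, Finsupp.optionElim_apply_none] at this
    -- Homogeneity holds for each coefficient in `r` separately; the multilinear maps of all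
    -- coefficients combine into one with values in power series.
    choose M hM using h'
    exact ⟨MultilinearMap.pi M, fun G => funext fun m => hM m G⟩

theorem IsHomogeneousSeries.paramSeries_toParamFunctional
    {Φ : E → MvPowerSeries (Option (Fin e)) ℝ}
    (h : IsHomogeneousSeries (Finsupp.applyAddHom none) Φ) (G : E) :
    h.toParamFunctional.paramSeries G = Φ G := by
  refine MvPowerSeries.ext fun n => ?_
  change MvPowerSeries.coeff (n.some.optionElim (n none)) (Φ G) = _
  rw [Finsupp.optionElim_some]

theorem FunctionalPowerSeries.ext_paramSeries
    {F F' : FunctionalPowerSeries E (MvPowerSeries (Fin e) ℝ)}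
    (h : ∀ G, F.paramSeries G = F'.paramSeries G) : F = F' := by
  refine FunctionalPowerSeries.ext (funext fun n => funext fun G => MvPowerSeries.ext fun m => ?_)
  have := congrArg (MvPowerSeries.coeff (m.optionElim n)) (h G)
  change MvPowerSeries.coeff (m.optionElim n).some (F.comp (m.optionElim n none) G) =
    MvPowerSeries.coeff (m.optionElim n).some (F'.comp (m.optionElim n none) G) at this
  rwa [Finsupp.optionElim_apply_none, Finsupp.some_optionElim] at this

end FunctionalSeries

/-! ### Existence, uniqueness and tree formulas for the equations. -/

section Existence
variable {d : ℕ} {V : Set (Pt d)} {S : MvPowerSeries (Fin d) ℝ}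

/-- `G ↦ λ G` as a linear map. -/
def scaledMap (V : Set (Pt d)) : SmoothFn V →ₗ[ℝ] Pt d → MvPowerSeries Unit ℝ where
  toFun G := scaled G.1
  map_add' G G' := funext fun y => MvPowerSeries.ext fun n => by
    rw [Pi.add_apply, map_add, coeff_scaled, coeff_scaled, coeff_scaled, ← mul_add]
    rfl
  map_smul' c G := funext fun y => MvPowerSeries.ext fun n => by
    rw [Pi.smul_apply, MvPowerSeries.coeff_smul, coeff_scaled, coeff_scaled]
    exact mul_left_comm _ _ _

/-- `G ↦ λ G` as a linear map. -/
def scaledParamMap (V : Set (Pt d)) (e : ℕ) :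
    SmoothFamily V e →ₗ[ℝ] Pt d → MvPowerSeries (Option (Fin e)) ℝ where
  toFun G := scaledParam G.1
  map_add' G G' := funext fun y => MvPowerSeries.ext fun n => by
    rw [Pi.add_apply, map_add]
    simp only [coeff_scaledParam]
    split_ifs
    · rfl
    · exact (add_zero _).symm
  map_smul' c G := funext fun y => MvPowerSeries.ext fun n => by
    rw [Pi.smul_apply, MvPowerSeries.coeff_smul]
    simp only [coeff_scaledParam]
    split_ifs
    · rfl
    · exact (mul_zero _).symm

/-- For each fixed `G` the series form a solution of the system in power series in `λ`, where
`SolvesSystem.unique` applies. -/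
theorem SolvesGeneral.eq_solution {q y : Fin d → FunctionalPowerSeries (SmoothFn V) ℝ}
    {R : FunctionalPowerSeries (SmoothFn V) ℝ} (h : SolvesGeneral V S q y R) (hV : IsOpen V)
    (hS : linearPart S ∈ V) (G : SmoothFn V) :
    (fun i => (q i).series G) = solutionQ S (scaled G.1) ∧
    (fun i => (y i).series G) = solutionY S (scaled G.1) ∧
    R.series G = resultOf S (scaled G.1) (solutionQ S (scaled G.1)) (solutionY S (scaled G.1)) := by
  have hL := scaled_isLinearFamily G.2
  obtain ⟨h1, h2⟩ := (h G).1.unique hL (solvesSystem_solution hV hL hS)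
  exact ⟨h1, h2, by rw [(h G).2, h1, h2]⟩

theorem existsUnique_solvesGeneral (hV : IsOpen V) (hS : linearPart S ∈ V) :
    ∃! p : (Fin d → FunctionalPowerSeries (SmoothFn V) ℝ) ×
      (Fin d → FunctionalPowerSeries (SmoothFn V) ℝ) ×
      FunctionalPowerSeries (SmoothFn V) ℝ, SolvesGeneral V S p.1 p.2.1 p.2.2 := by
  have hL : ∀ G, IsLinearFamily (Finsupp.applyAddHom ()) V (scaledMap V G) :=
    fun G => scaled_isLinearFamily G.2
  refine ⟨(fun i => (isHomogeneousSeries_solutionQ hV hL hS i).toFunctional,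
    fun i => (isHomogeneousSeries_solutionY hV hL hS i).toFunctional,
    (isHomogeneousSeries_resultOf hV hL hS).toFunctional), fun G => ?_, ?_⟩
  · simp only [IsHomogeneousSeries.series_toFunctional]
    exact ⟨solvesSystem_solution hV (hL G) hS, rfl⟩
  · rintro ⟨q, y, R⟩ h
    refine Prod.ext (funext fun i => ?_) (Prod.ext (funext fun i => ?_) ?_)
    · refine FunctionalPowerSeries.ext_series fun G => ?_
      rw [IsHomogeneousSeries.series_toFunctional]
      exact congrFun (h.eq_solution hV hS G).1 i
    · refine FunctionalPowerSeries.ext_series fun G => ?_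
      rw [IsHomogeneousSeries.series_toFunctional]
      exact congrFun (h.eq_solution hV hS G).2.1 i
    · refine FunctionalPowerSeries.ext_series fun G => ?_
      rw [IsHomogeneousSeries.series_toFunctional]
      exact (h.eq_solution hV hS G).2.2

theorem SolvesGeneral.hasFormalSum {q y : Fin d → FunctionalPowerSeries (SmoothFn V) ℝ}
    {R : FunctionalPowerSeries (SmoothFn V) ℝ} (h : SolvesGeneral V S q y R) (hV : IsOpen V)
    (hS : linearPart S ∈ V) (G : SmoothFn V) :
    HasFormalSum (fun t : WhiteLeavedTree => t.1.labelFactor • t.1.ordered S G.1) (R.series G) ∧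
    HasFormalSum (fun c : WhiteLeavedClass =>
      (1 / (c.rep.symCard : ℝ)) • c.rep.ordered S G.1) (R.series G) := by
  rw [(h.eq_solution hV hS G).2.2]
  exact ⟨hasFormalSum_ordered hV hS G.2, hasFormalSum_whiteLeavedClass
    (fun t t' ⟨f⟩ => ordered_iso S G.1 f) (hasFormalSum_ordered hV hS G.2)⟩

variable {e : ℕ}

theorem SolvesGeneralParam.eq_solution
    {q y : Fin d → FunctionalPowerSeries (SmoothFamily V e) (MvPowerSeries (Fin e) ℝ)}
    {R : FunctionalPowerSeries (SmoothFamily V e) (MvPowerSeries (Fin e) ℝ)}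
    (h : SolvesGeneralParam V e S q y R) (hV : IsOpen V) (hS : linearPart S ∈ V)
    (G : SmoothFamily V e) :
    (fun i => (q i).paramSeries G) = solutionQ S (scaledParam G.1) ∧
    (fun i => (y i).paramSeries G) = solutionY S (scaledParam G.1) ∧
    R.paramSeries G = resultOf S (scaledParam G.1) (solutionQ S (scaledParam G.1))
      (solutionY S (scaledParam G.1)) := by
  have hL := scaledParam_isLinearFamily G
  obtain ⟨h1, h2⟩ := (h G).1.unique hL (solvesSystem_solution hV hL hS)
  exact ⟨h1, h2, by rw [(h G).2, h1, h2]⟩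

theorem existsUnique_solvesGeneralParam (e : ℕ) (hV : IsOpen V) (hS : linearPart S ∈ V) :
    ∃! p : (Fin d → FunctionalPowerSeries (SmoothFamily V e) (MvPowerSeries (Fin e) ℝ)) ×
      (Fin d → FunctionalPowerSeries (SmoothFamily V e) (MvPowerSeries (Fin e) ℝ)) ×
      FunctionalPowerSeries (SmoothFamily V e) (MvPowerSeries (Fin e) ℝ),
      SolvesGeneralParam V e S p.1 p.2.1 p.2.2 := by
  have hL : ∀ G, IsLinearFamily (Finsupp.applyAddHom none) V (scaledParamMap V e G) :=
    fun G => scaledParam_isLinearFamily G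
  refine ⟨(fun i => (isHomogeneousSeries_solutionQ hV hL hS i).toParamFunctional,
    fun i => (isHomogeneousSeries_solutionY hV hL hS i).toParamFunctional,
    (isHomogeneousSeries_resultOf hV hL hS).toParamFunctional), fun G => ?_, ?_⟩
  · simp only [IsHomogeneousSeries.paramSeries_toParamFunctional]
    exact ⟨solvesSystem_solution hV (hL G) hS, rfl⟩
  · rintro ⟨q, y, R⟩ h
    refine Prod.ext (funext fun i => ?_) (Prod.ext (funext fun i => ?_) ?_)
    · refine FunctionalPowerSeries.ext_paramSeries fun G => ?_
      rw [IsHomogeneousSeries.paramSeries_toParamFunctional]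
      exact congrFun (h.eq_solution hV hS G).1 i
    · refine FunctionalPowerSeries.ext_paramSeries fun G => ?_
      rw [IsHomogeneousSeries.paramSeries_toParamFunctional]
      exact congrFun (h.eq_solution hV hS G).2.1 i
    · refine FunctionalPowerSeries.ext_paramSeries fun G => ?_
      rw [IsHomogeneousSeries.paramSeries_toParamFunctional]
      exact (h.eq_solution hV hS G).2.2

theorem SolvesGeneralParam.hasFormalSum
    {q y : Fin d → FunctionalPowerSeries (SmoothFamily V e) (MvPowerSeries (Fin e) ℝ)}
    {R : FunctionalPowerSeries (SmoothFamily V e) (MvPowerSeries (Fin e) ℝ)}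
    (h : SolvesGeneralParam V e S q y R) (hV : IsOpen V) (hS : linearPart S ∈ V)
    (G : SmoothFamily V e) :
    HasFormalSum (fun t : WeightedTree => t.tree.labelFactor • t.contracted S G.1)
      (R.paramSeries G) ∧
    HasFormalSum (fun c : WeightedClass =>
      (1 / (c.rep.symCard : ℝ)) • c.rep.contracted S G.1) (R.paramSeries G) := by
  rw [(h.eq_solution hV hS G).2.2]
  exact ⟨hasFormalSum_contracted hV hS G, hasFormalSum_weightedClass
    (fun t t' ⟨f⟩ => contracted_iso S G.1 f) (hasFormalSum_contracted hV hS G)⟩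

theorem existsUnique_coordTransform (hV : IsOpen V) (hS : linearPart S ∈ V) {Y : Pt d → Pt d}
    (hY : ContDiffOn ℝ ∞ Y V) :
    ∃! p : (Fin d → MvPowerSeries (Fin d) ℝ) × (Fin d → MvPowerSeries (Fin d) ℝ) ×
      MvPowerSeries (Fin d) ℝ, SolvesSystem S (coordFamily Y) p.1 p.2.1 ∧
        p.2.2 = resultOf S (coordFamily Y) p.1 p.2.1 := by
  have hL := coordFamily_isLinearFamily hY
  refine ⟨(solutionQ S (coordFamily Y), solutionY S (coordFamily Y),
    resultOf S (coordFamily Y) (solutionQ S (coordFamily Y)) (solutionY S (coordFamily Y))),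
    ⟨solvesSystem_solution hV hL hS, rfl⟩, ?_⟩
  rintro ⟨q, y, R⟩ ⟨h, hR⟩
  obtain ⟨rfl, rfl⟩ := h.unique hL (solvesSystem_solution hV hL hS)
  exact Prod.ext rfl (Prod.ext rfl hR)

theorem SolvesSystem.hasFormalSum_coord (hV : IsOpen V) (hS : linearPart S ∈ V) {Y : Pt d → Pt d}
    (hY : ContDiffOn ℝ ∞ Y V) {q y : Fin d → MvPowerSeries (Fin d) ℝ}
    (h : SolvesSystem S (coordFamily Y) q y) :
    HasFormalSum (fun t : WhiteLeavedTree => t.1.labelFactor • t.1.coordContracted S Y)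
      (resultOf S (coordFamily Y) q y) ∧
    HasFormalSum (fun c : WhiteLeavedClass =>
      (1 / (c.rep.symCard : ℝ)) • c.rep.coordContracted S Y)
      (resultOf S (coordFamily Y) q y) := by
  have hL := coordFamily_isLinearFamily hY
  obtain ⟨rfl, rfl⟩ := h.unique hL (solvesSystem_solution hV hL hS)
  exact ⟨hasFormalSum_coordContracted hV hS hY, hasFormalSum_whiteLeavedClass
    (fun t t' ⟨f⟩ => coordContracted_iso S Y f) (hasFormalSum_coordContracted hV hS hY)⟩

theorem existsUnique_pointwise {X A B C : Type} {P : X → A → B → C → Prop}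
    (h : ∀ x, ∃! p : A × B × C, P x p.1 p.2.1 p.2.2) :
    ∃! p : (X → A) × (X → B) × (X → C), ∀ x, P x (p.1 x) (p.2.1 x) (p.2.2 x) := by
  choose p hp hu using h
  refine ⟨(fun x => (p x).1, fun x => (p x).2.1, fun x => (p x).2.2), hp, ?_⟩
  rintro ⟨a, b, c⟩ h
  have : ∀ x, (a x, b x, c x) = p x := fun x => hu x _ (h x)
  exact Prod.ext (funext fun x => congrArg Prod.fst (this x))
    (Prod.ext (funext fun x => congrArg (fun q => q.2.1) (this x))
      (funext fun x => congrArg (fun q => q.2.2) (this x)))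

end Existence
end Thick
end

/-! ### The theorem. -/

open Thick in
theorem proposition1 :
    -- the general equation
    (∀ (d : ℕ) (V : Set (Pt d)) (_ : IsOpen V) (S : MvPowerSeries (Fin d) ℝ)
      (_ : linearPart S ∈ V),
      (∃! p : (Fin d → FunctionalPowerSeries (SmoothFn V) ℝ) ×
          (Fin d → FunctionalPowerSeries (SmoothFn V) ℝ) ×
          FunctionalPowerSeries (SmoothFn V) ℝ, SolvesGeneral V S p.1 p.2.1 p.2.2) ∧
      ∀ q y R, SolvesGeneral V S q y R → ∀ G : SmoothFn V,
        HasFormalSum (fun t : WhiteLeavedTree => t.1.labelFactor • t.1.ordered S G.1)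
          (R.series G) ∧
        HasFormalSum (fun c : WhiteLeavedClass =>
          (1 / (c.rep.symCard : ℝ)) • c.rep.ordered S G.1) (R.series G)) ∧
    -- isomorphic trees have equal terms, and the number of trees isomorphic to a given one
    (∀ (d : ℕ) (V : Set (Pt d)) (_ : IsOpen V) (S : MvPowerSeries (Fin d) ℝ)
      (_ : linearPart S ∈ V) (G : SmoothFn V) (t t' : BipartiteTree),
      Nonempty (BipartiteTree.Iso t t') → t.term S G.1 = t'.term S G.1) ∧
    (∀ t : BipartiteTree,
      Finite {t' : BipartiteTree // Nonempty (BipartiteTree.Iso t t')} ∧ 0 < t.symCard ∧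
      (Nat.card {t' : BipartiteTree // Nonempty (BipartiteTree.Iso t t')} : ℝ) =
        (t.nW.factorial * t.nB.factorial : ℝ) / (t.symCard : ℝ)) ∧
    -- pullbacks
    (∀ (m d : ℕ) (U : Set (Pt m)) (V : Set (Pt d)) (_ : IsOpen U) (_ : IsOpen V)
      (S : GeneratingFunction U V),
      (∃! p : (U → Fin d → FunctionalPowerSeries (SmoothFn V) ℝ) ×
          (U → Fin d → FunctionalPowerSeries (SmoothFn V) ℝ) ×
          (U → FunctionalPowerSeries (SmoothFn V) ℝ), IsPullback S p.1 p.2.1 p.2.2) ∧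
      ∀ q y P, IsPullback S q y P → ∀ (g : SmoothFn V) (x : U),
        HasFormalSum (fun t : WhiteLeavedTree =>
          t.1.labelFactor • t.1.ordered (S.toFun x) g.1) ((P x).series g) ∧
        HasFormalSum (fun c : WhiteLeavedClass =>
          (1 / (c.rep.symCard : ℝ)) • c.rep.ordered (S.toFun x) g.1) ((P x).series g)) ∧
    -- compositions
    (∀ (m d e : ℕ) (U : Set (Pt m)) (V : Set (Pt d)) (_ : IsOpen U) (_ : IsOpen V)
      (F : GeneratingFunction U V),
      (∃! p : (U → Fin d →
            FunctionalPowerSeries (SmoothFamily V e) (MvPowerSeries (Fin e) ℝ)) ×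
          (U → Fin d →
            FunctionalPowerSeries (SmoothFamily V e) (MvPowerSeries (Fin e) ℝ)) ×
          (U → FunctionalPowerSeries (SmoothFamily V e) (MvPowerSeries (Fin e) ℝ)),
        IsComposition e F p.1 p.2.1 p.2.2) ∧
      ∀ q y H, IsComposition e F q y H → ∀ (G : SmoothFamily V e) (x : U),
        HasFormalSum (fun t : WeightedTree =>
          t.tree.labelFactor • t.contracted (F.toFun x) G.1) ((H x).paramSeries G) ∧
        HasFormalSum (fun c : WeightedClass =>
          (1 / (c.rep.symCard : ℝ)) • c.rep.contracted (F.toFun x) G.1)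
          ((H x).paramSeries G)) ∧
    -- coordinate transformations
    (∀ (m d : ℕ) (U : Set (Pt m)) (V : Set (Pt d)) (S : GeneratingFunction U V)
      (X : OpenPartialHomeomorph (Pt m) (Pt m)) (Y : OpenPartialHomeomorph (Pt d) (Pt d)),
      IsCoordChange X → X.target = U → IsCoordChange Y → Y.source = V →
      (∃! p : (X.source → Fin d → MvPowerSeries (Fin d) ℝ) ×
          (X.source → Fin d → MvPowerSeries (Fin d) ℝ) ×
          (X.source → MvPowerSeries (Fin d) ℝ), IsCoordTransform S X Y p.1 p.2.1 p.2.2) ∧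
      ∀ q y S', IsCoordTransform S X Y q y S' → ∀ x' : X.source,
        HasFormalSum (fun t : WhiteLeavedTree =>
          t.1.labelFactor • t.1.coordContracted (S.toFun (X x')) Y) (S' x') ∧
        HasFormalSum (fun c : WhiteLeavedClass =>
          (1 / (c.rep.symCard : ℝ)) • c.rep.coordContracted (S.toFun (X x')) Y) (S' x')) := by
  refine ⟨fun d V hV S hS => ⟨existsUnique_solvesGeneral hV hS, fun q y R h G =>
    h.hasFormalSum hV hS G⟩, fun d V _ S _ G t t' ⟨f⟩ => term_iso S G.1 f, fun t => ?_,
    fun m d U V _ hV S => ⟨existsUnique_pointwise fun x =>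
      existsUnique_solvesGeneral hV (S.mapsTo x x.2), fun q y P h g x =>
        (h x).hasFormalSum hV (S.mapsTo x x.2) g⟩,
    fun m d e U V _ hV F => ⟨existsUnique_pointwise fun x =>
      existsUnique_solvesGeneralParam e hV (F.mapsTo x x.2), fun q y H h G x =>
        (h x).hasFormalSum hV (F.mapsTo x x.2) G⟩, ?_⟩
  · obtain ⟨h1, h2, h3⟩ := t.card_iso_class
    have h4 : (t.symCard : ℝ) ≠ 0 := by positivity
    refine ⟨h1, h2, ?_⟩
    rw [eq_div_iff h4, mul_comm (t.nW.factorial : ℝ)]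
    exact_mod_cast h3
  -- At each point `x'` this is the power series system for the family `Y^a q'_a`, with the total
  -- degree in `q'` as grading.
  · rintro m d U V S X Y - rfl hY rfl
    have hS : ∀ x' : X.source, linearPart (S.toFun (X x')) ∈ Y.source :=
      fun x' => S.mapsTo _ (X.map_source x'.2)
    refine ⟨existsUnique_pointwise (P := fun (x' : X.source) q y R =>
      SolvesSystem (S.toFun (X x')) (coordFamily Y) q y ∧
        R = resultOf (S.toFun (X x')) (coordFamily Y) q y) fun x' =>
      existsUnique_coordTransform Y.open_source (hS x') hY.1, fun q y S' h x' => ?_⟩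
    rw [(h x').2]
    exact (h x').1.hasFormalSum_coord Y.open_source (hS x') hY.1
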